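/- Let $k$ be a finite field with $q$ elements, $t=+\sqrt q$, and let $\mathcal A$ be an abelian category such that: (a) $\mathcal A$ is essentially small with finite morphism sets; (b) $\mathcal A$ is $k$-linear; (c) $\mathcal A$ has enough projectives and finite global dimension; (d) $\mathcal A$ is hereditary (global dimension at most $1$); (e) nonzero objects have nonzero class in the Grothendieck group $K(\mathcal A)$. Assume moreover that $\mathcal A$ is artinian or noetherian, that is, either every object of $\mathcal A$ is artinian or every object is noetherian. Write $\langle\cdot,\cdot\rangle$ for the Euler form $\sum_i(-1)^i\dim_k\operatorname{Ext}^i_{\mathcal A}(\cdot,\cdot)$ on $K(\mathcal A)$ and $(\alpha,\beta)=\langle\alpha,\beta\rangle+\langle\beta,\alpha\rangle$. All algebras are associative, unital, over $\mathbb C$. *The localized Hall algebra.* Let $\mathcal C(\mathcal P)$ be the category of $\mathbb Z/2$-graded complexes $M_1\rightleftarrows M_0$ of projective objects of $\mathcal A$, inside the abelian category $\mathcal C(\mathcal A)$ of all $\mathbb Z/2$-graded complexes in $\mathcal A$. The twisted Hall algebra $\mathcal H_{\rm tw}(\mathcal C(\mathcal P))$ has as basis the isomorphism classes $[M]$ of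 objects of $\mathcal C(\mathcal P)$, unit $[0]$ and product $$[M]*[N]=t^{\langle M_0,N_0\rangle+\langle M_1,N_1\rangle}\sum_{R}\frac{|\operatorname{Ext}^1_{\mathcal C(\mathcal A)}(M,N)_R|}{|\operatorname{Hom}_{\mathcal C(\mathcal A)}(M,N)|}\,[R],$$ where $\operatorname{Ext}^1(M,N)_R$ is the set of classes of extensions $0\to N\to R'\to M\to 0$ with $R'\cong R$. Then $\mathcal{DH}(\mathcal A)$ is obtained from it by inverting $[M]$ for all acyclic $M$, and $\mathcal{DH}_{\rm red}(\mathcal A)$ is the quotient of $\mathcal{DH}(\mathcal A)$ by the two-sided ideal generated by the elements $[M]-1$ with $M$ acyclic and isomorphic to its shift $M^\dagger$. *The extended Hall bialgebra.* $H=\mathcal H^{e}_{\rm tw}(\mathcal A)$ has basis $[A]*K_\alpha$ ($A$ an isomorphism class of objects of $\mathcal A$, $\alpha\in K(\mathcal A)$), unit $[0]*K_0$, and product determined by $$[A]*[C]=t^{\langle A,C\rangle}\sum_B\frac{|\operatorname{Ext}^1_{\mathcal A}(A,C)_B|}{|\operatorname{Hom}_{\mathcal A}(A,C)|}[B],\qquad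 K_\alpha*K_\beta=K_{\alpha+\beta},\qquad K_\alpha*[B]=t^{(\alpha,B)}[B]*K_\alpha.$$ It carries Green's (topological) coproduct and pairing $$\Delta([B]K_\alpha)=\sum_{C'\subseteq B}t^{\langle B/C',C'\rangle}\,[B/C']K_{C'+\alpha}\otimes[C']K_\alpha,\qquad ([A]K_\alpha,[B]K_\beta)=\delta_{A,B}\,|\operatorname{Aut}A|\,t^{(\alpha,\beta)}.$$ *The Drinfeld double.* $D(H)$ is the algebra generated by two copies $H^+,H^-$ of the algebra $H$ subject to the relations $$\sum (a_{(2)},b_{(1)})\,a_{(1)}^{+}\,b_{(2)}^{-}=\sum (a_{(1)},b_{(2)})\,b_{(1)}^{-}\,a_{(2)}^{+}\qquad(a,b\in H),$$ and the reduced Drinfeld double $D_{\rm red}(H)$ is its quotient by the relations $K_\alpha^+K_\alpha^-=1$ ($\alpha\in K(\mathcal A)$). **Theorem.** Under these assumptions the multiplication map $H\otimes_{\mathbb C}H\to D(H)$, $a\otimes b\mapsto a^+b^-$, is an isomorphism of vector spaces (so that $D(H)$ is the vector space $H\otimes H$ with the Drinfeld double product); the algebra $\mathcal{DH}(\mathcal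 A)$ is isomorphic to $D(H)$; and the algebra $\mathcal{DH}_{\rm red}(\mathcal A)$ is isomorphic to $D_{\rm red}(H)$. -/

import Mathlib

open CategoryTheory Limits
open scoped TensorProduct ZeroObject

universe w v u

namespace HallDouble

noncomputable section

/-! ### Finiteness conditions on an abelian category -/

/-- All morphism sets are finite. -/
class HomFinite (A : Type u) [Category.{v} A] : Prop where
  finite_hom : ∀ X Y : A, Finite (X ⟶ Y)

/-- Finite global dimension: the projective dimensions of all objects are bounded. -/
class FiniteGlobalDimension (A : Type u) [Category.{v} A] [Abelian A] : Prop where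
  exists_bound : ∃ n : ℕ, ∀ X : A, HasProjectiveDimensionLT X n

/-- Global dimension at most one. -/
def Hereditary (A : Type u) [Category.{v} A] [Abelian A] : Prop :=
  ∀ X : A, HasProjectiveDimensionLE X 1

/-! ### Grothendieck group -/

section Grothendieck

variable (A : Type u) [Category.{v} A] [Abelian A]

/-- The subgroup generated by `[X₂] - [X₁] - [X₃]` for short exact sequences
`0 ⟶ X₁ ⟶ X₂ ⟶ X₃ ⟶ 0`. -/
def grothendieckRelations : AddSubgroup (FreeAbelianGroup A) :=
  AddSubgroup.closure {x | ∃ S : ShortComplex A, S.ShortExact ∧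
    x = FreeAbelianGroup.of S.X₂ - FreeAbelianGroup.of S.X₁ - FreeAbelianGroup.of S.X₃}

/-- The Grothendieck group `K(A)`. -/
abbrev K0 : Type u := FreeAbelianGroup A ⧸ grothendieckRelations A

variable {A}

/-- The class of an object in `K(A)`. -/
def cls (X : A) : K0 A := QuotientAddGroup.mk (FreeAbelianGroup.of X)

/-- A function on objects that is additive on short exact sequences extends to `K(A)`. -/
def K0.lift {G : Type*} [AddCommGroup G] (f : A → G)
    (hf : ∀ S : ShortComplex A, S.ShortExact → f S.X₂ = f S.X₁ + f S.X₃) : K0 A →+ G :=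
  QuotientAddGroup.lift (grothendieckRelations A) (FreeAbelianGroup.lift f) (by
    rw [grothendieckRelations, AddSubgroup.closure_le]
    rintro x ⟨S, hS, rfl⟩
    simp [hf S hS])

@[simp]
lemma K0.lift_cls {G : Type*} [AddCommGroup G] (f : A → G)
    (hf : ∀ S : ShortComplex A, S.ShortExact → f S.X₂ = f S.X₁ + f S.X₃) (X : A) :
    K0.lift f hf (cls X) = f X := by
  simp [K0.lift, cls]

lemma K0.hom_ext {G : Type*} [AddCommGroup G] {f g : K0 A →+ G}
    (h : ∀ X : A, f (cls X) = g (cls X)) : f = g := by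
  apply QuotientAddGroup.addMonoidHom_ext
  apply FreeAbelianGroup.lift_ext
  exact h

end Grothendieck

/-! ### Euler form -/

section LinearAlgebra

open Module

variable {k : Type w} [Field k]

/-- In a bounded long exact sequence of finite-dimensional spaces the alternating sum of the
dimensions is zero. -/
lemma alternating_sum_of_exact {V₁ V₂ V₃ : ℕ → Type*}
    [∀ n, AddCommGroup (V₁ n)] [∀ n, AddCommGroup (V₂ n)] [∀ n, AddCommGroup (V₃ n)]
    [∀ n, Module k (V₁ n)] [∀ n, Module k (V₂ n)] [∀ n, Module k (V₃ n)]
    [∀ n, Module.Finite k (V₁ n)] [∀ n, Module.Finite k (V₂ n)] [∀ n, Module.Finite k (V₃ n)]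
    (f : ∀ n, V₁ n →ₗ[k] V₂ n) (g : ∀ n, V₂ n →ₗ[k] V₃ n) (δ : ∀ n, V₃ n →ₗ[k] V₁ (n + 1))
    (hf : Function.Injective (f 0)) (hfg : ∀ n, Function.Exact (f n) (g n))
    (hgd : ∀ n, Function.Exact (g n) (δ n)) (hdf : ∀ n, Function.Exact (δ n) (f (n + 1)))
    (m : ℕ) (hm : Subsingleton (V₃ m)) :
    ∑ n ∈ Finset.range (m + 1), (-1 : ℤ) ^ n * finrank k (V₂ n) =
      ∑ n ∈ Finset.range (m + 1), (-1 : ℤ) ^ n * finrank k (V₁ n) +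
      ∑ n ∈ Finset.range (m + 1), (-1 : ℤ) ^ n * finrank k (V₃ n) := by
  have e2 : ∀ n, finrank k (V₂ n) =
      finrank k (LinearMap.range (g n)) + finrank k (LinearMap.range (f n)) := fun n => by
    rw [← (hfg n).linearMap_ker_eq, LinearMap.finrank_range_add_finrank_ker]
  have e3 : ∀ n, finrank k (V₃ n) =
      finrank k (LinearMap.range (δ n)) + finrank k (LinearMap.range (g n)) := fun n => by
    rw [← (hgd n).linearMap_ker_eq, LinearMap.finrank_range_add_finrank_ker]
  have e1 : ∀ n, finrank k (V₁ (n + 1)) =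
      finrank k (LinearMap.range (f (n + 1))) + finrank k (LinearMap.range (δ n)) := fun n => by
    rw [← (hdf n).linearMap_ker_eq, LinearMap.finrank_range_add_finrank_ker]
  have e0 : finrank k (V₁ 0) = finrank k (LinearMap.range (f 0)) :=
    (LinearMap.finrank_range_of_inj hf).symm
  have key : ∀ m : ℕ, ∑ n ∈ Finset.range (m + 1), (-1 : ℤ) ^ n * finrank k (V₂ n) =
      ∑ n ∈ Finset.range (m + 1), (-1 : ℤ) ^ n * finrank k (V₁ n) +
      ∑ n ∈ Finset.range (m + 1), (-1 : ℤ) ^ n * finrank k (V₃ n) -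
        (-1 : ℤ) ^ m * finrank k (LinearMap.range (δ m)) := by
    intro m
    induction m with
    | zero => simp [e0, e2 0, e3 0]; ring
    | succ m ih =>
      rw [Finset.sum_range_succ, ih, Finset.sum_range_succ _ (m + 1),
        Finset.sum_range_succ _ (m + 1), e1 m, e2 (m + 1), e3 (m + 1)]
      push_cast
      ring
  have hz : finrank k (LinearMap.range (δ m)) = 0 := by
    have := e3 m
    rw [finrank_zero_of_subsingleton] at this
    omega
  rw [key m, hz]
  simp

end LinearAlgebra

section Euler

open Abelian

variable (k : Type w) [Field k] {A : Type u} [Category.{v} A] [Abelian A] [Linear k A]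

/-- `dim_k Ext^i(X, Y)`. -/
def extDim (X Y : A) (i : ℕ) : ℕ :=
  haveI := HasExt.standard A
  Module.finrank k (Ext.{max u v} X Y i)

/-- The Euler form `⟨X, Y⟩ = ∑ᵢ (-1)ⁱ dim_k Extⁱ(X, Y)` of two objects. -/
def eulerChar (X Y : A) : ℤ := ∑ᶠ i : ℕ, (-1 : ℤ) ^ i * (extDim k X Y i : ℤ)

lemma finite_ext [Finite k] [HomFinite A] [EnoughProjectives A] [HasExt.{max u v} A] (n : ℕ) :
    ∀ X Y : A, Module.Finite k (Ext.{max u v} X Y n) := by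
  induction n with
  | zero =>
    intro X Y
    have := HomFinite.finite_hom X Y
    have : Module.Finite k (X ⟶ Y) := Module.Finite.of_finite
    exact Module.Finite.equiv (Ext.linearEquiv₀ (R := k) (X := X) (Y := Y)).symm
  | succ n ih =>
    intro X Y
    let S : ShortComplex A := ShortComplex.mk (kernel.ι (Projective.π X)) (Projective.π X)
      (kernel.condition _)
    have hS : S.ShortExact :=
      { exact := ShortComplex.exact_of_f_is_kernel _ (kernelIsKernel _)
        mono_f := by dsimp [S]; infer_instance
        epi_g := by dsimp [S]; infer_instance }
    have := ih S.X₁ Y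
    have hsurj : Function.Surjective
        (Ext.precompOfLinear hS.extClass k Y (show 1 + n = n + 1 by omega)) := by
      intro x
      have hP : Projective S.X₂ := by dsimp [S]; infer_instance
      obtain ⟨y, hy⟩ := Ext.contravariant_sequence_exact₃ hS Y x
        (Ext.eq_zero_of_projective _) (show 1 + n = n + 1 by omega)
      exact ⟨y, hy⟩
    exact Module.Finite.of_surjective _ hsurj

lemma exists_eulerChar_eq [FiniteGlobalDimension A] : ∃ N : ℕ, (∀ X : A, HasProjectiveDimensionLT X N) ∧
    ∀ X Y : A, eulerChar k X Y =
      ∑ n ∈ Finset.range (N + 1), (-1 : ℤ) ^ n * (extDim k X Y n : ℤ) := by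
  obtain ⟨N, hN⟩ := FiniteGlobalDimension.exists_bound (A := A)
  refine ⟨N, hN, fun X Y => finsum_eq_sum_of_support_subset _ ?_⟩
  intro n hn
  by_contra h
  have := HasExt.standard A
  have := hN X
  have := HasProjectiveDimensionLT.subsingleton.{max u v} X N n (by simp at h; omega) Y
  apply hn
  simp [extDim, Module.finrank_zero_of_subsingleton]

variable [Finite k] [HomFinite A] [EnoughProjectives A] [FiniteGlobalDimension A]

lemma eulerChar_additive_right (X : A) (S : ShortComplex A) (hS : S.ShortExact) :
    eulerChar k X S.X₂ = eulerChar k X S.X₁ + eulerChar k X S.X₃ := by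
  obtain ⟨N, hN, h⟩ := exists_eulerChar_eq k (A := A)
  have := HasExt.standard A
  have := fun n (X Y : A) => finite_ext k n X Y
  have := hN X
  simp only [h]
  refine alternating_sum_of_exact (k := k) (V₁ := fun n => Ext.{max u v} X S.X₁ n)
    (V₂ := fun n => Ext.{max u v} X S.X₂ n) (V₃ := fun n => Ext.{max u v} X S.X₃ n)
    (fun n => Ext.postcompOfLinear (Ext.mk₀ S.f) k X (add_zero n))
    (fun n => Ext.postcompOfLinear (Ext.mk₀ S.g) k X (add_zero n))
    (fun n => Ext.postcompOfLinear hS.extClass k X rfl) ?_ ?_ ?_ ?_ N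
    (HasProjectiveDimensionLT.subsingleton.{max u v} X N N le_rfl _)
  · have := hS.mono_f
    exact Ext.postcomp_mk₀_injective_of_mono X S.f
  · exact fun n => (ShortComplex.ab_exact_iff_function_exact _).1
      (Ext.covariant_sequence_exact₂' X hS n)
  · exact fun n => (ShortComplex.ab_exact_iff_function_exact _).1
      (Ext.covariant_sequence_exact₃' X hS n (n + 1) rfl)
  · exact fun n => (ShortComplex.ab_exact_iff_function_exact _).1
      (Ext.covariant_sequence_exact₁' X hS n (n + 1) rfl)

lemma eulerChar_additive_left (Y : A) (S : ShortComplex A) (hS : S.ShortExact) :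
    eulerChar k S.X₂ Y = eulerChar k S.X₁ Y + eulerChar k S.X₃ Y := by
  obtain ⟨N, hN, h⟩ := exists_eulerChar_eq k (A := A)
  have := HasExt.standard A
  have := fun n (X Y : A) => finite_ext k n X Y
  have := hN S.X₁
  simp only [h]
  refine Eq.trans (alternating_sum_of_exact (k := k) (V₁ := fun n => Ext.{max u v} S.X₃ Y n)
    (V₂ := fun n => Ext.{max u v} S.X₂ Y n) (V₃ := fun n => Ext.{max u v} S.X₁ Y n)
    (fun n => Ext.precompOfLinear (Ext.mk₀ S.g) k Y (zero_add n))
    (fun n => Ext.precompOfLinear (Ext.mk₀ S.f) k Y (zero_add n))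
    (fun n => Ext.precompOfLinear hS.extClass k Y (add_comm 1 n)) ?_ ?_ ?_ ?_ N
    (HasProjectiveDimensionLT.subsingleton.{max u v} S.X₁ N N le_rfl _)) (add_comm _ _)
  · have := hS.epi_g
    exact Ext.precomp_mk₀_injective_of_epi Y S.g
  · exact fun n => (ShortComplex.ab_exact_iff_function_exact _).1
      (Ext.contravariant_sequence_exact₂' hS Y n)
  · exact fun n => (ShortComplex.ab_exact_iff_function_exact _).1
      (Ext.contravariant_sequence_exact₁' hS Y n (n + 1) (add_comm 1 n))
  · exact fun n => (ShortComplex.ab_exact_iff_function_exact _).1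
      (Ext.contravariant_sequence_exact₃' hS Y n (n + 1) (add_comm 1 n))

/-- The Euler form as a bilinear form on `K(A)`. -/
def eulerForm : K0 A →+ K0 A →+ ℤ :=
  K0.lift (fun X => K0.lift (fun Y => eulerChar k X Y) (eulerChar_additive_right k X))
    (fun S hS => K0.hom_ext fun Y => by simp [eulerChar_additive_left k Y S hS])

/-- The symmetrised Euler form `(α, β) = ⟨α, β⟩ + ⟨β, α⟩`. -/
def symForm (α β : K0 A) : ℤ := eulerForm k α β + eulerForm k β α

end Euler

/-! ### Hall numbers -/

section Hall

/-- `Iso(C)`: the isomorphism classes of objects of a category. -/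
abbrev IsoClasses (C : Type u) [Category.{v} C] : Type u := Quotient (isIsomorphicSetoid C)

/-- The isomorphism class of an object. -/
def isoClass {C : Type u} [Category.{v} C] (X : C) : IsoClasses C :=
  Quotient.mk (isIsomorphicSetoid C) X

/-- A representative of an isomorphism class. All the numbers below depend only on the
isomorphism class of their arguments. -/
def rep {C : Type u} [Category.{v} C] (X : IsoClasses C) : C := Quotient.out X

variable {C : Type u} [Category.{v} C] [Abelian C]

/-- The number of elements of `Ext¹(X, Z)_Y`, the set of classes in `Ext¹(X, Z)` of extensions
`0 ⟶ Z ⟶ Y ⟶ X ⟶ 0` with middle term (isomorphic to) `Y`. -/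
def extCount (X Z Y : C) : ℕ :=
  haveI := HasExt.standard C
  Nat.card {e : Abelian.Ext.{max u v} X Z 1 // ∃ (i : Z ⟶ Y) (p : Y ⟶ X) (w : i ≫ p = 0)
    (h : (ShortComplex.mk i p w).ShortExact), h.extClass = e}

/-- The structure constant `|Ext¹(X, Z)_Y| / |Hom(X, Z)|` of the Hall product. -/
def hallCoeff (X Z Y : C) : ℂ := (extCount X Z Y : ℂ) / (Nat.card (X ⟶ Z) : ℂ)

/-- The number of subobjects `Z'` of `Y` with `Z' ≅ Z` and `Y / Z' ≅ X`. -/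
def subobjectCount (X Z Y : C) : ℕ :=
  Nat.card {S : Subobject Y // Nonempty ((S : C) ≅ Z) ∧ Nonempty (cokernel S.arrow ≅ X)}

end Hall

/-! ### The extended twisted Hall algebra, Green's coproduct and Green's pairing

The space `ExtHall A` has the basis `[B] * K_α`, indexed by `B ∈ Iso(A)` and `α ∈ K(A)`. -/

/-- The positive square root `t` of `q = |k|`. -/
def tt (k : Type w) : ℂ := ((Real.sqrt (Nat.card k) : ℝ) : ℂ)

section Extended

variable (A : Type u) [Category.{v} A] [Abelian A]

/-- Index set of the basis `[B] * K_α` of the extended Hall algebra. -/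
abbrev ExtIndex : Type u := IsoClasses A × K0 A

/-- The underlying vector space of the extended twisted Hall algebra. -/
abbrev ExtHall : Type u := ExtIndex A →₀ ℂ

variable {A}

/-- The class in `K(A)` of an isomorphism class of objects. -/
def isoCls (X : IsoClasses A) : K0 A := cls (rep X)

variable (k : Type w) [Field k] [Linear k A]
  [Finite k] [HomFinite A] [EnoughProjectives A] [FiniteGlobalDimension A]

/-- Product of two basis elements:
`([X] K_α) * ([Z] K_β) = t^{(α, Z)} [X] * [Z] * K_{α + β}` with
`[X] * [Z] = t^{⟨X, Z⟩} ∑_Y |Ext¹(X, Z)_Y| / |Hom(X, Z)| [Y]`. The sum is finite. -/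
def extMul (x z : ExtIndex A) : ExtHall A :=
  ∑ᶠ Y : IsoClasses A, Finsupp.single (Y, x.2 + z.2)
    (tt k ^ (symForm k x.2 (isoCls z.1) + eulerForm k (isoCls x.1) (isoCls z.1)) *
      hallCoeff (rep x.1) (rep z.1) (rep Y))

/-- The unit `[0] * K_0`, as a basis index. -/
def extOne : ExtIndex A := (isoClass 0, 0)

open scoped Classical in
/-- The coefficient of `y ⊗ z` in the coproduct of the basis element `x`. Here
`Δ([Y] K_α) = ∑_{Z' ⊆ Y} t^{⟨Y/Z', Z'⟩} [Y/Z'] K_{Z' + α} ⊗ [Z'] K_α`, which in general is an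
infinite sum, that is, an element of a completion of the tensor square. -/
def coproductCoeff (x y z : ExtIndex A) : ℂ :=
  if y.2 = isoCls z.1 + x.2 ∧ z.2 = x.2 then
    tt k ^ (eulerForm k (isoCls y.1) (isoCls z.1)) *
      (subobjectCount (rep y.1) (rep z.1) (rep x.1) : ℂ)
  else 0

open scoped Classical in
/-- Green's pairing `([X] K_α, [Y] K_β) = δ_{X, Y} |Aut X| t^{(α, β)}`. -/
def greenPairing (x y : ExtIndex A) : ℂ :=
  if x.1 = y.1 then (Nat.card (Aut (rep x.1)) : ℂ) * tt k ^ (symForm k x.2 y.2) else 0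

end Extended

/-! ### The Drinfeld double -/

section Double

variable (k : Type w) [Field k] (A : Type u) [Category.{v} A] [Abelian A] [Linear k A]
  [Finite k] [HomFinite A] [EnoughProjectives A] [FiniteGlobalDimension A]

/-- Free algebra on two copies (`inl`: positive, `inr`: negative) of the basis of the extended
twisted Hall algebra. -/
abbrev DoubleFree : Type u := FreeAlgebra ℂ (ExtIndex A ⊕ ExtIndex A)

variable {A} in
/-- The positive basis element `x⁺`. -/
def freePos (x : ExtIndex A) : DoubleFree A := FreeAlgebra.ι ℂ (Sum.inl x)

variable {A} in
/-- The negative basis element `x⁻`. -/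
def freeNeg (x : ExtIndex A) : DoubleFree A := FreeAlgebra.ι ℂ (Sum.inr x)

/-- The relations of the Drinfeld double: both copies multiply as in the extended twisted Hall
algebra, and
`∑ (a₍₂₎, b₍₁₎) a₍₁₎⁺ b₍₂₎⁻ = ∑ (a₍₁₎, b₍₂₎) b₍₁₎⁻ a₍₂₎⁺`
for all basis elements (hence for all elements) `a` and `b`. Both sums are finite. -/
inductive DoubleRel : DoubleFree A → DoubleFree A → Prop
  | one_pos : DoubleRel (freePos extOne) 1
  | one_neg : DoubleRel (freeNeg extOne) 1
  | mul_pos (x y : ExtIndex A) : DoubleRel (freePos x * freePos y)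
      (Finsupp.linearCombination ℂ freePos (extMul k x y))
  | mul_neg (x y : ExtIndex A) : DoubleRel (freeNeg x * freeNeg y)
      (Finsupp.linearCombination ℂ freeNeg (extMul k x y))
  | cross (a b : ExtIndex A) : DoubleRel
      (∑ᶠ p : (ExtIndex A × ExtIndex A) × (ExtIndex A × ExtIndex A),
        (coproductCoeff k a p.1.1 p.1.2 * coproductCoeff k b p.2.1 p.2.2 *
          greenPairing k p.1.2 p.2.1) • (freePos p.1.1 * freeNeg p.2.2))
      (∑ᶠ p : (ExtIndex A × ExtIndex A) × (ExtIndex A × ExtIndex A),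
        (coproductCoeff k a p.1.1 p.1.2 * coproductCoeff k b p.2.1 p.2.2 *
          greenPairing k p.1.1 p.2.2) • (freeNeg p.2.1 * freePos p.1.2))

/-- The Drinfeld double of the extended twisted Hall bialgebra. -/
abbrev DrinfeldDouble : Type u := RingQuot (DoubleRel k A)

/-- The map `H ⟶ D`, `a ↦ a⁺`. -/
def toDoublePos : ExtHall A →ₗ[ℂ] DrinfeldDouble k A :=
  (RingQuot.mkAlgHom ℂ (DoubleRel k A)).toLinearMap ∘ₗ Finsupp.linearCombination ℂ freePos

/-- The map `H ⟶ D`, `b ↦ b⁻`. -/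
def toDoubleNeg : ExtHall A →ₗ[ℂ] DrinfeldDouble k A :=
  (RingQuot.mkAlgHom ℂ (DoubleRel k A)).toLinearMap ∘ₗ Finsupp.linearCombination ℂ freeNeg

/-- The multiplication map `H ⊗ H ⟶ D`, `a ⊗ b ↦ a⁺ b⁻`. -/
def doubleMulMap : ExtHall A ⊗[ℂ] ExtHall A →ₗ[ℂ] DrinfeldDouble k A :=
  TensorProduct.lift
    ((LinearMap.mul ℂ (DrinfeldDouble k A)).compl₁₂ (toDoublePos k A) (toDoubleNeg k A))

/-- The relations `K_α⁺ K_α⁻ = 1`. -/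
inductive ReducedDoubleRel : DrinfeldDouble k A → DrinfeldDouble k A → Prop
  | torus (α : K0 A) : ReducedDoubleRel
      (toDoublePos k A (Finsupp.single (isoClass 0, α) 1) *
        toDoubleNeg k A (Finsupp.single (isoClass 0, α) 1)) 1

/-- The reduced Drinfeld double. -/
abbrev ReducedDrinfeldDouble : Type u := RingQuot (ReducedDoubleRel k A)

end Double

/-! ### `ℤ/2`-graded complexes and the localized Hall algebra -/

section Complexes

variable (A : Type u) [Category.{v} A] [Abelian A]

/-- `ℤ/2`-graded complexes in `A`. -/
abbrev Z2Complex : Type (max u v) := HomologicalComplex A (ComplexShape.up (ZMod 2))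

variable {A} in
/-- The shift involution: it exchanges the degrees and changes the sign of the differential. -/
def dagger (M : Z2Complex A) : Z2Complex A where
  X i := M.X (i + 1)
  d i j := -M.d (i + 1) (j + 1)
  shape i j h := by
    rw [M.shape, neg_zero]
    intro h'
    apply h
    simp only [ComplexShape.up_Rel] at h' ⊢
    exact add_right_cancel h'

/-- The property of being a complex of projective objects. -/
def projectiveComplexes : ObjectProperty (Z2Complex A) := fun M => ∀ i, Projective (M.X i)

/-- The category `C(P)` of `ℤ/2`-graded complexes of projectives. -/
abbrev ProjComplex : Type (max u v) := (projectiveComplexes A).FullSubcategory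

/-- Index set of the basis `[M]` of the Hall algebra of `C(P)`. -/
abbrev ProjIndex : Type (max u v) := IsoClasses (ProjComplex A)

variable {A} in
/-- The underlying complex of a representative. -/
def repComplex (M : ProjIndex A) : Z2Complex A := (rep M).obj

/-- The isomorphism classes of acyclic complexes of projectives. -/
abbrev AcyclicIndex : Type (max u v) := {M : ProjIndex A // (repComplex M).Acyclic}

/-- The zero complex, as an object of `C(P)`. -/
def zeroComplex : ProjComplex A :=
  ⟨0, fun i => ((HomologicalComplex.eval A (ComplexShape.up (ZMod 2)) i).map_isZero
    (isZero_zero (Z2Complex A))).projective⟩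

variable {A}
variable (k : Type w) [Field k] [Linear k A]
  [Finite k] [HomFinite A] [EnoughProjectives A] [FiniteGlobalDimension A]

/-- Product of two basis elements of the twisted Hall algebra of `C(P)`:
`[M] * [N] = t^{⟨M₀, N₀⟩ + ⟨M₁, N₁⟩} ∑_R |Ext¹(M, N)_R| / |Hom(M, N)| [R]`, with `Ext¹` and
`Hom` taken in the abelian category of complexes. The sum is finite. -/
def complexMul (M N : ProjIndex A) : ProjIndex A →₀ ℂ :=
  ∑ᶠ R : ProjIndex A, Finsupp.single R
    (tt k ^ (eulerForm k (cls ((repComplex M).X 0)) (cls ((repComplex N).X 0)) +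
        eulerForm k (cls ((repComplex M).X 1)) (cls ((repComplex N).X 1))) *
      hallCoeff (repComplex M) (repComplex N) (repComplex R))

variable (A)

/-- Free algebra on the symbols `[M]` and, for acyclic `M`, `[M]⁻¹`. -/
abbrev DHFree : Type (max u v) := FreeAlgebra ℂ (ProjIndex A ⊕ AcyclicIndex A)

variable {A} in
/-- The generator `[M]`. -/
def freeGen (M : ProjIndex A) : DHFree A := FreeAlgebra.ι ℂ (Sum.inl M)

variable {A} in
/-- The generator `[M]⁻¹`. -/
def freeInv (M : AcyclicIndex A) : DHFree A := FreeAlgebra.ι ℂ (Sum.inr M)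

/-- The symbols `[M]` multiply as in the twisted Hall algebra of `C(P)`, and `[M]⁻¹` is a
two-sided inverse of `[M]`. -/
inductive DHRel : DHFree A → DHFree A → Prop
  | one : DHRel (freeGen (isoClass (zeroComplex A))) 1
  | mul (M N : ProjIndex A) : DHRel (freeGen M * freeGen N)
      (Finsupp.linearCombination ℂ freeGen (complexMul k M N))
  | mul_inv (M : AcyclicIndex A) : DHRel (freeGen M.1 * freeInv M) 1
  | inv_mul (M : AcyclicIndex A) : DHRel (freeInv M * freeGen M.1) 1

/-- The localized Hall algebra: the universal algebra over the twisted Hall algebra of `C(P)` in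
which the classes of acyclic complexes are invertible. -/
abbrev DH : Type (max u v) := RingQuot (DHRel A k)

/-- The relations `[M] = 1` for `M` acyclic and isomorphic to its shift. -/
inductive ReducedDHRel : DH A k → DH A k → Prop
  | shift (M : AcyclicIndex A) (h : Nonempty (repComplex M.1 ≅ dagger (repComplex M.1))) :
      ReducedDHRel (RingQuot.mkAlgHom ℂ (DHRel A k) (freeGen M.1)) 1

/-- The reduced localized Hall algebra. -/
abbrev ReducedDH : Type (max u v) := RingQuot (ReducedDHRel A k)

end Complexes

end

end HallDouble

/-!
Complexes of projectives are handled as quadruples `Cx` of two projectives and two differentials.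
An extension of `M` by `N` in the category of complexes splits in each degree, so that it is the
cone of a map of degree one from `M` to `N` (a `Cocycle`), and the Hall product of `[M]` and `[N]`
is, up to a power of `t`, the sum of `[cone s]` over all cocycles `s` (`hallCoeff_eq_card`,
`complexMul_eq`). Associativity, the exchange of the two degrees and the products with contractible
complexes are statements about cones.

The localized algebra `DH` has an explicit basis. In a hereditary category every complex of
projectives is the sum of a resolution of its homology in degree `0` and a shifted resolution of its
homology in degree `1`, and by Schanuel's lemma the homology determines it up to contractible
complexes. Let `K_α`, `K'_α` be the units given by the contractible complexes `P = P` and by their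
shifts, extended to `α ∈ K(A)` because `K(A)` is the group completion of the projectives. Then
`[M]` is, up to a power of `t`, `X_a K_β K'_γ`, with `a` the pair of homology objects of `M` and
`β`, `γ` the classes of the images of its differentials. The elements `X_a K_β K'_γ` are linearly
independent: the vector space `LocSpace` with this basis has the universal property of the
localization as a right module over the torus (`IsLocalizing.exists_lift`), therefore carries an
action of `DH`, and the action on the vector of the unit is inverse to the evident map
`LocSpace ⟶ DH` (`locEquiv`).

Write `E_X` and `F_Y` for the basis elements of objects concentrated in degree `0` and degree `1`.
With `K_α`, respectively `K'_α`, they span two copies of the extended Hall algebra (`pos_mul`,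
`neg_mul`). A product of the two kinds is a sum over maps:
`E_X F_Y = ∑_{f : X ⟶ Y} t^{-⟨X - Y, im f⟩} X_{(ker f, coker f)} K'_{im f}` (`xx_mul_xx_mixed`).
Green's coproduct and pairing also combine to a sum over maps, since a map is the same as a
subobject of the target, a quotient of the source and an isomorphism between them
(`finsum_coproduct`). Together, either side of the cross relation becomes a sum over pairs of maps
`g : Y ⟶ X`, `h : X ⟶ Y` with `g ≫ h = 0` and `h ≫ g = 0`, in which the two objects have symmetric
roles. This proves the cross relation (`pos_neg_cross`), hence gives `D(H) ⟶ DH` (`toDH`).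

The formula for `E_X F_Y` has the leading term `f = 0`, and the other terms belong to the pairs
`(ker f, coker f)` with `f ≠ 0`. The relation between `(X, Y)` and `(ker f, coker f)` is well
founded: if all objects are artinian the subobject `ker f` of `X` becomes strictly smaller, and if
all objects are noetherian the kernel of `Y ⟶ coker f` becomes strictly larger
(`wellFounded_kerCokerRel`). So the composition `H ⊗ H ⟶ D(H) ⟶ DH` is triangular, hence bijective.
By the same induction the cross relation rewrites every product `b⁻ a⁺` in terms of products
`a⁺ b⁻`, so that `H ⊗ H ⟶ D(H)` is surjective. Both maps are then bijective.

For the reduced algebras, an acyclic complex of projectives is isomorphic to its shift if and only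
if its two contractible parts agree, in which case its class is `K_α K'_α`; and these classes, for
`α` a class of a projective, generate the same relations as all `K_α⁺ K_α⁻ = 1`.
-/

namespace HallDouble

noncomputable section

/-! ### Finite sums -/

section Finsum

variable {ι κ W : Type*} [AddCommGroup W]

lemma map_finsum' {W' F : Type*} [AddCommGroup W'] [FunLike F W W'] [AddMonoidHomClass F W W']
    [Finite ι] (L : F) (f : ι → W) : L (∑ᶠ i, f i) = ∑ᶠ i, L (f i) :=
  AddMonoidHom.map_finsum (L : W →+ W') (Set.toFinite _)

lemma finsum_sigma' {β : ι → Type*} [Finite ι] [∀ i, Finite (β i)] (F : (Σ i, β i) → W) :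
    ∑ᶠ x, F x = ∑ᶠ i, ∑ᶠ b, F ⟨i, b⟩ := by
  classical
  have := Fintype.ofFinite ι
  have := fun i => Fintype.ofFinite (β i)
  simp only [finsum_eq_sum_of_fintype, Fintype.sum_sigma]

/-- Summing over the fibres of a map from a finite type. -/
lemma finsum_fiber [Finite ι] (π : ι → κ) (F : ι → W) :
    ∑ᶠ i, F i = ∑ᶠ j, ∑ᶠ i : {i // π i = j}, F i := by
  classical
  have := Fintype.ofFinite ι
  have h : ∀ j, ∑ᶠ i : {i // π i = j}, F i = ∑ i with π i = j, F i := fun j => by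
    have := Fintype.ofFinite {i // π i = j}
    rw [finsum_eq_sum_of_fintype]
    exact (Finset.sum_subtype _ (by simp) F).symm
  simp only [h]
  rw [finsum_eq_sum_of_fintype, finsum_eq_sum_of_support_subset (s := Finset.univ.image π)]
  · exact (Finset.sum_fiberwise_of_maps_to
      (fun i _ => Finset.mem_image_of_mem _ (Finset.mem_univ i)) F).symm
  · intro j hj
    by_contra hj'
    refine hj (Finset.sum_eq_zero fun i hi => ?_)
    simp only [Finset.mem_filter, Finset.mem_univ, true_and] at hi
    exact absurd (by simpa using ⟨i, hi⟩) hj'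

lemma finsum_equiv' (e : ι ≃ κ) (F : ι → W) (G : κ → W) (h : ∀ i, F i = G (e i)) :
    ∑ᶠ i, F i = ∑ᶠ j, G j :=
  (finsum_congr h).trans (finsum_comp_equiv e)

variable [Module ℂ W]

lemma finsum_const' [Finite ι] (w : W) : ∑ᶠ _ : ι, w = (Nat.card ι : ℂ) • w := by
  have := Fintype.ofFinite ι
  rw [finsum_eq_sum_of_fintype, Finset.sum_const, Finset.card_univ, Nat.card_eq_fintype_card,
    Nat.cast_smul_eq_nsmul]

/-- A sum weighted by the cardinalities of the fibres of `π` is a sum over the source of `π`. -/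
lemma finsum_card_fiber_smul [Finite ι] (π : ι → κ) (G : κ → W) :
    ∑ᶠ j, (Nat.card {i // π i = j} : ℂ) • G j = ∑ᶠ i, G (π i) := by
  rw [finsum_fiber π]
  refine finsum_congr fun j => ?_
  rw [← finsum_const']
  exact finsum_congr fun i => by rw [i.2]

lemma finsum_comp_of_card_fiber [Finite ι] (π : ι → κ) (n : ℂ)
    (hn : ∀ j, (Nat.card {i // π i = j} : ℂ) = n) (G : κ → W) [Finite κ] :
    ∑ᶠ i, G (π i) = n • ∑ᶠ j, G j := by
  rw [← finsum_card_fiber_smul, smul_finsum]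
  exact finsum_congr fun j => by rw [hn]

end Finsum

/-! ### Extensions with a fixed quotient as pushouts of a projective presentation -/

section HallCoefficient

open Abelian

variable {C : Type u} [Category.{v} C] [Abelian C]

/-- Extensions with the same class have isomorphic middle terms. -/
lemma nonempty_iso_of_extClass_eq [HasExt.{w} C] {X Y Y' Z : C} {i : Z ⟶ Y} {p : Y ⟶ X}
    {i' : Z ⟶ Y'} {p' : Y' ⟶ X} {h : i ≫ p = 0} {h' : i' ≫ p' = 0}
    (hS : (ShortComplex.mk i p h).ShortExact) (hS' : (ShortComplex.mk i' p' h').ShortExact)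
    (e : hS.extClass = hS'.extClass) : Nonempty (Y ≅ Y') := by
  -- lift `p` to `φ : Y ⟶ Y'`
  obtain ⟨φ, hφ⟩ : ∃ φ : Y ⟶ Y', φ ≫ p' = p := by
    obtain ⟨x, hx⟩ := Ext.covariant_sequence_exact₃ Y hS' (Ext.mk₀ p) (zero_add 1)
      (by rw [← e]; exact hS.comp_extClass)
    obtain ⟨φ, rfl⟩ := Ext.addEquiv₀.symm.surjective x
    refine ⟨φ, Ext.addEquiv₀.symm.injective ?_⟩
    simpa using hx
  have hm : Mono i := hS.mono_f
  have hm' : Mono i' := hS'.mono_f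
  let a : Z ⟶ Z := hS'.exact.lift (i ≫ φ) (by simp [hφ, h])
  have ha : a ≫ i' = i ≫ φ := hS'.exact.lift_f _ _
  -- correct `φ` so that it restricts to the identity of `Z`
  obtain ⟨b, hb⟩ : ∃ b : Y ⟶ Z, i ≫ b = a - 𝟙 Z := by
    have nat := ShortComplex.ShortExact.extClass_naturality hS hS'
      (ShortComplex.homMk a φ (𝟙 X) (by simpa using ha) (by simpa using hφ))
    have : hS.extClass.comp (Ext.mk₀ (a - 𝟙 Z)) (add_zero 1) = 0 := by
      have e1 : Ext.mk₀ (a - 𝟙 Z) = Ext.mk₀ a - Ext.mk₀ (𝟙 Z) :=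
        (Ext.addEquiv₀ (X := Z) (Y := Z)).symm.map_sub _ _
      rw [e1]
      refine ((hS.extClass.precomp Z (add_zero 1)).map_sub _ _).trans (sub_eq_zero.2 ?_)
      refine nat.trans ?_
      change (Ext.mk₀ (𝟙 X)).comp hS'.extClass (zero_add 1) =
        hS.extClass.comp (Ext.mk₀ (𝟙 Z)) (add_zero 1)
      simp [e]
    obtain ⟨x, hx⟩ := Ext.contravariant_sequence_exact₁ hS Z _ (add_zero 1) this
    obtain ⟨b, rfl⟩ := Ext.addEquiv₀.symm.surjective x
    refine ⟨b, Ext.addEquiv₀.symm.injective ?_⟩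
    simpa using hx
  let ψ : Y ⟶ Y' := φ - b ≫ i'
  let F : ShortComplex.mk i p h ⟶ ShortComplex.mk i' p' h' :=
    ShortComplex.homMk (𝟙 Z) ψ (𝟙 X)
      (by simp [ψ, Preadditive.comp_sub, ← ha, reassoc_of% hb, Preadditive.sub_comp])
      (by simp [ψ, Preadditive.sub_comp, hφ, h'])
  have : IsIso F.τ₁ := inferInstanceAs (IsIso (𝟙 Z))
  have : IsIso F.τ₃ := inferInstanceAs (IsIso (𝟙 X))
  have : IsIso F.τ₂ := ShortComplex.isIso₂_of_shortExact_of_isIso₁₃ F hS hS'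
  exact ⟨asIso F.τ₂⟩

/-- Let `0 ⟶ P ⟶ Q ⟶ X ⟶ 0` be exact with `Q` projective, and for every `f : P ⟶ Z` let `Y f` be
the middle term of the pushout of this extension along `f`. The Hall coefficients of `X` and `Z`
count the maps `f` with a prescribed `Y f`: the class of the pushout depends on `f` modulo the
image of `Hom(Q, Z)`, and every extension arises. -/
lemma hallCoeff_eq_card (hfin : ∀ X Y : C, Finite (X ⟶ Y)) {S : ShortComplex C}
    (hS : S.ShortExact) [Projective S.X₂] {Z : C} (Y : (S.X₁ ⟶ Z) → C)
    (i : ∀ f, Z ⟶ Y f) (p : ∀ f, Y f ⟶ S.X₃) (hip : ∀ f, i f ≫ p f = 0)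
    (hY : ∀ f, (ShortComplex.mk (i f) (p f) (hip f)).ShortExact)
    (g : ∀ f, S.X₂ ⟶ Y f) (hg : ∀ f, S.f ≫ g f = f ≫ i f) (hgp : ∀ f, g f ≫ p f = S.g) (W : C) :
    hallCoeff S.X₃ Z W = (Nat.card {f // Nonempty (Y f ≅ W)} : ℂ) / (Nat.card (S.X₂ ⟶ Z) : ℂ) := by
  have := HasExt.standard C
  have := hS.epi_g
  let δ : (S.X₁ ⟶ Z) →+ Ext.{max u v} S.X₃ Z 1 :=
    (hS.extClass.precomp Z (add_zero 1)).comp Ext.addEquiv₀.symm.toAddMonoidHom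
  have δ_apply : ∀ f, δ f = hS.extClass.comp (Ext.mk₀ f) (add_zero 1) := fun f => rfl
  have hδ : ∀ f, (hY f).extClass = δ f := fun f => by
    have := ShortComplex.ShortExact.extClass_naturality hS (hY f)
      (ShortComplex.homMk f (g f) (𝟙 S.X₃) (by simpa using (hg f).symm) (by simpa using hgp f))
    rw [δ_apply]
    refine Eq.trans ?_ this.symm
    simp
  let r : (S.X₂ ⟶ Z) →+ (S.X₁ ⟶ Z) := Preadditive.leftComp Z S.f
  let r' : (S.X₃ ⟶ Z) →+ (S.X₂ ⟶ Z) := Preadditive.leftComp Z S.g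
  have hker : δ.ker = r.range := by
    ext f
    constructor
    · intro hf
      obtain ⟨x, hx⟩ := Ext.contravariant_sequence_exact₁ hS Z (Ext.mk₀ f) (add_zero 1) hf
      obtain ⟨b, rfl⟩ := Ext.addEquiv₀.symm.surjective x
      refine ⟨b, Ext.addEquiv₀.symm.injective ?_⟩
      change Ext.mk₀ (S.f ≫ b) = Ext.mk₀ f
      simpa using hx
    · rintro ⟨b, rfl⟩
      change δ (S.f ≫ b) = 0
      rw [δ_apply, ← Ext.mk₀_comp_mk₀]
      exact ShortComplex.ShortExact.extClass_comp_assoc hS (Ext.mk₀ b)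
  have hker' : r.ker = r'.range := by
    ext b
    constructor
    · intro hb
      exact ⟨hS.exact.desc b hb, hS.exact.g_desc b hb⟩
    · rintro ⟨c, rfl⟩
      change S.f ≫ S.g ≫ c = 0
      simp
  have hinj : Function.Injective r' := fun a b h => (cancel_epi S.g).1 h
  have hcard : Nat.card (S.X₂ ⟶ Z) = Nat.card δ.ker * Nat.card (S.X₃ ⟶ Z) := by
    rw [hker, Nat.card_congr (AddMonoidHom.ofInjective hinj).toEquiv, ← hker',
      ← Nat.card_congr (QuotientAddGroup.quotientKerEquivRange r).toEquiv]
    exact AddSubgroup.card_eq_card_quotient_mul_card_addSubgroup _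
  -- the maps `f` with `Y f ≅ W` are the preimage of the set counted by `extCount`
  let E : Set (Ext.{max u v} S.X₃ Z 1) := {e | ∃ (i : Z ⟶ W) (p : W ⟶ S.X₃) (w : i ≫ p = 0)
    (h : (ShortComplex.mk i p w).ShortExact), h.extClass = e}
  have hE : ∀ f, Nonempty (Y f ≅ W) ↔ δ f ∈ E := fun f => by
    constructor
    · rintro ⟨e⟩
      let F : ShortComplex.mk (i f) (p f) (hip f) ≅
          ShortComplex.mk (i f ≫ e.hom) (e.inv ≫ p f) (by simp [hip f]) :=
        ShortComplex.isoMk (Iso.refl _) e (Iso.refl _)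
      have hs := ShortComplex.shortExact_of_iso F (hY f)
      refine ⟨_, _, _, hs, ?_⟩
      have := ShortComplex.ShortExact.extClass_naturality (hY f) hs F.hom
      rw [← hδ]
      simpa [F] using this.symm
    · rintro ⟨i', p', w', h', e⟩
      exact nonempty_iso_of_extClass_eq (hY f) h' ((hδ f).trans e.symm)
  have hsurj : ∀ e : Ext.{max u v} S.X₃ Z 1, ∃ f, δ f = e := fun e => by
    obtain ⟨x, hx⟩ := Ext.contravariant_sequence_exact₃ hS Z e
      (Ext.eq_zero_of_projective _) (add_zero 1)
    obtain ⟨f, rfl⟩ := Ext.addEquiv₀.symm.surjective x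
    exact ⟨f, hx⟩
  have key : Nat.card {f // Nonempty (Y f ≅ W)} = extCount S.X₃ Z W * Nat.card δ.ker := by
    choose σ hσ using hsurj
    have e : {f // Nonempty (Y f ≅ W)} ≃ E × δ.ker :=
      { toFun := fun f => (⟨δ f.1, (hE _).1 f.2⟩, ⟨f.1 - σ (δ f.1), by
          change δ _ = 0
          simp [hσ]⟩)
        invFun := fun x => ⟨σ x.1.1 + x.2.1, (hE _).2 (by
          have : δ x.2.1 = 0 := x.2.2
          simp only [map_add, hσ, this, add_zero]
          exact x.1.2)⟩
        left_inv := fun f => by simp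
        right_inv := fun x => by
          have : δ x.2.1 = 0 := x.2.2
          ext1
          · simp [hσ, this]
          · simp [hσ, this] }
    rw [Nat.card_congr e, Nat.card_prod]
    rfl
  have h1 : (Nat.card δ.ker : ℂ) ≠ 0 := by
    have := hfin S.X₁ Z
    exact_mod_cast Nat.card_pos.ne'
  rw [hallCoeff, key, hcard]
  push_cast
  rw [mul_comm (Nat.card δ.ker : ℂ), mul_div_mul_right _ _ h1]

end HallCoefficient

end

noncomputable section

/-! ### Short exact sequences and classes in the Grothendieck group -/

section Classes

variable {A : Type u} [Category.{v} A] [Abelian A]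

lemma cls_shortExact {S : ShortComplex A} (hS : S.ShortExact) :
    cls S.X₂ = cls S.X₁ + cls S.X₃ := by
  rw [← sub_eq_zero]
  refine Eq.trans ?_ ((QuotientAddGroup.eq_zero_iff
    (FreeAbelianGroup.of S.X₂ - (FreeAbelianGroup.of S.X₁ + FreeAbelianGroup.of S.X₃))).2 ?_)
  · rfl
  · rw [← sub_sub]
    exact AddSubgroup.subset_closure ⟨S, hS, rfl⟩

lemma shortExact_biprod (X Y : A) :
    (ShortComplex.mk (biprod.inl : X ⟶ X ⊞ Y) biprod.snd (by simp)).ShortExact :=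
  (ShortComplex.Splitting.ofHasBinaryBiproduct X Y).shortExact

lemma cls_biprod (X Y : A) : cls (X ⊞ Y) = cls X + cls Y :=
  cls_shortExact (shortExact_biprod X Y)

lemma shortExact_kernel {X Y : A} (f : X ⟶ Y) [Epi f] :
    (ShortComplex.mk (kernel.ι f) f (kernel.condition f)).ShortExact where
  exact := ShortComplex.exact_of_f_is_kernel _ (kernelIsKernel _)

lemma shortExact_cokernel {X Y : A} (f : X ⟶ Y) [Mono f] :
    (ShortComplex.mk f (cokernel.π f) (cokernel.condition f)).ShortExact where
  exact := ShortComplex.exact_of_g_is_cokernel _ (cokernelIsCokernel _)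

lemma cls_eq_zero {X : A} (h : IsZero X) : cls X = 0 := by
  have hS : (ShortComplex.mk (0 : X ⟶ X) (0 : X ⟶ X) (by simp)).ShortExact :=
    { exact := ShortComplex.exact_of_isZero_X₂ _ h
      mono_f := ⟨fun _ _ _ => h.eq_of_tgt _ _⟩
      epi_g := ⟨fun _ _ _ => h.eq_of_src _ _⟩ }
  have := cls_shortExact hS
  simpa using this

lemma cls_zero : cls (0 : A) = 0 := cls_eq_zero (isZero_zero A)

lemma cls_congr {X Y : A} (e : X ≅ Y) : cls X = cls Y := by
  have hS : (ShortComplex.mk (0 : (0 : A) ⟶ X) e.hom (by simp)).ShortExact :=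
    { exact := (ShortComplex.exact_iff_mono _ rfl).2 (inferInstanceAs (Mono e.hom))
      mono_f := ⟨fun _ _ _ => (isZero_zero A).eq_of_tgt _ _⟩
      epi_g := inferInstanceAs (Epi e.hom) }
  have := cls_shortExact hS
  rwa [cls_zero, zero_add] at this

lemma isoClass_eq_iff {C : Type u} [Category.{v} C] {X Y : C} :
    isoClass X = isoClass Y ↔ Nonempty (X ≅ Y) := Quotient.eq

lemma isoClass_congr {C : Type u} [Category.{v} C] {X Y : C} (e : X ≅ Y) :
    isoClass X = isoClass Y := isoClass_eq_iff.2 ⟨e⟩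

@[simp]
lemma isoClass_rep {C : Type u} [Category.{v} C] (X : IsoClasses C) : isoClass (rep X) = X :=
  Quotient.out_eq X

/-- The chosen representative of the class of `X` is isomorphic to `X`. -/
def repIso {C : Type u} [Category.{v} C] (X : C) : rep (isoClass X) ≅ X :=
  (isoClass_eq_iff.1 (isoClass_rep (isoClass X))).some

@[simp]
lemma isoCls_isoClass (X : A) : isoCls (isoClass X) = cls X := cls_congr (repIso X)

lemma cls_kernel_add {X Y : A} (f : X ⟶ Y) [Epi f] : cls X = cls (kernel f) + cls Y :=
  cls_shortExact (shortExact_kernel f)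

lemma cls_add_cokernel {X Y : A} (f : X ⟶ Y) [Mono f] : cls Y = cls X + cls (cokernel f) :=
  cls_shortExact (shortExact_cokernel f)

/-- Pulling back a short exact sequence along a map to its last term. -/
lemma shortExact_pullback {S : ShortComplex A} (hS : S.ShortExact) {X : A} (f : X ⟶ S.X₃) :
    (ShortComplex.mk (pullback.lift (0 : S.X₁ ⟶ X) S.f (by rw [zero_comp, S.zero]))
      (pullback.fst f S.g) (pullback.lift_fst _ _ _)).ShortExact := by
  have := hS.mono_f
  have := hS.epi_g
  let j : S.X₁ ⟶ pullback f S.g := pullback.lift 0 S.f (by rw [zero_comp, S.zero])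
  have hj : j ≫ pullback.snd f S.g = S.f := pullback.lift_snd _ _ _
  have hj' : j ≫ pullback.fst f S.g = 0 := pullback.lift_fst _ _ _
  have hm : Mono j := mono_of_mono_fac hj
  have hl : IsLimit (KernelFork.ofι j hj') := KernelFork.IsLimit.ofι' j hj' fun x hx =>
    ⟨hS.fIsKernel.lift (KernelFork.ofι (x ≫ pullback.snd f S.g) (by
      rw [Category.assoc, ← pullback.condition, reassoc_of% hx, zero_comp])), by
      apply pullback.hom_ext
      · rw [Category.assoc, hj', comp_zero, hx]
      · rw [Category.assoc, hj]
        exact hS.fIsKernel.fac _ WalkingParallelPair.zero⟩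
  exact ShortComplex.ShortExact.mk' (S := ShortComplex.mk j _ hj')
    (ShortComplex.exact_of_f_is_kernel _ hl) hm (by dsimp; infer_instance)

/-- A short exact sequence with projective last term splits. -/
lemma nonempty_iso_biprod {S : ShortComplex A} (hS : S.ShortExact) [Projective S.X₃] :
    Nonempty (S.X₂ ≅ S.X₁ ⊞ S.X₃) := by
  have := hS.mono_f
  have := hS.epi_g
  refine ⟨(ShortComplex.Splitting.ofExactOfSection S hS.exact (Projective.factorThru (𝟙 _) S.g)
    (Projective.factorThru_comp _ _) inferInstance).isoBinaryBiproduct⟩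

end Classes

/-! ### The Grothendieck group of a hereditary category in terms of projectives -/

section Hereditary

variable {A : Type u} [Category.{v} A] [Abelian A]

/-- In a hereditary category subobjects of projective objects are projective. -/
lemma Hereditary.projective_of_mono (h : Hereditary A) {P Q : A} (i : P ⟶ Q) [Mono i]
    [Projective Q] : Projective P := by
  rw [projective_iff_hasProjectiveDimensionLT_one]
  exact ((shortExact_cokernel i).hasProjectiveDimensionLT_X₃_iff 0 inferInstance).1
    (h (cokernel i))

lemma Hereditary.projective_kernel (h : Hereditary A) {P X : A} (f : P ⟶ X)
    [Projective P] : Projective (kernel f) :=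
  h.projective_of_mono (kernel.ι f)

variable {G : Type*} [AddCommGroup G] {f : A → G}

/-- Schanuel's lemma, for invariants of projective objects. -/
lemma sub_eq_sub_of_resolutions
    (hiso : ∀ P Q : A, Projective P → (P ≅ Q) → f P = f Q)
    (hadd : ∀ P Q : A, Projective P → Projective Q → f (P ⊞ Q) = f P + f Q)
    {S S' : ShortComplex A} (hS : S.ShortExact) (hS' : S'.ShortExact) (e : S.X₃ ≅ S'.X₃)
    [h₁ : Projective S.X₁] [h₂ : Projective S.X₂] [h₁' : Projective S'.X₁]
    [h₂' : Projective S'.X₂] :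
    f S.X₂ - f S.X₁ = f S'.X₂ - f S'.X₁ := by
  -- the pullback of the two epimorphisms onto the same object is a direct sum in two ways
  let T : ShortComplex A := ShortComplex.mk S.f (S.g ≫ e.hom) (by simp)
  have hT : T.ShortExact := ShortComplex.shortExact_of_iso
    (ShortComplex.isoMk (Iso.refl _) (Iso.refl _) e : S ≅ T) hS
  have E₁ := shortExact_pullback hS' T.g
  have E₂ := shortExact_pullback hT S'.g
  have : Projective T.X₂ := h₂
  obtain ⟨e₁⟩ := nonempty_iso_biprod E₁
  obtain ⟨e₂⟩ := nonempty_iso_biprod E₂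
  have e₃ := e₁.symm ≪≫ pullbackSymmetry _ _ ≪≫ e₂
  have := hiso _ _ inferInstance e₃
  dsimp [T] at this
  rw [hadd _ _ h₁' h₂, hadd _ _ h₁ h₂'] at this
  rw [sub_eq_sub_iff_add_eq_add, add_comm, this, add_comm]

/-- An invariant of projective objects that is additive on direct sums extends to the
Grothendieck group. -/
lemma Hereditary.exists_hom (h : Hereditary A) [EnoughProjectives A]
    (hiso : ∀ P Q : A, Projective P → (P ≅ Q) → f P = f Q)
    (hadd : ∀ P Q : A, Projective P → Projective Q → f (P ⊞ Q) = f P + f Q) :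
    ∃ φ : K0 A →+ G, ∀ P : A, Projective P → φ (cls P) = f P := by
  let g : A → G := fun X => f (Projective.over X) - f (kernel (Projective.π X))
  have hg : ∀ (S : ShortComplex A), S.ShortExact → Projective S.X₁ → Projective S.X₂ →
      g S.X₃ = f S.X₂ - f S.X₁ := fun S hS h₁ h₂ =>
    sub_eq_sub_of_resolutions hiso hadd (shortExact_kernel (Projective.π S.X₃)) hS (Iso.refl _)
      (h₁ := h.projective_kernel _) (h₂ := Projective.projective_over _)
  refine ⟨K0.lift g fun S hS => ?_, fun P hP => ?_⟩
  · -- resolve all three terms by means of a projective cover `Q` of the middle term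
    let Q := Projective.over S.X₂
    let π : Q ⟶ S.X₂ := Projective.π S.X₂
    have := hS.mono_f
    have := hS.epi_g
    let T₂ := ShortComplex.mk (kernel.ι π) π (kernel.condition π)
    have hT₂ : T₂.ShortExact := shortExact_kernel π
    let T₁ := ShortComplex.mk (pullback.lift (0 : kernel π ⟶ S.X₁) (kernel.ι π)
      (by rw [zero_comp, kernel.condition])) (pullback.fst S.f π) (pullback.lift_fst _ _ _)
    have hT₁ : T₁.ShortExact := shortExact_pullback hT₂ S.f
    let T₃ := ShortComplex.mk (pullback.snd S.f π) (π ≫ S.g) (by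
      rw [← reassoc_of% pullback.condition (f := S.f) (g := π), S.zero, comp_zero])
    have hT₃ : T₃.ShortExact :=
      { exact := ShortComplex.exact_of_f_is_kernel _ (KernelFork.IsLimit.ofι' _ _ fun x hx =>
          ⟨pullback.lift (hS.fIsKernel.lift (KernelFork.ofι (x ≫ π) (by simpa using hx))) x
            (hS.fIsKernel.fac _ WalkingParallelPair.zero),
            pullback.lift_snd _ _ _⟩)
        mono_f := by dsimp [T₃]; infer_instance
        epi_g := by dsimp [T₃]; infer_instance }
    have hQ : Projective Q := Projective.projective_over _
    have hR : Projective (pullback S.f π) := h.projective_of_mono (pullback.snd S.f π)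
    have hK : Projective (kernel π) := h.projective_kernel π
    have e₁ := hg T₁ hT₁ hK hR
    have e₂ := hg T₂ hT₂ hK hQ
    have e₃ := hg T₃ hT₃ hR hQ
    dsimp [T₁, T₂, T₃] at e₁ e₂ e₃
    rw [e₁, e₂, e₃]
    abel
  · rw [K0.lift_cls]
    have hz : Projective (0 : A) := (isZero_zero A).projective
    have hS : (ShortComplex.mk (0 : (0 : A) ⟶ P) (𝟙 P) (by simp)).ShortExact :=
      { exact := (ShortComplex.exact_iff_mono _ rfl).2 (inferInstanceAs (Mono (𝟙 P)))
        mono_f := ⟨fun _ _ _ => (isZero_zero A).eq_of_tgt _ _⟩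
        epi_g := inferInstanceAs (Epi (𝟙 P)) }
    have h0 : f (0 : A) = 0 := by
      have := hadd 0 0 hz hz
      rwa [← hiso 0 (0 ⊞ 0) hz (isoBiprodZero (isZero_zero A)), left_eq_add] at this
    have := hg _ hS hz hP
    rw [this, h0, sub_zero]

/-- Every element of the Grothendieck group is a difference of classes of projectives. -/
lemma Hereditary.exists_sub (h : Hereditary A) [EnoughProjectives A] (α : K0 A) :
    ∃ P Q : A, Projective P ∧ Projective Q ∧ α = cls P - cls Q := by
  have hz : Projective (0 : A) := (isZero_zero A).projective
  obtain ⟨x, rfl⟩ := QuotientAddGroup.mk_surjective α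
  induction x using FreeAbelianGroup.induction_on with
  | zero => exact ⟨0, 0, hz, hz, by simp⟩
  | of X =>
    refine ⟨Projective.over X, kernel (Projective.π X), Projective.projective_over _,
      h.projective_kernel _, ?_⟩
    rw [cls_kernel_add (Projective.π X), add_sub_cancel_left]
    rfl
  | neg X hX =>
    obtain ⟨P, Q, hP, hQ, e⟩ := hX
    exact ⟨Q, P, hQ, hP, by rw [QuotientAddGroup.mk_neg, e, neg_sub]⟩
  | add x y hx hy =>
    obtain ⟨P, Q, hP, hQ, e⟩ := hx
    obtain ⟨P', Q', hP', hQ', e'⟩ := hy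
    refine ⟨P ⊞ P', Q ⊞ Q', inferInstance, inferInstance, ?_⟩
    rw [QuotientAddGroup.mk_add, e, e', cls_biprod, cls_biprod]
    abel

end Hereditary

/-! ### The Euler form and the numbers of homomorphisms -/

section Numbers

lemma tt_sq (k : Type w) : tt k ^ 2 = Nat.card k := by
  rw [tt, ← Complex.ofReal_pow, Real.sq_sqrt (Nat.cast_nonneg _)]
  simp

variable (k : Type w) [Field k] {A : Type u} [Category.{v} A] [Abelian A] [Linear k A]

lemma tt_ne_zero [Finite k] : tt k ≠ 0 := by
  have : (0 : ℝ) < Nat.card k := by exact_mod_cast Nat.card_pos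
  simp only [tt, ne_eq, Complex.ofReal_eq_zero]
  exact (Real.sqrt_pos.2 this).ne'

lemma eulerChar_of_projective (P X : A) [Projective P] :
    eulerChar k P X = Module.finrank k (P ⟶ X) := by
  have := HasExt.standard A
  rw [eulerChar, finsum_eq_single _ 0]
  · simp only [pow_zero, one_mul, extDim]
    rw [(Abelian.Ext.linearEquiv₀ (R := k) (X := P) (Y := X)).finrank_eq]
  · intro n hn
    obtain ⟨n, rfl⟩ := Nat.exists_eq_succ_of_ne_zero hn
    have : Subsingleton (Abelian.Ext.{max u v} P X (n + 1)) :=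
      subsingleton_of_forall_eq 0 fun e => Abelian.Ext.eq_zero_of_projective e
    simp [extDim, Module.finrank_zero_of_subsingleton]

variable [Finite k] [HomFinite A] [EnoughProjectives A] [FiniteGlobalDimension A]

@[simp]
lemma eulerForm_cls (X Y : A) : eulerForm k (cls X) (cls Y) = eulerChar k X Y := by
  simp [eulerForm]

/-- `|Hom(P, X)|` is a power of `q = t²`, because higher extensions of `P` vanish. -/
lemma card_hom_of_projective (P X : A) [Projective P] :
    (Nat.card (P ⟶ X) : ℂ) = tt k ^ (2 * eulerForm k (cls P) (cls X)) := by
  have := HomFinite.finite_hom P X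
  rw [eulerForm_cls, eulerChar_of_projective, zpow_mul, zpow_ofNat, tt_sq, zpow_natCast,
    Module.natCard_eq_pow_finrank (K := k)]
  push_cast
  rfl

lemma symForm_comm (α β : K0 A) : symForm k α β = symForm k β α := add_comm _ _

end Numbers

end

noncomputable section

/-! ### Two-periodic complexes of projectives -/

section

variable (A : Type u) [Category.{v} A] [Abelian A]

/-- A `ℤ/2`-graded complex of projectives, given by its two terms and two differentials. -/
structure Cx where
  /-- the term of degree `0` -/
  X₀ : A
  /-- the term of degree `1` -/
  X₁ : A
  /-- the differential of degree `0` -/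
  d₀ : X₀ ⟶ X₁
  /-- the differential of degree `1` -/
  d₁ : X₁ ⟶ X₀
  d₀₁ : d₀ ≫ d₁ = 0
  d₁₀ : d₁ ≫ d₀ = 0
  [p₀ : Projective X₀]
  [p₁ : Projective X₁]

end

namespace Cx

variable {A : Type u} [Category.{v} A] [Abelian A]

attribute [instance] p₀ p₁
attribute [simp] d₀₁ d₁₀

@[simp]
lemma d₀₁_assoc (M : Cx A) {Z : A} (f : M.X₀ ⟶ Z) : M.d₀ ≫ M.d₁ ≫ f = 0 := by
  rw [← Category.assoc, M.d₀₁, zero_comp]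

@[simp]
lemma d₁₀_assoc (M : Cx A) {Z : A} (f : M.X₁ ⟶ Z) : M.d₁ ≫ M.d₀ ≫ f = 0 := by
  rw [← Category.assoc, M.d₁₀, zero_comp]

/-- The terms of a complex, as a function on `ℤ/2`. -/
def zX (X₀ X₁ : A) : Fin 2 → A
  | 0 => X₀
  | 1 => X₁

/-- The differentials of a complex, as a function on `ℤ/2`. -/
def zd {X₀ X₁ : A} (d₀ : X₀ ⟶ X₁) (d₁ : X₁ ⟶ X₀) : ∀ i j : Fin 2, zX X₀ X₁ i ⟶ zX X₀ X₁ j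
  | 0, 0 => 0
  | 0, 1 => d₀
  | 1, 0 => d₁
  | 1, 1 => 0

/-- The `ℤ/2`-graded complex with two given terms and differentials. -/
def mkZ2 (X₀ X₁ : A) (d₀ : X₀ ⟶ X₁) (d₁ : X₁ ⟶ X₀) (h₀₁ : d₀ ≫ d₁ = 0) (h₁₀ : d₁ ≫ d₀ = 0) :
    Z2Complex A where
  X := zX X₀ X₁
  d := zd d₀ d₁
  shape i j h := match i, j with
    | 0, 0 => rfl
    | 0, 1 => absurd (show (0 : ZMod 2) + 1 = 1 by decide) h
    | 1, 0 => absurd (show (1 : ZMod 2) + 1 = 0 by decide) h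
    | 1, 1 => rfl
  d_comp_d' i j l h h' := match i, j, l with
    | 0, 1, 0 => h₀₁
    | 1, 0, 1 => h₁₀
    | 0, 0, _ => zero_comp
    | 1, 1, _ => zero_comp
    | 1, 0, 0 => comp_zero
    | 0, 1, 1 => comp_zero

/-- A morphism of `ℤ/2`-graded complexes is a pair of compatible maps. -/
def homZ2 {K L : Z2Complex A} (f₀ : K.X 0 ⟶ L.X 0) (f₁ : K.X 1 ⟶ L.X 1)
    (h₀ : f₀ ≫ L.d 0 1 = K.d 0 1 ≫ f₁) (h₁ : f₁ ≫ L.d 1 0 = K.d 1 0 ≫ f₀) : K ⟶ L where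
  f i := match (i : Fin 2) with
    | 0 => f₀
    | 1 => f₁
  comm' i j h := match i, j with
    | 0, 0 => absurd h (by decide)
    | 0, 1 => h₀
    | 1, 0 => h₁
    | 1, 1 => absurd h (by decide)

@[simp]
lemma homZ2_zero {K L : Z2Complex A} (f₀ : K.X 0 ⟶ L.X 0) (f₁ : K.X 1 ⟶ L.X 1) (h₀) (h₁) :
    (homZ2 f₀ f₁ h₀ h₁).f 0 = f₀ := rfl

@[simp]
lemma homZ2_one {K L : Z2Complex A} (f₀ : K.X 0 ⟶ L.X 0) (f₁ : K.X 1 ⟶ L.X 1) (h₀) (h₁) :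
    (homZ2 f₀ f₁ h₀ h₁).f 1 = f₁ := rfl

lemma homZ2_ext {K L : Z2Complex A} {f g : K ⟶ L} (h₀ : f.f 0 = g.f 0) (h₁ : f.f 1 = g.f 1) :
    f = g := by
  apply HomologicalComplex.hom_ext
  intro i
  match i with
  | 0 => exact h₀
  | 1 => exact h₁

/-- Isomorphisms of `ℤ/2`-graded complexes from compatible isomorphisms of the terms. -/
def isoZ2 {K L : Z2Complex A} (e₀ : K.X 0 ≅ L.X 0) (e₁ : K.X 1 ≅ L.X 1)
    (h₀ : e₀.hom ≫ L.d 0 1 = K.d 0 1 ≫ e₁.hom) (h₁ : e₁.hom ≫ L.d 1 0 = K.d 1 0 ≫ e₀.hom) :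
    K ≅ L where
  hom := homZ2 e₀.hom e₁.hom h₀ h₁
  inv := homZ2 e₀.inv e₁.inv (by rw [Iso.inv_comp_eq, ← Category.assoc, h₀]; simp)
    (by rw [Iso.inv_comp_eq, ← Category.assoc, h₁]; simp)
  hom_inv_id := homZ2_ext (by simp) (by simp)
  inv_hom_id := homZ2_ext (by simp) (by simp)

lemma shortExact_Z2 {S : ShortComplex (Z2Complex A)}
    (h₀ : (ShortComplex.mk (S.f.f 0) (S.g.f 0)
      (by rw [← HomologicalComplex.comp_f, S.zero]; rfl)).ShortExact)
    (h₁ : (ShortComplex.mk (S.f.f 1) (S.g.f 1)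
      (by rw [← HomologicalComplex.comp_f, S.zero]; rfl)).ShortExact) : S.ShortExact := by
  apply HomologicalComplex.shortExact_of_degreewise_shortExact
  intro i
  match i with
  | 0 => exact h₀
  | 1 => exact h₁

lemma finite_hom_Z2 [HomFinite A] (K L : Z2Complex A) : Finite (K ⟶ L) := by
  have := fun i => HomFinite.finite_hom (K.X i) (L.X i)
  exact Finite.of_injective (fun f : K ⟶ L => (f.f 0, f.f 1)) fun f g h =>
    homZ2_ext (congrArg Prod.fst h) (congrArg Prod.snd h)

variable (M N : Cx A)

/-- The underlying `ℤ/2`-graded complex. -/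
def z : Z2Complex A := mkZ2 M.X₀ M.X₁ M.d₀ M.d₁ M.d₀₁ M.d₁₀

@[simp] lemma z_X_zero : M.z.X 0 = M.X₀ := rfl
@[simp] lemma z_X_one : M.z.X 1 = M.X₁ := rfl

/-- The complex as an object of the category of complexes of projectives. -/
def obj : ProjComplex A := ⟨M.z, fun i => match (i : Fin 2) with
  | 0 => M.p₀
  | 1 => M.p₁⟩

/-- The isomorphism class of a complex of projectives. -/
def cl : ProjIndex A := isoClass M.obj

variable {M N}

lemma cl_eq_iff : M.cl = N.cl ↔ Nonempty (M.z ≅ N.z) := by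
  rw [cl, cl, isoClass_eq_iff]
  exact ⟨fun ⟨e⟩ => ⟨(ObjectProperty.ι _).mapIso e⟩,
    fun ⟨e⟩ => ⟨(projectiveComplexes A).isoMk e⟩⟩

lemma cl_eq (e₀ : M.X₀ ≅ N.X₀) (e₁ : M.X₁ ≅ N.X₁) (h₀ : e₀.hom ≫ N.d₀ = M.d₀ ≫ e₁.hom)
    (h₁ : e₁.hom ≫ N.d₁ = M.d₁ ≫ e₀.hom) : M.cl = N.cl :=
  cl_eq_iff.2 ⟨isoZ2 e₀ e₁ h₀ h₁⟩

lemma exists_iso_of_cl_eq (h : M.cl = N.cl) : ∃ (e₀ : M.X₀ ≅ N.X₀) (e₁ : M.X₁ ≅ N.X₁),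
    e₀.hom ≫ N.d₀ = M.d₀ ≫ e₁.hom ∧ e₁.hom ≫ N.d₁ = M.d₁ ≫ e₀.hom := by
  obtain ⟨e⟩ := cl_eq_iff.1 h
  let e₀ : M.X₀ ≅ N.X₀ := HomologicalComplex.Hom.isoApp e 0
  let e₁ : M.X₁ ≅ N.X₁ := HomologicalComplex.Hom.isoApp e 1
  exact ⟨e₀, e₁, e.hom.comm 0 1, e.hom.comm 1 0⟩

/-- A complex of projectives in a given isomorphism class. -/
def ofClass (R : ProjIndex A) : Cx A where
  X₀ := (repComplex R).X 0
  X₁ := (repComplex R).X 1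
  d₀ := (repComplex R).d 0 1
  d₁ := (repComplex R).d 1 0
  d₀₁ := (repComplex R).d_comp_d _ _ _
  d₁₀ := (repComplex R).d_comp_d _ _ _
  p₀ := (rep R).property 0
  p₁ := (rep R).property 1

/-- The complex `ofClass R` is the representative of `R`. -/
def zOfClass (R : ProjIndex A) : (ofClass R).z ≅ repComplex R :=
  isoZ2 (K := (ofClass R).z) (Iso.refl _) (Iso.refl _)
    ((Category.id_comp _).trans (Category.comp_id _).symm)
    ((Category.id_comp _).trans (Category.comp_id _).symm)

@[simp]
lemma cl_ofClass (R : ProjIndex A) : (ofClass R).cl = R := by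
  conv_rhs => rw [← isoClass_rep R]
  exact isoClass_congr ((projectiveComplexes A).isoMk (zOfClass R))

/-- The representative of the class of `M` is isomorphic to `M`. -/
def repComplexIso (M : Cx A) : repComplex M.cl ≅ M.z :=
  (ObjectProperty.ι _).mapIso (repIso M.obj)

/-! ### Cones -/

variable (M N) in
/-- Closed maps of degree one from `M` to `N`, with the sign convention that makes the differential
of the cone square to zero. They form the set of extensions of `M` by `N` that are split in each
degree, together with a splitting. -/
@[ext]
structure Cocycle where
  /-- the component from degree `0` to degree `1` -/
  s₀ : M.X₀ ⟶ N.X₁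
  /-- the component from degree `1` to degree `0` -/
  s₁ : M.X₁ ⟶ N.X₀
  h₀ : s₀ ≫ N.d₁ + M.d₀ ≫ s₁ = 0
  h₁ : s₁ ≫ N.d₀ + M.d₁ ≫ s₀ = 0

instance [HomFinite A] : Finite (Cocycle M N) := by
  have := HomFinite.finite_hom M.X₀ N.X₁
  have := HomFinite.finite_hom M.X₁ N.X₀
  exact Finite.of_injective (fun s : Cocycle M N => (s.s₀, s.s₁)) fun s t h =>
    Cocycle.ext (congrArg Prod.fst h) (congrArg Prod.snd h)

/-- The extension of `M` by `N` defined by a cocycle. -/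
abbrev cone (s : Cocycle M N) : Cx A where
  X₀ := N.X₀ ⊞ M.X₀
  X₁ := N.X₁ ⊞ M.X₁
  d₀ := biprod.desc (N.d₀ ≫ biprod.inl) (s.s₀ ≫ biprod.inl + M.d₀ ≫ biprod.inr)
  d₁ := biprod.desc (N.d₁ ≫ biprod.inl) (s.s₁ ≫ biprod.inl + M.d₁ ≫ biprod.inr)
  d₀₁ := by
    ext
    · simp
    · simp
    · simpa using s.h₀
    · simp
  d₁₀ := by
    ext
    · simp
    · simp
    · simpa using s.h₁
    · simp

/-- The zero cocycle; its cone is the direct sum. -/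
def zeroCocycle (M N : Cx A) : Cocycle M N := ⟨0, 0, by simp, by simp⟩

variable (M) in
/-- The shift of a complex. -/
abbrev sh : Cx A where
  X₀ := M.X₁
  X₁ := M.X₀
  d₀ := -M.d₁
  d₁ := -M.d₀
  d₀₁ := by simp
  d₁₀ := by simp

variable (M) in
/-- The tautological extension of `M` by its shift, whose middle term is projective in the category
of complexes. -/
def tautCocycle : Cocycle M M.sh := ⟨𝟙 M.X₀, 𝟙 M.X₁, by
  simp [sh], by simp [sh]⟩

lemma comp_add_eq_zero_iff {X Y Y' Z : A} {a : X ⟶ Y} {b : Y ⟶ Z} {c : X ⟶ Y'} {d : Y' ⟶ Z} :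
    a ≫ b + c ≫ d = 0 ↔ a ≫ b = (-c) ≫ d := by
  rw [Preadditive.neg_comp, eq_neg_iff_add_eq_zero]

/-- The cocycle corresponding to a morphism from the shift of `M` to `N`. -/
def cocycleEquiv (M N : Cx A) : (M.sh.z ⟶ N.z) ≃ Cocycle M N where
  toFun f := ⟨f.f 1, f.f 0, comp_add_eq_zero_iff.2 (f.comm 1 0),
    comp_add_eq_zero_iff.2 (f.comm 0 1)⟩
  invFun s := homZ2 (K := M.sh.z) (L := N.z) s.s₁ s.s₀ (comp_add_eq_zero_iff.1 s.h₁)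
    (comp_add_eq_zero_iff.1 s.h₀)
  left_inv _ := homZ2_ext rfl rfl
  right_inv _ := rfl

/-- The inclusion of `N` into an extension. -/
def coneInl (s : Cocycle M N) : N.z ⟶ (cone s).z :=
  homZ2 (K := N.z) (L := (cone s).z) biprod.inl biprod.inl
    (by change biprod.inl ≫ (cone s).d₀ = N.d₀ ≫ biprod.inl; simp [cone])
    (by change biprod.inl ≫ (cone s).d₁ = N.d₁ ≫ biprod.inl; simp [cone])

/-- The projection of an extension onto `M`. -/
def coneSnd (s : Cocycle M N) : (cone s).z ⟶ M.z :=
  homZ2 (K := (cone s).z) (L := M.z) biprod.snd biprod.snd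
    (by
      change biprod.snd ≫ M.d₀ = (cone s).d₀ ≫ biprod.snd
      apply biprod.hom_ext' <;> simp [cone])
    (by
      change biprod.snd ≫ M.d₁ = (cone s).d₁ ≫ biprod.snd
      apply biprod.hom_ext' <;> simp [cone])

lemma coneInl_coneSnd (s : Cocycle M N) : coneInl s ≫ coneSnd s = 0 :=
  homZ2_ext biprod.inl_snd biprod.inl_snd

lemma shortExact_cone (s : Cocycle M N) :
    (ShortComplex.mk (coneInl s) (coneSnd s) (coneInl_coneSnd s)).ShortExact :=
  shortExact_Z2 (shortExact_biprod N.X₀ M.X₀) (shortExact_biprod N.X₁ M.X₁)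

/-- The map from the tautological extension to the extension defined by a cocycle. -/
def tautMap (s : Cocycle M N) : (cone M.tautCocycle).z ⟶ (cone s).z :=
  homZ2 (K := (cone M.tautCocycle).z) (L := (cone s).z)
    (biprod.map s.s₁ (𝟙 M.X₀)) (biprod.map s.s₀ (𝟙 M.X₁))
    (by
      change biprod.map s.s₁ (𝟙 M.X₀) ≫ (cone s).d₀ =
        (cone M.tautCocycle).d₀ ≫ biprod.map s.s₀ (𝟙 M.X₁)
      have := eq_neg_of_add_eq_zero_left s.h₁
      apply biprod.hom_ext' <;> simp [cone, tautCocycle, sh, reassoc_of% this])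
    (by
      change biprod.map s.s₀ (𝟙 M.X₁) ≫ (cone s).d₁ =
        (cone M.tautCocycle).d₁ ≫ biprod.map s.s₁ (𝟙 M.X₀)
      have := eq_neg_of_add_eq_zero_left s.h₀
      apply biprod.hom_ext' <;> simp [cone, tautCocycle, sh, reassoc_of% this])

/-- Morphisms out of the tautological extension are pairs of maps on the terms of `M`. -/
def tautHomEquiv (M : Cx A) (L : Z2Complex A) :
    ((cone M.tautCocycle).z ⟶ L) ≃ (M.X₀ ⟶ L.X 0) × (M.X₁ ⟶ L.X 1) where
  toFun f := ((biprod.inr : M.X₀ ⟶ M.X₁ ⊞ M.X₀) ≫ f.f 0,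
    (biprod.inr : M.X₁ ⟶ M.X₀ ⊞ M.X₁) ≫ f.f 1)
  invFun g := homZ2 (K := (cone M.tautCocycle).z)
    (biprod.desc (g.2 ≫ L.d 1 0 - M.d₁ ≫ g.1) g.1)
    (biprod.desc (g.1 ≫ L.d 0 1 - M.d₀ ≫ g.2) g.2)
    (by
      change biprod.desc (g.2 ≫ L.d 1 0 - M.d₁ ≫ g.1) g.1 ≫ L.d 0 1 =
        (cone M.tautCocycle).d₀ ≫ biprod.desc (g.1 ≫ L.d 0 1 - M.d₀ ≫ g.2) g.2
      apply biprod.hom_ext' <;> simp [cone, tautCocycle, sh, Preadditive.sub_comp,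
        Preadditive.comp_sub])
    (by
      change biprod.desc (g.1 ≫ L.d 0 1 - M.d₀ ≫ g.2) g.2 ≫ L.d 1 0 =
        (cone M.tautCocycle).d₁ ≫ biprod.desc (g.2 ≫ L.d 1 0 - M.d₁ ≫ g.1) g.1
      apply biprod.hom_ext' <;> simp [cone, tautCocycle, sh, Preadditive.sub_comp,
        Preadditive.comp_sub])
  left_inv f := by
    have key : ∀ {X Y Z Z' : A} (f : X ⊞ Y ⟶ Z) (f' : Y ⊞ X ⟶ Z') (d : Z ⟶ Z') (m : Y ⟶ X)
        (n : X ⟶ Y), f ≫ d = biprod.desc ((-n) ≫ biprod.inl)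
          (𝟙 Y ≫ biprod.inl + m ≫ biprod.inr) ≫ f' →
        biprod.desc ((biprod.inr ≫ f) ≫ d - m ≫ biprod.inr ≫ f') (biprod.inr ≫ f') = f' := by
      intro X Y Z Z' f f' d m n h
      apply biprod.hom_ext' <;> simp [h]
    exact homZ2_ext (key (f.f 1) (f.f 0) _ M.d₁ M.d₀ (f.comm 1 0))
      (key (f.f 0) (f.f 1) _ M.d₀ M.d₁ (f.comm 0 1))
  right_inv g := Prod.ext (biprod.inr_desc _ _) (biprod.inr_desc _ _)

instance (M : Cx A) : Projective (cone M.tautCocycle).z where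
  factors {E X} f e he := by
    have h0 : Epi (e.f 0) := inferInstance
    have h1 : Epi (e.f 1) := inferInstance
    refine ⟨(tautHomEquiv M E).symm (Projective.factorThru (tautHomEquiv M X f).1 (e.f 0),
      Projective.factorThru (tautHomEquiv M X f).2 (e.f 1)), (tautHomEquiv M X).injective ?_⟩
    refine Prod.ext ?_ ?_
    · change biprod.inr ≫ biprod.desc _ _ ≫ e.f 0 = _
      rw [biprod.inr_desc_assoc, Projective.factorThru_comp]
    · change biprod.inr ≫ biprod.desc _ _ ≫ e.f 1 = _
      rw [biprod.inr_desc_assoc, Projective.factorThru_comp]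

end Cx

end

noncomputable section

/-! ### The two Hall products as sums over cocycles -/

section Transport

variable {C : Type u} [Category.{v} C] [Abelian C]

/-- The version of `hallCoeff_eq_card` for objects isomorphic to the outer terms. -/
lemma hallCoeff_eq_card_of_iso (hfin : ∀ X Y : C, Finite (X ⟶ Y)) {S : ShortComplex C}
    (hS : S.ShortExact) [Projective S.X₂] {Z : C} (Y : (S.X₁ ⟶ Z) → C)
    (i : ∀ f, Z ⟶ Y f) (p : ∀ f, Y f ⟶ S.X₃) (hip : ∀ f, i f ≫ p f = 0)
    (hY : ∀ f, (ShortComplex.mk (i f) (p f) (hip f)).ShortExact)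
    (g : ∀ f, S.X₂ ⟶ Y f) (hg : ∀ f, S.f ≫ g f = f ≫ i f) (hgp : ∀ f, g f ≫ p f = S.g)
    {X' Z' : C} (eX : X' ≅ S.X₃) (eZ : Z' ≅ Z) (W : C) :
    hallCoeff X' Z' W = (Nat.card {f // Nonempty (Y f ≅ W)} : ℂ) / (Nat.card (S.X₂ ⟶ Z) : ℂ) := by
  let S' : ShortComplex C := ShortComplex.mk S.f (S.g ≫ eX.inv) (by simp)
  have hS' : S'.ShortExact := ShortComplex.shortExact_of_iso
    (ShortComplex.isoMk (Iso.refl _) (Iso.refl _) eX.symm : S ≅ S') hS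
  have : Projective S'.X₂ := ‹Projective S.X₂›
  let c : (S'.X₁ ⟶ Z') ≃ (S.X₁ ⟶ Z) := eZ.homToEquiv
  have hip' : ∀ f, (eZ.hom ≫ i (c f)) ≫ p (c f) ≫ eX.inv = 0 := fun f => by
    rw [Category.assoc, reassoc_of% hip, zero_comp, comp_zero]
  have hY' : ∀ f, (ShortComplex.mk (eZ.hom ≫ i (c f)) (p (c f) ≫ eX.inv) (hip' f)).ShortExact :=
    fun f => ShortComplex.shortExact_of_iso
      (ShortComplex.isoMk (S₁ := ShortComplex.mk (i (c f)) (p (c f)) (hip (c f))) eZ.symm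
        (Iso.refl _) eX.symm (by simp) (by simp)) (hY (c f))
  have := hallCoeff_eq_card hfin hS' (Z := Z') (fun f => Y (c f)) _ _ hip' hY' (fun f => g (c f))
    (fun f => by
      have : c f = f ≫ eZ.hom := rfl
      rw [this, show S'.f = S.f from rfl, hg]
      simp)
    (fun f => by
      rw [reassoc_of% hgp]) W
  refine this.trans ?_
  congr 2
  · exact Nat.card_congr (c.subtypeEquiv fun f => Iff.rfl)
  · exact Nat.card_congr (eZ.homToEquiv (Z := S.X₂))

end Transport

variable (k : Type w) [Field k] {A : Type u} [Category.{v} A] [Abelian A] [Linear k A]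
  [Finite k] [HomFinite A] [EnoughProjectives A] [FiniteGlobalDimension A]

/-- The product of two basis elements of the extended Hall algebra, as a sum over the maps out of
the first term of a resolution. -/
lemma extMul_eq {S : ShortComplex A} (hS : S.ShortExact) [Projective S.X₂] {Z : A}
    (Y : (S.X₁ ⟶ Z) → A) (i : ∀ f, Z ⟶ Y f) (p : ∀ f, Y f ⟶ S.X₃) (hip : ∀ f, i f ≫ p f = 0)
    (hY : ∀ f, (ShortComplex.mk (i f) (p f) (hip f)).ShortExact)
    (g : ∀ f, S.X₂ ⟶ Y f) (hg : ∀ f, S.f ≫ g f = f ≫ i f) (hgp : ∀ f, g f ≫ p f = S.g)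
    (α β : K0 A) :
    extMul k (isoClass S.X₃, α) (isoClass Z, β) =
      ∑ᶠ f : S.X₁ ⟶ Z, tt k ^ (symForm k α (cls Z) + eulerForm k (cls S.X₃) (cls Z)
        - 2 * eulerForm k (cls S.X₂) (cls Z)) •
          Finsupp.single (isoClass (Y f), α + β) (1 : ℂ) := by
  have := HomFinite.finite_hom S.X₁ Z
  rw [extMul, ← finsum_card_fiber_smul (fun f => isoClass (Y f)) (fun R =>
    tt k ^ (symForm k α (cls Z) + eulerForm k (cls S.X₃) (cls Z)
        - 2 * eulerForm k (cls S.X₂) (cls Z)) • Finsupp.single (R, α + β) (1 : ℂ))]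
  refine finsum_congr fun R => ?_
  dsimp only
  rw [hallCoeff_eq_card_of_iso (HomFinite.finite_hom) hS Y i p hip hY g hg hgp (repIso _)
    (repIso _) (rep R), card_hom_of_projective k, isoCls_isoClass, isoCls_isoClass,
    zpow_sub₀ (tt_ne_zero k), Finsupp.smul_single, Finsupp.smul_single, smul_eq_mul, smul_eq_mul,
    mul_one]
  have : ∀ f, Nonempty (Y f ≅ rep R) ↔ isoClass (Y f) = R := fun f => by
    rw [← isoClass_eq_iff, isoClass_rep]
  simp only [this]
  congr 1
  ring

namespace Cx

variable (M N : Cx A)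

/-- The Euler form of two complexes, summed over the two degrees. -/
def eu : ℤ := eulerForm k (cls M.X₀) (cls N.X₀) + eulerForm k (cls M.X₁) (cls N.X₁)

/-- The twisted product of the classes of two complexes of projectives is the sum of the classes of
the cones of all cocycles, up to a power of `t`. -/
lemma complexMul_eq : complexMul k M.cl N.cl =
    ∑ᶠ s : Cocycle M N, tt k ^ (-eu k M N) • Finsupp.single (cone s).cl (1 : ℂ) := by
  -- extensions of `M` by `N` are the pushouts of the tautological extension of `M` by its shift
  rw [complexMul, ← finsum_card_fiber_smul (fun s : Cocycle M N => (cone s).cl) (fun R =>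
    tt k ^ (-eu k M N) • Finsupp.single R (1 : ℂ))]
  refine finsum_congr fun R => ?_
  have : Projective (ShortComplex.mk (coneInl M.tautCocycle) (coneSnd M.tautCocycle)
    (coneInl_coneSnd M.tautCocycle)).X₂ := inferInstanceAs (Projective (cone M.tautCocycle).z)
  rw [hallCoeff_eq_card_of_iso finite_hom_Z2 (shortExact_cone M.tautCocycle)
    (fun f => (cone (cocycleEquiv M N f)).z) (fun f => coneInl _) (fun f => coneSnd _)
    (fun f => coneInl_coneSnd _) (fun f => shortExact_cone _)
    (fun f => tautMap (cocycleEquiv M N f))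
    (fun f => homZ2_ext (biprod.inl_map _ _) (biprod.inl_map _ _))
    (fun f => homZ2_ext ((biprod.map_snd _ _).trans (Category.comp_id _))
      ((biprod.map_snd _ _).trans (Category.comp_id _)))
    (repComplexIso M) (repComplexIso N) (repComplex R)]
  have e : Nat.card {f // Nonempty ((cone (cocycleEquiv M N f)).z ≅ repComplex R)} =
      Nat.card {s : Cocycle M N // (cone s).cl = R} := by
    refine Nat.card_congr ((cocycleEquiv M N).subtypeEquiv fun f => ?_)
    conv_rhs => rw [← cl_ofClass R, cl_eq_iff]
    exact ⟨fun ⟨e⟩ => ⟨e ≪≫ (zOfClass R).symm⟩, fun ⟨e⟩ => ⟨e ≪≫ zOfClass R⟩⟩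
  have hn : (Nat.card ((cone M.tautCocycle).z ⟶ N.z) : ℂ) = tt k ^ (2 * eu k M N) := by
    rw [Nat.card_congr (tautHomEquiv M N.z), Nat.card_prod, Nat.cast_mul, z_X_zero, z_X_one,
      card_hom_of_projective k, card_hom_of_projective k, ← zpow_add₀ (tt_ne_zero k), eu, mul_add]
  have c : ∀ (K : Cx A) i, cls ((repComplex K.cl).X i) = cls (K.z.X i) := fun K i =>
    cls_congr ((HomologicalComplex.eval A _ i).mapIso (repComplexIso K))
  rw [c, c, c, c]
  simp only [z_X_zero, z_X_one]
  erw [e, hn]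
  rw [← eu, Finsupp.smul_single, Finsupp.smul_single, smul_eq_mul, smul_eq_mul, mul_one]
  congr 1
  rw [div_eq_mul_inv, ← zpow_neg, mul_left_comm, ← zpow_add₀ (tt_ne_zero k)]
  congr 2
  ring

end Cx

end

noncomputable section

namespace Cx

/-! ### Associativity of the Hall product of complexes -/

section Cones

variable {A : Type u} [Category.{v} A] [Abelian A] {M N L : Cx A}

/-- Upper triangular perturbations of the differential of `L ⊕ N ⊕ M`. They describe the iterated
cones over three complexes with either bracketing. -/
@[ext]
structure Tri (M N L : Cx A) where
  /-- the part from `M` to `N` -/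
  s : Cocycle M N
  /-- the part from `N` to `L` -/
  u : Cocycle N L
  /-- the part from `M` to `L`, from degree `0` to degree `1` -/
  w₀ : M.X₀ ⟶ L.X₁
  /-- the part from `M` to `L`, from degree `1` to degree `0` -/
  w₁ : M.X₁ ⟶ L.X₀
  h₀ : w₀ ≫ L.d₁ + s.s₀ ≫ u.s₁ + M.d₀ ≫ w₁ = 0
  h₁ : w₁ ≫ L.d₀ + s.s₁ ≫ u.s₀ + M.d₁ ≫ w₀ = 0

/-- The triangular perturbation given by a cocycle on a cone. -/
def triOfLeft (x : Σ s : Cocycle M N, Cocycle (cone s) L) : Tri M N L where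
  s := x.1
  u := ⟨biprod.inl ≫ x.2.s₀, biprod.inl ≫ x.2.s₁,
    by simpa using biprod.inl ≫= x.2.h₀, by simpa using biprod.inl ≫= x.2.h₁⟩
  w₀ := biprod.inr ≫ x.2.s₀
  w₁ := biprod.inr ≫ x.2.s₁
  h₀ := by simpa [add_assoc] using biprod.inr ≫= x.2.h₀
  h₁ := by simpa [add_assoc] using biprod.inr ≫= x.2.h₁

/-- The triangular perturbation given by a cocycle with values in a cone. -/
def triOfRight (x : Σ u : Cocycle N L, Cocycle M (cone u)) : Tri M N L where
  s := ⟨x.2.s₀ ≫ biprod.snd, x.2.s₁ ≫ biprod.snd, by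
      have := x.2.h₀ =≫ biprod.snd
      simpa [biprod.desc_eq, add_assoc] using this, by
      have := x.2.h₁ =≫ biprod.snd
      simpa [biprod.desc_eq, add_assoc] using this⟩
  u := x.1
  w₀ := x.2.s₀ ≫ biprod.fst
  w₁ := x.2.s₁ ≫ biprod.fst
  h₀ := by
    have := x.2.h₀ =≫ biprod.fst
    simpa [biprod.desc_eq, add_assoc] using this
  h₁ := by
    have := x.2.h₁ =≫ biprod.fst
    simpa [biprod.desc_eq, add_assoc] using this

lemma triOfLeft_bijective : Function.Bijective (triOfLeft (M := M) (N := N) (L := L)) := by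
  constructor
  · rintro ⟨s, c⟩ ⟨s', c'⟩ h
    obtain rfl : s = s' := congrArg Tri.s h
    congr 1
    have hu := congrArg Tri.u h
    ext
    · exact congrArg Cocycle.s₀ hu
    · exact congrArg Tri.w₀ h
    · exact congrArg Cocycle.s₁ hu
    · exact congrArg Tri.w₁ h
  · intro τ
    refine ⟨⟨τ.s, biprod.desc τ.u.s₀ τ.w₀, biprod.desc τ.u.s₁ τ.w₁, ?_, ?_⟩, ?_⟩
    · apply biprod.hom_ext'
      · simpa using τ.u.h₀
      · simpa [add_assoc] using τ.h₀
    · apply biprod.hom_ext'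
      · simpa using τ.u.h₁
      · simpa [add_assoc] using τ.h₁
    · ext <;> simp [triOfLeft]

lemma triOfRight_bijective : Function.Bijective (triOfRight (M := M) (N := N) (L := L)) := by
  constructor
  · rintro ⟨u, c⟩ ⟨u', c'⟩ h
    obtain rfl : u = u' := congrArg Tri.u h
    congr 1
    have hs := congrArg Tri.s h
    ext
    · exact congrArg Tri.w₀ h
    · exact congrArg Cocycle.s₀ hs
    · exact congrArg Tri.w₁ h
    · exact congrArg Cocycle.s₁ hs
  · intro τ
    refine ⟨⟨τ.u, biprod.lift τ.w₀ τ.s.s₀, biprod.lift τ.w₁ τ.s.s₁, ?_, ?_⟩, ?_⟩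
    · apply biprod.hom_ext
      · simpa [biprod.lift_desc] using τ.h₀
      · simpa [biprod.lift_desc] using τ.s.h₀
    · apply biprod.hom_ext
      · simpa [biprod.lift_desc] using τ.h₁
      · simpa [biprod.lift_desc] using τ.s.h₁
    · ext <;> simp [triOfRight]

/-- The two iterated cones that correspond to the same triangular perturbation are isomorphic. -/
lemma cl_cone_cone {x : Σ s : Cocycle M N, Cocycle (cone s) L}
    {y : Σ u : Cocycle N L, Cocycle M (cone u)} (h : triOfLeft x = triOfRight y) :
    (cone x.2).cl = (cone y.2).cl := by
  obtain ⟨s, c⟩ := x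
  obtain ⟨u, c'⟩ := y
  have s₀ : s.s₀ = c'.s₀ ≫ biprod.snd := congrArg (fun τ => τ.s.s₀) h
  have s₁ : s.s₁ = c'.s₁ ≫ biprod.snd := congrArg (fun τ => τ.s.s₁) h
  have u₀ : biprod.inl ≫ c.s₀ = u.s₀ := congrArg (fun τ => τ.u.s₀) h
  have u₁ : biprod.inl ≫ c.s₁ = u.s₁ := congrArg (fun τ => τ.u.s₁) h
  have w₀ : biprod.inr ≫ c.s₀ = c'.s₀ ≫ biprod.fst := congrArg Tri.w₀ h
  have w₁ : biprod.inr ≫ c.s₁ = c'.s₁ ≫ biprod.fst := congrArg Tri.w₁ h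
  refine cl_eq (biprod.associator _ _ _).symm (biprod.associator _ _ _).symm ?_ ?_
  · ext <;> simp [reassoc_of% u₀, reassoc_of% w₀, s₀]
  · ext <;> simp [reassoc_of% u₁, reassoc_of% w₁, s₁]

end Cones

/-! ### Cones of null-homotopic cocycles and direct sums -/

section Contractible

variable {A : Type u} [Category.{v} A] [Abelian A] {M N : Cx A}

/-- The direct sum of two complexes. -/
abbrev dsum (M N : Cx A) : Cx A := cone (zeroCocycle M N)

/-- The cone of a null-homotopic cocycle is the direct sum. -/
lemma cl_cone_of_homotopy (s : Cocycle M N) (h₀ : M.X₀ ⟶ N.X₀) (h₁ : M.X₁ ⟶ N.X₁)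
    (e₀ : s.s₀ = h₀ ≫ N.d₀ - M.d₀ ≫ h₁) (e₁ : s.s₁ = h₁ ≫ N.d₁ - M.d₁ ≫ h₀) :
    (cone s).cl = (dsum M N).cl := by
  let shear : ∀ {X Y : A} (h : X ⟶ Y), Y ⊞ X ≅ Y ⊞ X := fun h =>
    { hom := biprod.desc biprod.inl (h ≫ biprod.inl + biprod.inr)
      inv := biprod.desc biprod.inl (-h ≫ biprod.inl + biprod.inr)
      hom_inv_id := by ext <;> simp
      inv_hom_id := by ext <;> simp }
  refine cl_eq (shear h₀) (shear h₁) ?_ ?_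
  · ext <;> simp [shear, zeroCocycle, e₀]
  · ext <;> simp [shear, zeroCocycle, e₁]

lemma cl_dsum_comm (M N : Cx A) : (dsum M N).cl = (dsum N M).cl := by
  refine cl_eq (biprod.braiding _ _) (biprod.braiding _ _) ?_ ?_
  · ext <;> simp [zeroCocycle]
  · ext <;> simp [zeroCocycle]

lemma cl_dsum_congr {M M' N N' : Cx A} (hM : M.cl = M'.cl) (hN : N.cl = N'.cl) :
    (dsum M N).cl = (dsum M' N').cl := by
  obtain ⟨e₀, e₁, h₀, h₁⟩ := exists_iso_of_cl_eq hM
  obtain ⟨f₀, f₁, g₀, g₁⟩ := exists_iso_of_cl_eq hN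
  refine cl_eq (biprod.mapIso f₀ e₀) (biprod.mapIso f₁ e₁) ?_ ?_
  · ext <;> simp [zeroCocycle, reassoc_of% h₀, reassoc_of% g₀]
  · ext <;> simp [zeroCocycle, reassoc_of% h₁, reassoc_of% g₁]

variable (A) in
/-- The zero complex. -/
abbrev zero : Cx A where
  X₀ := 0
  X₁ := 0
  d₀ := 0
  d₁ := 0
  d₀₁ := by simp
  d₁₀ := by simp
  p₀ := (isZero_zero A).projective
  p₁ := (isZero_zero A).projective

lemma cl_dsum_zero (M : Cx A) : (dsum (zero A) M).cl = M.cl := by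
  refine cl_eq (isoBiprodZero (isZero_zero A)).symm (isoBiprodZero (isZero_zero A)).symm ?_ ?_
  · apply biprod.hom_ext' <;> simp [zeroCocycle]
  · apply biprod.hom_ext' <;> simp [zeroCocycle]

lemma cl_zero : (zero A).cl = isoClass (zeroComplex A) := by
  refine isoClass_congr ((projectiveComplexes A).isoMk ?_)
  have hz : ∀ i, IsZero ((0 : Z2Complex A).X i) := fun i =>
    (HomologicalComplex.eval A (ComplexShape.up (ZMod 2)) i).map_isZero (isZero_zero (Z2Complex A))
  exact isoZ2 (K := (zero A).z) ((isZero_zero A).iso (hz 0)) ((isZero_zero A).iso (hz 1))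
    ((hz 1).eq_of_tgt _ _) ((hz 0).eq_of_tgt _ _)

/-- The contractible complex `P ⟶ P` with differential in degree `1`. -/
abbrev kx (P : A) [Projective P] : Cx A where
  X₀ := P
  X₁ := P
  d₀ := 0
  d₁ := 𝟙 P
  d₀₁ := by simp
  d₁₀ := by simp

/-- Cocycles with values in a contractible complex. -/
def cocycleToKx (M : Cx A) (P : A) [Projective P] : Cocycle M (kx P) ≃ (M.X₁ ⟶ P) where
  toFun s := s.s₁
  invFun f := ⟨-M.d₀ ≫ f, f, by simp, by simp⟩
  left_inv s := by
    ext
    · simpa [add_eq_zero_iff_eq_neg, eq_comm] using s.h₀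
    · rfl
  right_inv f := rfl

/-- Cocycles on a contractible complex. -/
def cocycleOfKx (M : Cx A) (P : A) [Projective P] : Cocycle (kx P) M ≃ (P ⟶ M.X₀) where
  toFun s := s.s₁
  invFun f := ⟨-f ≫ M.d₀, f, by simp, by simp⟩
  left_inv s := by
    ext
    · simpa [add_eq_zero_iff_neg_eq, eq_comm] using s.h₁
    · rfl
  right_inv f := rfl

/-- Every extension of `M` by a contractible complex is split. -/
lemma cl_cone_to_kx {P : A} [Projective P] (s : Cocycle M (kx P)) :
    (cone s).cl = (dsum M (kx P)).cl :=
  cl_cone_of_homotopy s 0 s.s₁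
    (by simpa [add_eq_zero_iff_eq_neg] using s.h₀) (by simp)

/-- Every extension of a contractible complex by `M` is split. -/
lemma cl_cone_of_kx {P : A} [Projective P] (s : Cocycle (kx P) M) :
    (cone s).cl = (dsum M (kx P)).cl :=
  (cl_cone_of_homotopy s (-s.s₁) 0
    (by simpa [add_eq_zero_iff_neg_eq, eq_comm] using s.h₁) (by simp)).trans (cl_dsum_comm _ _)

end Contractible

/-! ### Exchanging the two degrees -/

section Swap

variable {A : Type u} [Category.{v} A] [Abelian A] {M N : Cx A}

/-- The complex with the two degrees exchanged. It is isomorphic to the shift, in which moreover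
the sign of the differential is changed. -/
abbrev swap (M : Cx A) : Cx A where
  X₀ := M.X₁
  X₁ := M.X₀
  d₀ := M.d₁
  d₁ := M.d₀
  d₀₁ := M.d₁₀
  d₁₀ := M.d₀₁

/-- Exchanging the degrees, on cocycles. -/
def swapCocycle (M N : Cx A) : Cocycle M N ≃ Cocycle M.swap N.swap where
  toFun s := ⟨s.s₁, s.s₀, s.h₁, s.h₀⟩
  invFun s := ⟨s.s₁, s.s₀, s.h₁, s.h₀⟩
  left_inv _ := rfl
  right_inv _ := rfl

lemma cl_swap_congr (h : M.cl = N.cl) : M.swap.cl = N.swap.cl := by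
  obtain ⟨e₀, e₁, h₀, h₁⟩ := exists_iso_of_cl_eq h
  exact cl_eq e₁ e₀ h₁ h₀

/-- Exchanging the degrees, on isomorphism classes. -/
def swapIndex (R : ProjIndex A) : ProjIndex A := (ofClass R).swap.cl

@[simp]
lemma swapIndex_cl (M : Cx A) : swapIndex M.cl = M.swap.cl := cl_swap_congr (cl_ofClass _)

end Swap

end Cx

open Cx

/-! ### The twisted Hall algebra of complexes -/

section Algebra

variable {A : Type u} [Category.{v} A] [Abelian A]

variable (A) in
/-- The underlying space of the twisted Hall algebra of complexes. -/
abbrev HallCx : Type (max u v) := ProjIndex A →₀ ℂ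

/-- The basis element of a complex. -/
abbrev bas (M : Cx A) : HallCx A := Finsupp.single M.cl 1

lemma HallCx.hom_ext {W : Type*} [AddCommMonoid W] [Module ℂ W] {f g : HallCx A →ₗ[ℂ] W}
    (h : ∀ M : Cx A, f (bas M) = g (bas M)) : f = g := by
  refine Finsupp.lhom_ext' fun R => LinearMap.ext_ring ?_
  have := h (ofClass R)
  rwa [bas, cl_ofClass] at this

variable (A) in
/-- Exchanging the degrees, on the twisted Hall algebra. -/
def swapHall : HallCx A →ₗ[ℂ] HallCx A := Finsupp.lmapDomain ℂ ℂ swapIndex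

@[simp]
lemma swapHall_bas (M : Cx A) : swapHall A (bas M) = bas M.swap := by
  simp [swapHall, bas]

variable (k : Type w) [Field k] [Linear k A]
  [Finite k] [HomFinite A] [EnoughProjectives A] [FiniteGlobalDimension A]

/-- The product of the twisted Hall algebra of complexes. -/
def hallMul : HallCx A →ₗ[ℂ] HallCx A →ₗ[ℂ] HallCx A :=
  Finsupp.linearCombination ℂ fun M => Finsupp.linearCombination ℂ fun N => complexMul k M N

lemma hallMul_bas (M N : Cx A) :
    hallMul k (bas M) (bas N) = tt k ^ (-eu k M N) • ∑ᶠ s : Cocycle M N, bas (cone s) := by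
  simp [hallMul, bas, complexMul_eq, smul_finsum]

/-- Both bracketings are sums over the triangular perturbations of `L ⊕ N ⊕ M`. -/
lemma hallMul_assoc (x y z : HallCx A) :
    hallMul k (hallMul k x y) z = hallMul k x (hallMul k y z) := by
  have h₃ : ∀ M N L : Cx A, hallMul k (hallMul k (bas M) (bas N)) (bas L) =
      hallMul k (bas M) (hallMul k (bas N) (bas L)) := fun M N L => by
    have hL : hallMul k (∑ᶠ s : Cocycle M N, bas (cone s)) (bas L) =
        ∑ᶠ s : Cocycle M N, hallMul k (bas (cone s)) (bas L) :=
      map_finsum' ((hallMul k).flip (bas L)) _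
    have hR : hallMul k (bas M) (∑ᶠ s : Cocycle N L, bas (cone s)) =
        ∑ᶠ s : Cocycle N L, hallMul k (bas M) (bas (cone s)) :=
      map_finsum' (hallMul k (bas M)) _
    rw [hallMul_bas, hallMul_bas, map_smul, LinearMap.smul_apply, map_smul, hL, hR]
    simp only [hallMul_bas]
    have e₁ : ∀ s : Cocycle M N, eu k (cone s) L = eu k M L + eu k N L := fun s => by
      simp only [eu, cls_biprod, map_add, AddMonoidHom.add_apply]
      ring
    have e₂ : ∀ s : Cocycle N L, eu k M (cone s) = eu k M L + eu k M N := fun s => by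
      simp only [eu, cls_biprod, map_add]
      ring
    simp only [e₁, e₂, ← smul_finsum, smul_smul, ← zpow_add₀ (tt_ne_zero k)]
    congr 1
    · congr 1
      ring
    · rw [← finsum_sigma' (F := fun x : Σ s : Cocycle M N, Cocycle (cone s) L => bas (cone x.2)),
        ← finsum_sigma' (F := fun x : Σ s : Cocycle N L, Cocycle M (cone s) => bas (cone x.2))]
      refine finsum_equiv' ((Equiv.ofBijective _ triOfLeft_bijective).trans
        (Equiv.ofBijective _ triOfRight_bijective).symm) _ _ fun x => ?_
      rw [bas, bas, cl_cone_cone]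
      exact ((Equiv.ofBijective _ triOfRight_bijective).apply_symm_apply (triOfLeft x)).symm
  have h₂ : ∀ (M N : Cx A) z, hallMul k (hallMul k (bas M) (bas N)) z =
      hallMul k (bas M) (hallMul k (bas N) z) := fun M N => LinearMap.congr_fun
    (HallCx.hom_ext (g := hallMul k (bas M) ∘ₗ hallMul k (bas N)) fun L => h₃ M N L)
  have h₁ : ∀ (M : Cx A) y, hallMul k (hallMul k (bas M) y) z =
      hallMul k (bas M) (hallMul k y z) := fun M => LinearMap.congr_fun
    (HallCx.hom_ext (f := (hallMul k).flip z ∘ₗ hallMul k (bas M))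
      (g := hallMul k (bas M) ∘ₗ (hallMul k).flip z) fun N => h₂ M N z)
  exact LinearMap.congr_fun (HallCx.hom_ext (f := (hallMul k).flip z ∘ₗ (hallMul k).flip y)
    (g := (hallMul k).flip (hallMul k y z)) fun M => h₁ M y) x

lemma swapHall_hallMul (x y : HallCx A) :
    swapHall A (hallMul k x y) = hallMul k (swapHall A x) (swapHall A y) := by
  have : (hallMul k (A := A)).compr₂ (swapHall A) =
      (hallMul k).compl₁₂ (swapHall A) (swapHall A) := by
    refine HallCx.hom_ext fun M => HallCx.hom_ext fun N => ?_
    simp only [LinearMap.compr₂_apply, LinearMap.compl₁₂_apply, hallMul_bas, swapHall_bas,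
      map_smul, map_finsum']
    have : eu k M N = eu k M.swap N.swap := add_comm _ _
    rw [this]
    congr 1
    exact finsum_equiv' (swapCocycle M N) _ _ fun s => rfl
  exact LinearMap.congr_fun₂ this x y

lemma hallMul_bas_kx (M : Cx A) (P : A) [Projective P] : hallMul k (bas M) (bas (kx P)) =
    tt k ^ (-eulerForm k (cls M.X₀ - cls M.X₁) (cls P)) • bas (dsum M (kx P)) := by
  rw [hallMul_bas]
  simp only [bas, cl_cone_to_kx]
  rw [finsum_const', Nat.card_congr (cocycleToKx M P), card_hom_of_projective k, smul_smul,
    ← zpow_add₀ (tt_ne_zero k), eu]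
  congr 2
  simp only [map_sub, AddMonoidHom.sub_apply]
  ring

lemma hallMul_kx_bas (M : Cx A) (P : A) [Projective P] : hallMul k (bas (kx P)) (bas M) =
    tt k ^ (eulerForm k (cls P) (cls M.X₀ - cls M.X₁)) • bas (dsum M (kx P)) := by
  rw [hallMul_bas]
  simp only [bas, cl_cone_of_kx]
  rw [finsum_const', Nat.card_congr (cocycleOfKx M P), card_hom_of_projective k, smul_smul,
    ← zpow_add₀ (tt_ne_zero k), eu]
  congr 2
  simp only [map_sub]
  ring

lemma hallMul_zero_bas (M : Cx A) : hallMul k (bas (zero A)) (bas M) = bas M := by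
  have : Unique (Cocycle (zero A) M) :=
    { default := zeroCocycle _ _
      uniq := fun s => Cocycle.ext ((isZero_zero A).eq_of_src _ _)
        ((isZero_zero A).eq_of_src _ _) }
  rw [hallMul_bas, finsum_unique, eu, cls_zero]
  rw [← Unique.eq_default (zeroCocycle (zero A) M)]
  rw [bas, cl_dsum_zero]
  simp

lemma hallMul_bas_zero (M : Cx A) : hallMul k (bas M) (bas (zero A)) = bas M := by
  have : Unique (Cocycle M (zero A)) :=
    { default := zeroCocycle _ _
      uniq := fun s => Cocycle.ext ((isZero_zero A).eq_of_tgt _ _)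
        ((isZero_zero A).eq_of_tgt _ _) }
  rw [hallMul_bas, finsum_unique, eu, cls_zero]
  rw [← Unique.eq_default (zeroCocycle M (zero A))]
  rw [bas, cl_dsum_comm, cl_dsum_zero]
  simp

end Algebra

end

noncomputable section

/-! ### Numerical and homological invariants of a complex -/

/-- Left homology data from the elementary universal properties of the cycles and the homology. -/
def leftHomologyDataOf {A : Type u} [Category.{v} A] [Abelian A] {S : ShortComplex A} {K H : A}
    (i : K ⟶ S.X₂) [Mono i] (f' : S.X₁ ⟶ K) (hf : f' ≫ i = S.f) (wi : i ≫ S.g = 0)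
    (hK : ∀ {T : A} (x : T ⟶ S.X₂), x ≫ S.g = 0 → ∃ y, y ≫ i = x)
    (π : K ⟶ H) [Epi π] (wπ : f' ≫ π = 0)
    (hH : ∀ {T : A} (x : K ⟶ T), f' ≫ x = 0 → ∃ y, π ≫ y = x) : S.LeftHomologyData :=
  have hi : IsLimit (KernelFork.ofι i wi) := KernelFork.IsLimit.ofι' i wi fun x hx =>
    ⟨(hK x hx).choose, (hK x hx).choose_spec⟩
  have hf' : hi.lift (KernelFork.ofι _ S.zero) = f' := by
    rw [← cancel_mono i, hf]
    exact hi.fac _ WalkingParallelPair.zero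
  { K := K
    H := H
    i := i
    π := π
    wi := wi
    hi := hi
    wπ := by rw [hf', wπ]
    hπ := CokernelCofork.IsColimit.ofπ' π _ fun x hx =>
      ⟨(hH x (by rwa [hf'] at hx)).choose, (hH x (by rwa [hf'] at hx)).choose_spec⟩ }

/-- Rank-nullity in the Grothendieck group. -/
lemma cls_sub_kernel {A : Type u} [Category.{v} A] [Abelian A] {X Y : A} (f : X ⟶ Y) :
    cls X - cls (kernel f) = cls Y - cls (cokernel f) := by
  rw [cls_add_cokernel (kernel.ι f), cls_kernel_add (cokernel.π f)]
  have := cls_congr (Abelian.coimageIsoImage f)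
  rw [Abelian.coimage, Abelian.image] at this
  rw [this]
  abel

namespace Cx

section Invariants

variable {A : Type u} [Category.{v} A] [Abelian A]

/-- The complex around degree `0`. -/
abbrev sc₀ (M : Cx A) : ShortComplex A := ShortComplex.mk M.d₁ M.d₀ M.d₁₀

/-- The complex around degree `1`. -/
abbrev sc₁ (M : Cx A) : ShortComplex A := ShortComplex.mk M.d₀ M.d₁ M.d₀₁

/-- The difference of the classes of the two terms. -/
def chi (M : Cx A) : K0 A := cls M.X₀ - cls M.X₁

/-- The class of the image of the differential `d₁`, as the class of the term of degree `1` minus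
that of the cycles. -/
def bd₁ (M : Cx A) : K0 A := cls M.X₁ - cls M.sc₁.cycles

/-- The class of the image of the differential `d₀`, as the class of the term of degree `0` minus
that of the cycles. -/
def bd₀ (M : Cx A) : K0 A := cls M.X₀ - cls M.sc₀.cycles

/-- The isomorphism classes of the two homology objects. -/
def hom (M : Cx A) : IsoClasses A × IsoClasses A :=
  (isoClass M.sc₀.homology, isoClass M.sc₁.homology)

lemma bd₁_eq {M : Cx A} (h : M.sc₁.LeftHomologyData) : M.bd₁ = cls M.X₁ - cls h.K := by
  rw [bd₁, cls_congr h.cyclesIso]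

lemma bd₀_eq {M : Cx A} (h : M.sc₀.LeftHomologyData) : M.bd₀ = cls M.X₀ - cls h.K := by
  rw [bd₀, cls_congr h.cyclesIso]

lemma hom_eq {M : Cx A} (h₀ : M.sc₀.LeftHomologyData) (h₁ : M.sc₁.LeftHomologyData) :
    M.hom = (isoClass h₀.H, isoClass h₁.H) := by
  rw [hom, isoClass_congr h₀.homologyIso, isoClass_congr h₁.homologyIso]

section Congr

variable {M N : Cx A}

lemma hom_congr (h : M.cl = N.cl) : M.hom = N.hom := by
  obtain ⟨e₀, e₁, h₀, h₁⟩ := exists_iso_of_cl_eq h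
  rw [hom, hom, isoClass_congr (ShortComplex.homologyMapIso
      (ShortComplex.isoMk e₁ e₀ e₁ h₁ h₀ : M.sc₀ ≅ N.sc₀)),
    isoClass_congr (ShortComplex.homologyMapIso
      (ShortComplex.isoMk e₀ e₁ e₀ h₀ h₁ : M.sc₁ ≅ N.sc₁))]

lemma bd₀_congr (h : M.cl = N.cl) : M.bd₀ = N.bd₀ := by
  obtain ⟨e₀, e₁, h₀, h₁⟩ := exists_iso_of_cl_eq h
  rw [bd₀, bd₀, cls_congr e₀, cls_congr (ShortComplex.cyclesMapIso
      (ShortComplex.isoMk e₁ e₀ e₁ h₁ h₀ : M.sc₀ ≅ N.sc₀))]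

lemma bd₁_congr (h : M.cl = N.cl) : M.bd₁ = N.bd₁ := by
  obtain ⟨e₀, e₁, h₀, h₁⟩ := exists_iso_of_cl_eq h
  rw [bd₁, bd₁, cls_congr e₁, cls_congr (ShortComplex.cyclesMapIso
      (ShortComplex.isoMk e₀ e₁ e₀ h₀ h₁ : M.sc₁ ≅ N.sc₁))]

lemma chi_congr (h : M.cl = N.cl) : M.chi = N.chi := by
  obtain ⟨e₀, e₁, h₀, h₁⟩ := exists_iso_of_cl_eq h
  rw [chi, chi, cls_congr e₀, cls_congr e₁]

end Congr

lemma cls_sub_cycles (S : ShortComplex A) : cls S.X₁ - cls (kernel S.f) =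
    cls S.cycles - cls S.homology := by
  have e₁ : kernel S.f ≅ kernel S.toCycles :=
    kernelIsoOfEq S.toCycles_i.symm ≪≫ kernelCompMono S.toCycles S.iCycles
  have e₂ : S.homology ≅ cokernel S.toCycles :=
    S.homologyIsCokernel.coconePointUniqueUpToIso (colimit.isColimit _)
  rw [cls_congr e₁, cls_congr e₂, cls_sub_kernel]

lemma bd₁_eq_sub (M : Cx A) : M.bd₁ = cls M.sc₀.cycles - isoCls M.hom.1 := by
  rw [hom, isoCls_isoClass, ← cls_sub_cycles, bd₁, cls_congr M.sc₁.cyclesIsoKernel]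

lemma bd₀_eq_sub (M : Cx A) : M.bd₀ = cls M.sc₁.cycles - isoCls M.hom.2 := by
  rw [hom, isoCls_isoClass, ← cls_sub_cycles, bd₀, cls_congr M.sc₀.cyclesIsoKernel]

/-- The Euler characteristic can be computed on homology. -/
lemma chi_eq (M : Cx A) : M.chi = isoCls M.hom.1 - isoCls M.hom.2 := by
  have h₁ := M.bd₁_eq_sub
  have h₀ := M.bd₀_eq_sub
  rw [bd₁, sub_eq_iff_eq_add] at h₁
  rw [bd₀, sub_eq_iff_eq_add] at h₀
  rw [chi, h₁, h₀]
  abel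

@[simp] lemma swap_chi (M : Cx A) : M.swap.chi = -M.chi := by simp [chi]
@[simp] lemma swap_bd₀ (M : Cx A) : M.swap.bd₀ = M.bd₁ := rfl
@[simp] lemma swap_bd₁ (M : Cx A) : M.swap.bd₁ = M.bd₀ := rfl
lemma swap_hom (M : Cx A) : M.swap.hom = M.hom.swap := rfl

section Contractible

variable (M : Cx A) (P : A) [Projective P]

/-- The cycles and the homology in degree `0` of the sum of `M` and a contractible complex. -/
def kxData₀ : (dsum M (kx P)).sc₀.LeftHomologyData :=
  leftHomologyDataOf (K := P ⊞ M.sc₀.cycles) (H := M.sc₀.homology)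
    (biprod.map (𝟙 P) M.sc₀.iCycles) (biprod.map (𝟙 P) M.sc₀.toCycles)
    (by ext <;> simp [zeroCocycle])
    (by
      have := M.sc₀.iCycles_g
      dsimp at this
      ext <;> simp [zeroCocycle, reassoc_of% this])
    (fun x hx => ⟨biprod.lift (x ≫ biprod.fst) (M.sc₀.liftCycles (x ≫ biprod.snd) (by
      have := hx =≫ biprod.snd
      simpa [zeroCocycle, biprod.desc_eq] using this)), by ext <;> simp⟩)
    (biprod.snd ≫ M.sc₀.homologyπ) (by simp)
    (fun x hx => ⟨M.sc₀.descHomology (biprod.inr ≫ x) (by simpa using biprod.inr ≫= hx), by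
      have := biprod.inl ≫= hx
      apply biprod.hom_ext'
      · simpa [eq_comm] using this
      · simp⟩)

/-- The cycles and the homology in degree `1` of the sum of `M` and a contractible complex. -/
def kxData₁ : (dsum M (kx P)).sc₁.LeftHomologyData :=
  leftHomologyDataOf (K := M.sc₁.cycles) (H := M.sc₁.homology)
    (M.sc₁.iCycles ≫ biprod.inr) (biprod.snd ≫ M.sc₁.toCycles)
    (by ext <;> simp [zeroCocycle])
    (by
      have := M.sc₁.iCycles_g
      dsimp at this
      simp [zeroCocycle, reassoc_of% this])
    (fun x hx => ⟨M.sc₁.liftCycles (x ≫ biprod.snd) (by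
      have := hx =≫ biprod.snd
      simpa [zeroCocycle, biprod.desc_eq] using this), by
      have := hx =≫ biprod.fst
      apply biprod.hom_ext
      · simpa [zeroCocycle, biprod.desc_eq, eq_comm] using this
      · simp⟩)
    M.sc₁.homologyπ (by simp)
    (fun x hx => ⟨M.sc₁.descHomology x (by simpa using biprod.inr ≫= hx), by simp⟩)

lemma hom_dsum_kx : (dsum M (kx P)).hom = M.hom := hom_eq (kxData₀ M P) (kxData₁ M P)

lemma bd₁_dsum_kx : (dsum M (kx P)).bd₁ = M.bd₁ + cls P := by
  rw [bd₁_eq (kxData₁ M P), bd₁]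
  change cls (P ⊞ M.X₁) - cls M.sc₁.cycles = _
  rw [cls_biprod]
  abel

lemma bd₀_dsum_kx : (dsum M (kx P)).bd₀ = M.bd₀ := by
  rw [bd₀_eq (kxData₀ M P), bd₀]
  change cls (P ⊞ M.X₀) - cls (P ⊞ M.sc₀.cycles) = _
  rw [cls_biprod, cls_biprod]
  abel

lemma chi_dsum (N : Cx A) : (dsum M N).chi = M.chi + N.chi := by
  simp only [chi, cls_biprod]
  abel

lemma chi_kx : (kx P).chi = 0 := sub_self _

end Contractible

end Invariants

/-! ### Decomposition into two resolutions, and Schanuel's lemma -/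

section Decomposition

variable {A : Type u} [Category.{v} A] [Abelian A]

/-- The complex built from two resolutions, of the homology in degree `0` by `i` and of the homology
in degree `1` by `j`. -/
abbrev pm {I Z J Y : A} (i : I ⟶ Z) (j : J ⟶ Y) [Projective I] [Projective Z] [Projective J]
    [Projective Y] : Cx A where
  X₀ := J ⊞ Z
  X₁ := Y ⊞ I
  d₀ := biprod.fst ≫ j ≫ biprod.inl
  d₁ := biprod.snd ≫ i ≫ biprod.inr
  d₀₁ := by simp
  d₁₀ := by simp

/-- A short exact sequence with projective last term is isomorphic to the split one. -/
lemma exists_iso_biprod_of_projective {K X I : A} (κ : K ⟶ X) (e : X ⟶ I) (w : κ ≫ e = 0)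
    (h : (ShortComplex.mk κ e w).ShortExact) [Projective I] :
    ∃ φ : K ⊞ I ≅ X, biprod.inl ≫ φ.hom = κ ∧ φ.hom ≫ e = biprod.snd := by
  have := h.mono_f
  have := h.epi_g
  let σ := Projective.factorThru (𝟙 I) e
  have hσ : σ ≫ e = 𝟙 I := Projective.factorThru_comp _ _
  let F : ShortComplex.mk (biprod.inl : K ⟶ K ⊞ I) biprod.snd (by simp) ⟶ ShortComplex.mk κ e w :=
    ShortComplex.homMk (𝟙 K) (biprod.desc κ σ) (𝟙 I) (by simp) (by ext <;> simp [w, hσ])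
  have : IsIso F.τ₁ := inferInstanceAs (IsIso (𝟙 K))
  have : IsIso F.τ₃ := inferInstanceAs (IsIso (𝟙 I))
  have : IsIso F.τ₂ := ShortComplex.isIso₂_of_shortExact_of_isIso₁₃ F (shortExact_biprod K I) h
  refine ⟨asIso F.τ₂, ?_, ?_⟩
  · simp [F]
  · exact F.comm₂₃.trans (Category.comp_id _)

/-- Every complex of projectives in a hereditary category is built from two resolutions. -/
lemma exists_pm (hered : Hereditary A) (M : Cx A) : ∃ (I Z J Y : A) (_ : Projective I)
    (_ : Projective Z) (_ : Projective J) (_ : Projective Y) (i : I ⟶ Z) (j : J ⟶ Y),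
    Mono i ∧ Mono j ∧ Nonempty (cokernel i ≅ M.sc₀.homology) ∧
      Nonempty (cokernel j ≅ M.sc₁.homology) ∧ M.cl = (pm i j).cl := by
  -- in each degree, `I` is the image of the incoming differential
  have key : ∀ S : ShortComplex A, ∃ (I : A) (e : S.X₁ ⟶ I) (i : I ⟶ S.cycles), Mono i ∧ Epi e ∧
      e ≫ i ≫ S.iCycles = S.f ∧ Nonempty (cokernel i ≅ S.homology) ∧
      ∃ w : kernel.ι S.f ≫ e = 0, (ShortComplex.mk (kernel.ι S.f) e w).ShortExact := fun S => by
    have hf : factorThruImage S.toCycles ≫ image.ι S.toCycles ≫ S.iCycles = S.f := by simp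
    have w : kernel.ι S.f ≫ factorThruImage S.toCycles = 0 := by
      rw [← cancel_mono (image.ι S.toCycles ≫ S.iCycles), Category.assoc, hf, kernel.condition,
        zero_comp]
    refine ⟨image S.toCycles, factorThruImage S.toCycles, image.ι S.toCycles, inferInstance,
      inferInstance, hf, ⟨?_⟩, w, ?_⟩
    · exact (cokernelEpiComp (factorThruImage S.toCycles) (image.ι S.toCycles)).symm ≪≫
        cokernelIsoOfEq (image.fac _) ≪≫
        (S.homologyIsCokernel.coconePointUniqueUpToIso (colimit.isColimit _)).symm
    · exact
        { exact := ShortComplex.exact_of_f_is_kernel _ (KernelFork.IsLimit.ofι' _ _ fun x hx =>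
            ⟨kernel.lift _ x (by rw [← hf, reassoc_of% hx, zero_comp]), by simp⟩)
          mono_f := by dsimp; infer_instance
          epi_g := by dsimp; infer_instance }
  obtain ⟨I, e, i, hi, he, hei, hc, w, hs⟩ := key M.sc₀
  obtain ⟨J, e', j, hj, he', hei', hc', w', hs'⟩ := key M.sc₁
  have : Projective M.sc₀.X₂ := M.p₀
  have : Projective M.sc₁.X₂ := M.p₁
  have hZ : Projective M.sc₀.cycles := hered.projective_of_mono M.sc₀.iCycles
  have hY : Projective M.sc₁.cycles := hered.projective_of_mono M.sc₁.iCycles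
  have hI : Projective I := hered.projective_of_mono i
  have hJ : Projective J := hered.projective_of_mono j
  refine ⟨I, _, J, _, hI, hZ, hJ, hY, i, j, hi, hj, hc, hc', Eq.symm ?_⟩
  -- each term is the sum of its cycles and of the image of the differential out of it
  obtain ⟨φ, h₁, h₂⟩ := exists_iso_biprod_of_projective _ _ w hs
  obtain ⟨ψ, h₃, h₄⟩ := exists_iso_biprod_of_projective _ _ w' hs'
  let φ' : M.sc₁.cycles ⊞ I ≅ M.X₁ := biprod.mapIso M.sc₁.cyclesIsoKernel (Iso.refl _) ≪≫ φ
  let ψ' : J ⊞ M.sc₀.cycles ≅ M.X₀ := biprod.braiding _ _ ≪≫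
    biprod.mapIso M.sc₀.cyclesIsoKernel (Iso.refl _) ≪≫ ψ
  dsimp at hei hei'
  refine cl_eq ψ' φ' ?_ ?_
  · rw [← hei']
    simp [ψ', φ', h₁, reassoc_of% h₄]
  · rw [← hei]
    have h₆ : biprod.inr ≫ (biprod.braiding J M.sc₀.cycles).hom = biprod.inl := by ext <;> simp
    have h₅ : biprod.inr ≫ ψ'.hom = M.sc₀.iCycles := by
      rw [Iso.trans_hom, Iso.trans_hom, reassoc_of% h₆]
      simp [h₃]
    simp [φ', reassoc_of% h₂, h₅]

lemma shortExact_biprod_map (P : A) {I Z : A} (i : I ⟶ Z) [Mono i] :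
    (ShortComplex.mk (biprod.map (𝟙 P) i) (biprod.snd ≫ cokernel.π i) (by simp)).ShortExact where
  exact := ShortComplex.exact_of_f_is_kernel _ (KernelFork.IsLimit.ofι' _ _ fun x hx =>
    ⟨biprod.lift (x ≫ biprod.fst) ((shortExact_cokernel i).exact.lift (x ≫ biprod.snd)
      (by simpa using hx)), by
      have := (shortExact_cokernel i).exact.lift_f (x ≫ biprod.snd) (by simpa using hx)
      dsimp at this
      ext <;> simp [this]⟩)
  mono_f := by dsimp; infer_instance
  epi_g := by dsimp; infer_instance

/-- An isomorphism of the last two terms of short exact sequences induces one of the first terms. -/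
lemma exists_iso_of_shortExact {S S' : ShortComplex A} (hS : S.ShortExact) (hS' : S'.ShortExact)
    (b : S.X₂ ≅ S'.X₂) (c : S.X₃ ≅ S'.X₃) (hb : b.hom ≫ S'.g = S.g ≫ c.hom) :
    ∃ a : S.X₁ ≅ S'.X₁, a.hom ≫ S'.f = S.f ≫ b.hom := by
  have := hS.mono_f
  have := hS'.mono_f
  have hb' : b.inv ≫ S.g = S'.g ≫ c.inv := by
    rw [Iso.inv_comp_eq, ← Category.assoc, hb]
    simp
  exact ⟨⟨hS'.exact.lift (S.f ≫ b.hom) (by simp [hb]), hS.exact.lift (S'.f ≫ b.inv) (by simp [hb']),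
    by simp [← cancel_mono S.f], by simp [← cancel_mono S'.f]⟩, by simp⟩

/-- Exchanging the first two summands of a threefold direct sum. -/
def biprodPerm (X Y Z : A) : X ⊞ (Y ⊞ Z) ≅ Y ⊞ (X ⊞ Z) where
  hom := biprod.lift (biprod.snd ≫ biprod.fst) (biprod.lift biprod.fst (biprod.snd ≫ biprod.snd))
  inv := biprod.lift (biprod.snd ≫ biprod.fst) (biprod.lift biprod.fst (biprod.snd ≫ biprod.snd))

/-- Schanuel's lemma for complexes: two resolutions of the same object in degree `0` give complexes
that become isomorphic after adding contractible complexes. -/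
lemma cl_pm_left {I Z I' Z' J Y : A} (i : I ⟶ Z) (i' : I' ⟶ Z') (j : J ⟶ Y) [Mono i] [Mono i']
    [Projective I] [Projective Z] [Projective I'] [Projective Z'] [Projective J]
    [Projective Y] (c : cokernel i ≅ cokernel i') :
    (dsum (pm i j) (kx Z')).cl = (dsum (pm i' j) (kx Z)).cl := by
  -- lift the two projections onto the common cokernel through each other
  obtain ⟨h, hh⟩ : ∃ h : Z' ⟶ Z, h ≫ cokernel.π i ≫ c.hom = cokernel.π i' :=
    ⟨Projective.factorThru (cokernel.π i') (cokernel.π i ≫ c.hom), Projective.factorThru_comp _ _⟩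
  obtain ⟨h', hh'⟩ : ∃ h' : Z ⟶ Z', h' ≫ cokernel.π i' = cokernel.π i ≫ c.hom :=
    ⟨Projective.factorThru (cokernel.π i ≫ c.hom) (cokernel.π i'), Projective.factorThru_comp _ _⟩
  obtain ⟨b, hb⟩ : ∃ b : Z' ⊞ Z ≅ Z ⊞ Z', b.hom ≫ biprod.snd ≫ cokernel.π i' =
      (biprod.snd ≫ cokernel.π i) ≫ c.hom :=
    ⟨{  hom := biprod.desc (biprod.lift (-h) (𝟙 Z' - h ≫ h')) (biprod.lift (𝟙 Z) h')
        inv := biprod.desc (biprod.lift (-h') (𝟙 Z - h' ≫ h)) (biprod.lift (𝟙 Z') h)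
        hom_inv_id := by ext <;> simp
        inv_hom_id := by ext <;> simp }, by ext <;> simp [hh', hh]⟩
  obtain ⟨a, ha⟩ := exists_iso_of_shortExact (shortExact_biprod_map Z' i)
    (shortExact_biprod_map Z i') b c hb
  dsimp at ha
  have a₁ := ha =≫ biprod.fst
  have a₂ := ha =≫ biprod.snd
  simp only [Category.assoc, biprod.map_fst, biprod.map_snd, Category.comp_id] at a₁ a₂
  -- `b` identifies the two sums `Z' ⊞ Z ≅ Z ⊞ Z'` over the common cokernel, and `a` the kernels
  refine cl_eq (biprodPerm _ _ _ ≪≫ biprod.mapIso (Iso.refl J) b ≪≫ biprodPerm _ _ _)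
    (biprodPerm _ _ _ ≪≫ biprod.mapIso (Iso.refl Y) a ≪≫ biprodPerm _ _ _) ?_ ?_
  · ext <;> simp [biprodPerm, zeroCocycle, biprod.lift_eq]
  · ext <;> simp [biprodPerm, zeroCocycle, biprod.lift_eq, a₁, a₂]

/-- Schanuel's lemma in degree `1`. -/
lemma cl_pm_right {I Z J Y J' Y' : A} (i : I ⟶ Z) (j : J ⟶ Y) (j' : J' ⟶ Y') [Mono j] [Mono j']
    [Projective I] [Projective Z] [Projective J] [Projective Y] [Projective J']
    [Projective Y'] (c : cokernel j ≅ cokernel j') :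
    (dsum (pm i j).swap (kx Y')).cl = (dsum (pm i j').swap (kx Y)).cl := by
  have key : ∀ {J Y : A} (j : J ⟶ Y) [Projective J] [Projective Y],
      (pm i j).swap.cl = (pm j i).cl := fun j => by
    refine cl_eq (biprod.braiding _ _) (biprod.braiding _ _) ?_ ?_
    · ext <;> simp
    · ext <;> simp
  rw [cl_dsum_congr (key j) rfl, cl_dsum_congr (key j') rfl]
  exact cl_pm_left j j' i c

end Decomposition

end Cx

end

noncomputable section

open Cx

/-! ### The localization of the twisted Hall algebra as a vector space -/

section Localization

variable (A : Type u) [Category.{v} A] [Abelian A]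

/-- Indices of the basis of the localized Hall algebra: the two homology objects of a complex and
the classes of the images of the differentials `d₁` and `d₀`. -/
abbrev LocIndex : Type u := (IsoClasses A × IsoClasses A) × (K0 A × K0 A)

/-- A vector space with a basis indexed by `LocIndex`. It is shown to be the space underlying the
localized Hall algebra. -/
abbrev LocSpace : Type u := LocIndex A →₀ ℂ

variable {A}

/-- Translation of the classes of the boundaries. It corresponds to multiplication on the right by
classes of acyclic complexes. -/
def shiftLoc (γ : K0 A × K0 A) : LocSpace A →ₗ[ℂ] LocSpace A :=
  Finsupp.lmapDomain ℂ ℂ fun x => (x.1, x.2 + γ)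

@[simp]
lemma shiftLoc_single (γ : K0 A × K0 A) (x : LocIndex A) (c : ℂ) :
    shiftLoc γ (Finsupp.single x c) = Finsupp.single (x.1, x.2 + γ) c := by
  simp [shiftLoc]

lemma shiftLoc_add (γ δ : K0 A × K0 A) (x : LocSpace A) :
    shiftLoc (γ + δ) x = shiftLoc γ (shiftLoc δ x) := by
  have : shiftLoc (γ + δ) = shiftLoc γ ∘ₗ shiftLoc (A := A) δ := by
    ext x : 3
    simp [add_comm γ, add_assoc]
  rw [this, LinearMap.comp_apply]

lemma shiftLoc_zero (x : LocSpace A) : shiftLoc 0 x = x := by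
  have : shiftLoc (0 : K0 A × K0 A) = LinearMap.id (M := LocSpace A) := by
    ext x : 3
    simp
  rw [this, LinearMap.id_apply]

/-- The classes of the images of the two differentials. -/
def Cx.bd (M : Cx A) : K0 A × K0 A := (M.bd₁, M.bd₀)

lemma Cx.bd_congr {M N : Cx A} (h : M.cl = N.cl) : M.bd = N.bd := by
  rw [Cx.bd, Cx.bd, bd₁_congr h, bd₀_congr h]

lemma Cx.hom_pm {I Z J Y : A} (i : I ⟶ Z) (j : J ⟶ Y) [Mono i] [Mono j] [Projective I]
    [Projective Z] [Projective J] [Projective Y] :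
    (pm i j).hom = (isoClass (cokernel i), isoClass (cokernel j)) := by
  refine hom_eq (M := pm i j)
    (leftHomologyDataOf (K := Z) (H := cokernel i) biprod.inr (biprod.snd ≫ i) (by simp) (by simp)
      (fun x hx => ⟨x ≫ biprod.snd, ?_⟩) (cokernel.π i) (by simp)
      (fun x hx => ⟨cokernel.desc i x ?_, cokernel.π_desc _ _ _⟩))
    (leftHomologyDataOf (K := Y) (H := cokernel j) biprod.inl (biprod.fst ≫ j) (by simp) (by simp)
      (fun x hx => ⟨x ≫ biprod.fst, ?_⟩) (cokernel.π j) (by simp)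
      (fun x hx => ⟨cokernel.desc j x ?_, cokernel.π_desc _ _ _⟩))
  · have h : x ≫ biprod.fst = 0 := by
      rw [← cancel_mono (j ≫ (biprod.inl : Y ⟶ Y ⊞ I))]
      simpa using hx
    ext <;> simp [h]
  · simpa using biprod.inr ≫= hx
  · have h : x ≫ biprod.snd = 0 := by
      rw [← cancel_mono (i ≫ (biprod.inr : Z ⟶ J ⊞ Z))]
      simpa using hx
    ext <;> simp [h]
  · simpa using biprod.inl ≫= hx

/-- Every pair of objects is the homology of a complex of projectives. -/
lemma Hereditary.exists_hom_eq (hered : Hereditary A) [EnoughProjectives A]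
    (a : IsoClasses A × IsoClasses A) : ∃ M : Cx A, M.hom = a := by
  have key : ∀ X : IsoClasses A, isoClass (cokernel (kernel.ι (Projective.π (rep X)))) = X :=
    fun X => by
      conv_rhs => rw [← isoClass_rep X]
      exact isoClass_congr ((cokernelIsCokernel _).coconePointUniqueUpToIso
        (Abelian.epiIsCokernelOfKernel _ (kernelIsKernel (Projective.π (rep X)))))
  have := hered.projective_kernel (Projective.π (rep a.1))
  have := hered.projective_kernel (Projective.π (rep a.2))
  refine ⟨pm (kernel.ι (Projective.π (rep a.1))) (kernel.ι (Projective.π (rep a.2))), ?_⟩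
  rw [hom_pm, key, key]

variable (k : Type w) [Field k] [Linear k A]
  [Finite k] [HomFinite A] [EnoughProjectives A] [FiniteGlobalDimension A]

/-- The exponent that normalizes the class of a complex so that multiplication by acyclic complexes
becomes translation. -/
def Cx.wt (M : Cx A) : ℤ := eulerForm k M.chi (M.bd₁ - M.bd₀)

/-- The vector of `LocSpace` that represents the class of a complex. -/
def lam (M : Cx A) : LocSpace A := tt k ^ M.wt k • Finsupp.single (M.hom, M.bd) 1

lemma lam_congr {M N : Cx A} (h : M.cl = N.cl) : lam k M = lam k N := by
  rw [lam, lam, Cx.wt, Cx.wt, chi_congr h, bd₁_congr h, bd₀_congr h, hom_congr h, bd_congr h]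

lemma Cx.wt_dsum_kx (M : Cx A) (P : A) [Projective P] :
    (dsum M (kx P)).wt k = M.wt k + eulerForm k M.chi (cls P) := by
  rw [Cx.wt, Cx.wt, bd₁_dsum_kx, bd₀_dsum_kx, chi_dsum, chi_kx, add_zero, ← map_add]
  congr 1
  abel

lemma Cx.wt_swap (M : Cx A) : M.swap.wt k = M.wt k := by
  rw [Cx.wt, Cx.wt, swap_chi, swap_bd₀, swap_bd₁, ← neg_sub M.bd₁, map_neg, map_neg,
    AddMonoidHom.neg_apply, neg_neg]

lemma tt_zpow_add (m n : ℤ) : tt k ^ (m + n) = tt k ^ m * tt k ^ n :=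
  zpow_add₀ (tt_ne_zero k) _ _

lemma tt_zpow_ne_zero (m : ℤ) : tt k ^ m ≠ 0 := zpow_ne_zero _ (tt_ne_zero k)

lemma hallMul_bas_swap_kx (M : Cx A) (P : A) [Projective P] :
    hallMul k (bas M) (bas (kx P).swap) =
      tt k ^ (eulerForm k M.chi (cls P)) • bas (dsum M.swap (kx P)).swap := by
  have := congrArg (swapHall A) (hallMul_bas_kx k M.swap P)
  rw [swapHall_hallMul, map_smul, swapHall_bas, swapHall_bas, swapHall_bas] at this
  refine this.trans ?_
  congr 2
  rw [← AddMonoidHom.neg_apply, ← map_neg, neg_sub]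
  rfl

lemma hallMul_swap_kx_bas (M : Cx A) (P : A) [Projective P] :
    hallMul k (bas (kx P).swap) (bas M) =
      tt k ^ (-eulerForm k (cls P) M.chi) • bas (dsum M.swap (kx P)).swap := by
  have := congrArg (swapHall A) (hallMul_kx_bas k M.swap P)
  rw [swapHall_hallMul, map_smul, swapHall_bas, swapHall_bas, swapHall_bas] at this
  refine this.trans ?_
  congr 2
  rw [← map_neg, chi, neg_sub]

section Universal

variable {W : Type*} [AddCommGroup W] [Module ℂ W]

/-- Linear maps on the twisted Hall algebra for which right multiplication by acyclic complexes
corresponds to an action `σ` of `K(A) × K(A)`. -/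
structure IsLocalizing (φ : HallCx A →ₗ[ℂ] W) (σ : K0 A × K0 A → W →ₗ[ℂ] W) : Prop where
  add (γ δ : K0 A × K0 A) (x : W) : σ (γ + δ) x = σ γ (σ δ x)
  zero (x : W) : σ 0 x = x
  mul_kx (M : Cx A) (P : A) [Projective P] :
    φ (hallMul k (bas M) (bas (kx P))) = σ (cls P, 0) (φ (bas M))
  mul_swap_kx (M : Cx A) (P : A) [Projective P] :
    φ (hallMul k (bas M) (bas (kx P).swap)) = σ (0, cls P) (φ (bas M))

variable {φ : HallCx A →ₗ[ℂ] W} {σ : K0 A × K0 A → W →ₗ[ℂ] W}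

/-- The image of the class of a complex, normalized to depend on its homology only. -/
def normalized (φ : HallCx A →ₗ[ℂ] W) (σ : K0 A × K0 A → W →ₗ[ℂ] W) (M : Cx A) : W :=
  tt k ^ (-M.wt k) • σ (-M.bd) (φ (bas M))

variable {k}

lemma IsLocalizing.eq_normalized (h : IsLocalizing k φ σ) (M : Cx A) :
    φ (bas M) = tt k ^ M.wt k • σ M.bd (normalized k φ σ M) := by
  rw [normalized, map_smul, smul_smul, ← h.add, ← tt_zpow_add, add_neg_cancel, add_neg_cancel,
    h.zero, zpow_zero, one_smul]

lemma normalized_congr {M N : Cx A} (h : M.cl = N.cl) :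
    normalized k φ σ M = normalized k φ σ N := by
  rw [normalized, normalized, Cx.wt, Cx.wt, chi_congr h, bd₁_congr h, bd₀_congr h, bd_congr h,
    bas, bas, h]

/-- Adding contractible complexes does not change the normalized image. -/
lemma IsLocalizing.normalized_dsum_kx (h : IsLocalizing k φ σ) (M : Cx A) (P : A) [Projective P] :
    normalized k φ σ (dsum M (kx P)) = normalized k φ σ M := by
  have e := h.mul_kx M P
  rw [hallMul_bas_kx, map_smul] at e
  have e' : φ (bas (dsum M (kx P))) =
      tt k ^ (eulerForm k M.chi (cls P)) • σ (cls P, 0) (φ (bas M)) := by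
    rw [← e, smul_smul, ← tt_zpow_add, Cx.chi, add_neg_cancel, zpow_zero, one_smul]
  have hb : (dsum M (kx P)).bd = M.bd + (cls P, 0) := by
    rw [Cx.bd, Cx.bd, bd₁_dsum_kx, bd₀_dsum_kx, Prod.mk_add_mk, add_zero]
  rw [normalized, normalized, e', map_smul, smul_smul, ← tt_zpow_add, ← h.add, hb, wt_dsum_kx]
  congr 1
  · congr 1
    abel
  · congr 2
    abel

lemma IsLocalizing.normalized_swap_dsum_kx (h : IsLocalizing k φ σ) (M : Cx A) (P : A)
    [Projective P] : normalized k φ σ (dsum M.swap (kx P)).swap = normalized k φ σ M := by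
  have e := h.mul_swap_kx M P
  rw [hallMul_bas_swap_kx, map_smul] at e
  have e' : φ (bas (dsum M.swap (kx P)).swap) =
      tt k ^ (-eulerForm k M.chi (cls P)) • σ (0, cls P) (φ (bas M)) := by
    rw [← e, smul_smul, ← tt_zpow_add, neg_add_cancel, zpow_zero, one_smul]
  have hb : (dsum M.swap (kx P)).swap.bd = M.bd + (0, cls P) := by
    rw [Cx.bd, Cx.bd, swap_bd₁, swap_bd₀, bd₁_dsum_kx, bd₀_dsum_kx, Prod.mk_add_mk, add_zero]
    rfl
  rw [normalized, normalized, e', map_smul, smul_smul, ← tt_zpow_add, ← h.add, hb, wt_swap,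
    wt_dsum_kx, wt_swap, swap_chi, map_neg, AddMonoidHom.neg_apply]
  congr 1
  · congr 1
    abel
  · congr 2
    abel

/-- The normalized image depends on the homology only. -/
lemma IsLocalizing.normalized_eq (h : IsLocalizing k φ σ) (hered : Hereditary A) {M N : Cx A}
    (e : M.hom = N.hom) : normalized k φ σ M = normalized k φ σ N := by
  obtain ⟨I, Z, J, Y, _, _, _, _, i, j, _, _, ⟨c₀⟩, ⟨c₁⟩, hM⟩ := exists_pm hered M
  obtain ⟨I', Z', J', Y', _, _, _, _, i', j', _, _, ⟨c₀'⟩, ⟨c₁'⟩, hN⟩ := exists_pm hered N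
  rw [Cx.hom, Cx.hom, Prod.mk.injEq, isoClass_eq_iff, isoClass_eq_iff] at e
  obtain ⟨⟨e₀⟩, ⟨e₁⟩⟩ := e
  have h₁ := normalized_congr (k := k) (φ := φ) (σ := σ)
    (cl_pm_left i i' j (c₀ ≪≫ e₀ ≪≫ c₀'.symm))
  have h₂ := normalized_congr (k := k) (φ := φ) (σ := σ)
    (cl_swap_congr (cl_pm_right i' j j' (c₁ ≪≫ e₁ ≪≫ c₁'.symm)))
  -- replace the two resolutions one after the other
  rw [h.normalized_dsum_kx, h.normalized_dsum_kx] at h₁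
  rw [h.normalized_swap_dsum_kx, h.normalized_swap_dsum_kx] at h₂
  rw [normalized_congr hM, normalized_congr hN, h₁, h₂]

/-- The universal property of `LocSpace`: it is the localization of the twisted Hall algebra, as a
right module over the classes of acyclic complexes. -/
lemma IsLocalizing.exists_lift (h : IsLocalizing k φ σ) (hered : Hereditary A) :
    ∃ ρ : LocSpace A →ₗ[ℂ] W, (∀ M, ρ (lam k M) = φ (bas M)) ∧
      ∀ γ x, ρ (shiftLoc γ x) = σ γ (ρ x) := by
  choose N hN using hered.exists_hom_eq
  refine ⟨Finsupp.linearCombination ℂ fun x => σ x.2 (normalized k φ σ (N x.1)),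
    fun M => ?_, fun γ x => ?_⟩
  · rw [lam, map_smul, Finsupp.linearCombination_single, one_smul, h.eq_normalized M,
      h.normalized_eq hered (hN M.hom)]
  · induction x using Finsupp.induction_linear with
    | zero => simp
    | add x y hx hy => simp only [map_add, hx, hy]
    | single x c => simp [add_comm _ γ, h.add]

end Universal

/-- `LocSpace` is spanned by the translates of the vectors of complexes. -/
lemma LocSpace.hom_ext (hered : Hereditary A) {W : Type*} [AddCommGroup W] [Module ℂ W]
    {f g : LocSpace A →ₗ[ℂ] W}
    (h : ∀ γ M, f (shiftLoc γ (lam k M)) = g (shiftLoc γ (lam k M))) : f = g := by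
  refine Finsupp.lhom_ext' fun ⟨a, γ⟩ => LinearMap.ext_ring ?_
  obtain ⟨M, rfl⟩ := hered.exists_hom_eq a
  have := h (γ - M.bd) M
  rw [lam, map_smul, map_smul, map_smul, shiftLoc_single] at this
  simpa [tt_zpow_ne_zero] using this

/-- The linear extension of `lam`. -/
def lamHall : HallCx A →ₗ[ℂ] LocSpace A := Finsupp.linearCombination ℂ fun R => lam k (ofClass R)

lemma lamHall_bas (M : Cx A) : lamHall k (bas M) = lam k M := by
  rw [lamHall, bas, Finsupp.linearCombination_single, one_smul, lam_congr k (cl_ofClass _)]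

lemma isLocalizing_lamHall : IsLocalizing k (lamHall k (A := A)) shiftLoc where
  add := shiftLoc_add
  zero := shiftLoc_zero
  mul_kx M P _ := by
    rw [hallMul_bas_kx, map_smul, lamHall_bas, lamHall_bas, lam, lam, smul_smul, ← tt_zpow_add,
      map_smul, shiftLoc_single, Cx.bd, Cx.bd, bd₁_dsum_kx, bd₀_dsum_kx, hom_dsum_kx, wt_dsum_kx]
    congr 2
    rw [Cx.chi]
    abel
  mul_swap_kx M P _ := by
    rw [hallMul_bas_swap_kx, map_smul, lamHall_bas, lamHall_bas, lam, lam, smul_smul,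
      ← tt_zpow_add, map_smul, shiftLoc_single, Cx.bd, Cx.bd, swap_bd₁, swap_bd₀, bd₁_dsum_kx,
      bd₀_dsum_kx, swap_hom, hom_dsum_kx, wt_swap, wt_dsum_kx, wt_swap, swap_chi, map_neg,
      AddMonoidHom.neg_apply, swap_bd₀, swap_bd₁, swap_hom, Prod.swap_swap]
    congr 2
    abel

end Localization

end

noncomputable section

open Cx

/-! ### Acyclic complexes -/

section Acyclic

variable {A : Type u} [Category.{v} A] [Abelian A]

/-- Acyclicity in terms of the pair of homology classes. -/
lemma Cx.acyclic_iff (M : Cx A) : (repComplex M.cl).Acyclic ↔ M.hom = (isoClass 0, isoClass 0) := by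
  have e₀ : M.z.sc' 1 0 1 = M.sc₀ := rfl
  have e₁ : M.z.sc' 0 1 0 = M.sc₁ := rfl
  have hz : ∀ X : A, isoClass X = isoClass (0 : A) ↔ IsZero X := fun X => by
    rw [isoClass_eq_iff]
    exact ⟨fun ⟨e⟩ => (isZero_zero A).of_iso e, fun h => ⟨h.iso (isZero_zero A)⟩⟩
  have h₀ : M.z.ExactAt 0 ↔ M.sc₀.Exact := by
    rw [HomologicalComplex.exactAt_iff' M.z 1 0 1
      ((ComplexShape.up (ZMod 2)).prev_eq' (by decide))
      ((ComplexShape.up (ZMod 2)).next_eq' (by decide)), e₀]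
  have h₁ : M.z.ExactAt 1 ↔ M.sc₁.Exact := by
    rw [HomologicalComplex.exactAt_iff' M.z 0 1 0
      ((ComplexShape.up (ZMod 2)).prev_eq' (by decide))
      ((ComplexShape.up (ZMod 2)).next_eq' (by decide)), e₁]
  have h : (repComplex M.cl).Acyclic ↔ M.z.ExactAt 0 ∧ M.z.ExactAt 1 :=
    ⟨fun h => ⟨(h 0).of_iso (repComplexIso M), (h 1).of_iso (repComplexIso M)⟩,
      fun h i => match (i : Fin 2) with
        | 0 => h.1.of_iso (repComplexIso M).symm
        | 1 => h.2.of_iso (repComplexIso M).symm⟩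
  rw [h, h₀, h₁, ShortComplex.exact_iff_isZero_homology, ShortComplex.exact_iff_isZero_homology,
    Cx.hom, Prod.mk.injEq, hz, hz]

lemma Cx.hom_zero : (zero A).hom = (isoClass 0, isoClass 0) := by
  rw [Cx.hom, Prod.mk.injEq, isoClass_eq_iff]
  exact ⟨⟨((ShortComplex.exact_iff_isZero_homology _).1
      (ShortComplex.exact_of_isZero_X₂ _ (isZero_zero A))).iso (isZero_zero A)⟩,
    ⟨((ShortComplex.exact_iff_isZero_homology _).1
      (ShortComplex.exact_of_isZero_X₂ _ (isZero_zero A))).iso (isZero_zero A)⟩⟩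

lemma Cx.hom_kx (P : A) [Projective P] : (kx P).hom = (isoClass 0, isoClass 0) := by
  rw [← hom_congr (cl_dsum_zero (kx P)), hom_dsum_kx, hom_zero]

lemma Cx.bd_zero : (zero A).bd = 0 := by
  have h : ∀ S : ShortComplex A, IsZero S.X₂ → IsZero S.cycles := fun S hS =>
    hS.of_mono S.iCycles
  simp [Cx.bd, bd₁, bd₀, cls_eq_zero (h (zero A).sc₀ (isZero_zero A)), cls_zero]

/-- The contractible complexes on `P` and, with the degrees exchanged, on `Q` together. -/
abbrev Cx.kxkx (P Q : A) [Projective P] [Projective Q] : Cx A := (dsum (kx P).swap (kx Q)).swap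

lemma Cx.hom_kxkx (P Q : A) [Projective P] [Projective Q] :
    (kxkx P Q).hom = (isoClass 0, isoClass 0) := by
  rw [swap_hom, hom_dsum_kx, swap_hom, hom_kx]
  rfl

/-- Acyclic complexes of projectives in a hereditary category are contractible. -/
lemma Hereditary.exists_kxkx (hered : Hereditary A) {M : Cx A}
    (h : M.hom = (isoClass 0, isoClass 0)) :
    ∃ (P Q : A) (_ : Projective P) (_ : Projective Q), M.cl = (kxkx P Q).cl := by
  obtain ⟨I, Z, J, Y, _, _, _, _, i, j, _, _, ⟨c₀⟩, ⟨c₁⟩, hM⟩ := exists_pm hered M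
  rw [Cx.hom, Prod.mk.injEq, isoClass_eq_iff, isoClass_eq_iff] at h
  obtain ⟨⟨e₀⟩, ⟨e₁⟩⟩ := h
  have : Epi i := Preadditive.epi_of_isZero_cokernel i ((isZero_zero A).of_iso (c₀ ≪≫ e₀))
  have : Epi j := Preadditive.epi_of_isZero_cokernel j ((isZero_zero A).of_iso (c₁ ≪≫ e₁))
  have : IsIso i := isIso_of_mono_of_epi i
  have : IsIso j := isIso_of_mono_of_epi j
  refine ⟨Z, J, inferInstance, inferInstance, hM.trans ?_⟩
  refine cl_eq (M := pm i j) (N := kxkx Z J) (Iso.refl _) (biprod.mapIso (asIso j).symm (asIso i))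
    ?_ ?_
  · ext <;> simp [zeroCocycle]
  · ext <;> simp [zeroCocycle]

end Acyclic

/-! ### The localized Hall algebra -/

lemma HallCx.hom_ext₂ {A : Type u} [Category.{v} A] [Abelian A]
    {W : Type*} [AddCommMonoid W] [Module ℂ W] {f g : HallCx A →ₗ[ℂ] HallCx A →ₗ[ℂ] W}
    (h : ∀ M N, f (bas M) (bas N) = g (bas M) (bas N)) :
    f = g :=
  HallCx.hom_ext fun M => HallCx.hom_ext fun N => h M N

section Localized

variable (k : Type w) [Field k] {A : Type u} [Category.{v} A] [Abelian A] [Linear k A]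
  [Finite k] [HomFinite A] [EnoughProjectives A] [FiniteGlobalDimension A]

/-- The linear map from the twisted Hall algebra of complexes to its localization. -/
def gen : HallCx A →ₗ[ℂ] DH A k :=
  (RingQuot.mkAlgHom ℂ (DHRel A k)).toLinearMap ∘ₗ Finsupp.linearCombination ℂ freeGen

lemma gen_single (R : ProjIndex A) :
    gen k (Finsupp.single R 1) = RingQuot.mkAlgHom ℂ (DHRel A k) (freeGen R) := by
  simp [gen]

lemma gen_zero : gen k (bas (zero A)) = 1 := by
  rw [bas, gen_single, cl_zero, RingQuot.mkAlgHom_rel ℂ DHRel.one, map_one]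

lemma gen_hallMul (x y : HallCx A) : gen k (hallMul k x y) = gen k x * gen k y := by
  have : (hallMul k).compr₂ (gen k) = (LinearMap.mul ℂ (DH A k)).compl₁₂ (gen k) (gen k) := by
    refine HallCx.hom_ext₂ fun M N => ?_
    have h := RingQuot.mkAlgHom_rel ℂ (DHRel.mul (k := k) M.cl N.cl)
    rw [map_mul, ← gen_single, ← gen_single] at h
    refine Eq.trans ?_ h.symm
    change gen k (hallMul k (bas M) (bas N)) = gen k (complexMul k M.cl N.cl)
    simp [hallMul, bas]
  exact LinearMap.congr_fun₂ this x y

variable {k} in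
lemma isUnit_gen {M : Cx A} (h : M.hom = (isoClass 0, isoClass 0)) : IsUnit (gen k (bas M)) := by
  let R : AcyclicIndex A := ⟨M.cl, M.acyclic_iff.2 h⟩
  refine ⟨⟨_, RingQuot.mkAlgHom ℂ (DHRel A k) (freeInv R), ?_, ?_⟩, (gen_single k M.cl).symm⟩
  · rw [← map_mul, RingQuot.mkAlgHom_rel ℂ (DHRel.mul_inv R), map_one]
  · rw [← map_mul, RingQuot.mkAlgHom_rel ℂ (DHRel.inv_mul R), map_one]

section

variable {B : Type*} [Ring B] [Algebra ℂ B]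

variable {k} in
/-- The universal property of the localized Hall algebra. -/
lemma DH.exists_lift (φ : HallCx A →ₗ[ℂ] B) (h₁ : φ (bas (zero A)) = 1)
    (hmul : ∀ x y, φ (hallMul k x y) = φ x * φ y)
    (hu : ∀ M : Cx A, M.hom = (isoClass 0, isoClass 0) → IsUnit (φ (bas M))) :
    ∃ f : DH A k →ₐ[ℂ] B, ∀ x, f (gen k x) = φ x := by
  let F : DHFree A →ₐ[ℂ] B := FreeAlgebra.lift ℂ (Sum.elim (fun R => φ (Finsupp.single R 1))
    fun R => Ring.inverse (φ (Finsupp.single R.1 1)))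
  have hF : ∀ R, F (freeGen R) = φ (Finsupp.single R 1) := fun R => by simp [F, freeGen]
  have hF' : ∀ R, F (freeInv R) = Ring.inverse (φ (Finsupp.single R.1 1)) := fun R => by
    simp [F, freeInv]
  have hlin : ∀ x : HallCx A, F (Finsupp.linearCombination ℂ freeGen x) = φ x := fun x => by
    have : F.toLinearMap ∘ₗ Finsupp.linearCombination ℂ freeGen = φ := by
      ext R
      simp [hF]
    exact LinearMap.congr_fun this x
  have hu' : ∀ R : AcyclicIndex A, IsUnit (φ (Finsupp.single R.1 1)) := fun R => by
    have := hu (ofClass R.1) ((acyclic_iff _).1 (by rw [cl_ofClass]; exact R.2))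
    rwa [bas, cl_ofClass] at this
  refine ⟨RingQuot.liftAlgHom ℂ ⟨F, fun x y h => ?_⟩, fun x => ?_⟩
  · cases h with
    | one => rw [hF, map_one, ← cl_zero, h₁]
    | mul M N =>
      rw [map_mul, hF, hF, hlin, ← hmul]
      simp [hallMul]
    | mul_inv R => rw [map_mul, hF, hF', map_one, Ring.mul_inverse_cancel _ (hu' R)]
    | inv_mul R => rw [map_mul, hF, hF', map_one, Ring.inverse_mul_cancel _ (hu' R)]
  · exact (RingQuot.liftAlgHom_mkAlgHom_apply ℂ F _ _).trans (hlin x)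

variable {k} in
/-- The localized Hall algebra is generated by the classes of complexes and by inverses. -/
lemma DH.induction (S : Subalgebra ℂ (DH A k)) (hS : ∀ M : Cx A, gen k (bas M) ∈ S)
    (hi : ∀ u : (DH A k)ˣ, (u : DH A k) ∈ S → ((u⁻¹ : (DH A k)ˣ) : DH A k) ∈ S) (x : DH A k) :
    x ∈ S := by
  have hg : ∀ R, RingQuot.mkAlgHom ℂ (DHRel A k) (freeGen R) ∈ S := fun R => by
    have := hS (ofClass R)
    rwa [bas, cl_ofClass, gen_single] at this
  obtain ⟨y, rfl⟩ := RingQuot.mkAlgHom_surjective ℂ (DHRel A k) x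
  induction y using FreeAlgebra.induction with
  | grade0 r => rw [AlgHom.commutes]; exact S.algebraMap_mem r
  | mul a b ha hb => rw [map_mul]; exact S.mul_mem ha hb
  | add a b ha hb => rw [map_add]; exact S.add_mem ha hb
  | grade1 R =>
    rcases R with R | R
    · exact hg R
    · exact hi ⟨RingQuot.mkAlgHom ℂ (DHRel A k) (freeGen R.1),
        RingQuot.mkAlgHom ℂ (DHRel A k) (freeInv R),
        by rw [← map_mul, RingQuot.mkAlgHom_rel ℂ (DHRel.mul_inv R), map_one],
        by rw [← map_mul, RingQuot.mkAlgHom_rel ℂ (DHRel.inv_mul R), map_one]⟩ (hg R.1)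

variable {k} in
lemma DH.hom_ext {f g : DH A k →ₐ[ℂ] B} (h : ∀ M : Cx A, f (gen k (bas M)) = g (gen k (bas M))) :
    f = g := by
  refine AlgHom.ext fun x => DH.induction (AlgHom.equalizer f g) h (fun u hu => ?_) x
  change f _ = g _
  have hu : Units.map (f : DH A k →* B) u = Units.map (g : DH A k →* B) u := Units.ext hu
  have := congrArg (fun w => ((w⁻¹ : Bˣ) : B)) hu
  simpa using this

end

/-! ### Exchange of the degrees -/

lemma DH.exists_swap : ∃ f : DH A k →ₐ[ℂ] DH A k, ∀ x, f (gen k x) = gen k (swapHall A x) := by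
  refine DH.exists_lift (gen k ∘ₗ swapHall A) ?_ (fun x y => ?_) fun M hM => ?_
  · rw [LinearMap.comp_apply, swapHall_bas]
    exact gen_zero k
  · simp only [LinearMap.comp_apply, swapHall_hallMul, gen_hallMul]
  · rw [LinearMap.comp_apply, swapHall_bas]
    exact isUnit_gen (by rw [swap_hom, hM]; rfl)

/-- The involution of the localized Hall algebra that exchanges the degrees of a complex. -/
def DH.swap : DH A k →ₐ[ℂ] DH A k := (DH.exists_swap k).choose

lemma DH.swap_gen (x : HallCx A) : DH.swap k (gen k x) = gen k (swapHall A x) :=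
  (DH.exists_swap k).choose_spec x

lemma DH.swap_gen_bas (M : Cx A) : DH.swap k (gen k (bas M)) = gen k (bas M.swap) := by
  rw [DH.swap_gen, swapHall_bas]

lemma DH.swap_swap (x : DH A k) : DH.swap k (DH.swap k x) = x := by
  have : (DH.swap k).comp (DH.swap k) = AlgHom.id ℂ (DH A k) := DH.hom_ext fun M => by
    rw [AlgHom.comp_apply, DH.swap_gen_bas, DH.swap_gen_bas]
    rfl
  exact DFunLike.congr_fun this x

end Localized

end

noncomputable section

open Cx

/-! ### The units defined by contractible complexes -/

/-- The multiplicative version of `Hereditary.exists_hom`. The values need only commute with each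
other: the homomorphism is constructed with values in the subgroup that they generate. -/
lemma Hereditary.exists_unitHom {A : Type u} [Category.{v} A] [Abelian A] [EnoughProjectives A]
    (hered : Hereditary A) {G : Type*} [Group G] (f : A → G)
    (hcomm : ∀ P Q : A, Projective P → Projective Q → f P * f Q = f Q * f P)
    (hiso : ∀ P Q : A, Projective P → (P ≅ Q) → f P = f Q)
    (hadd : ∀ P Q : A, Projective P → Projective Q → f (P ⊞ Q) = f P * f Q) :
    ∃ φ : Multiplicative (K0 A) →* G, ∀ P : A, Projective P →
      φ (Multiplicative.ofAdd (cls P)) = f P := by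
  classical
  let s : Set G := {g | ∃ P : A, Projective P ∧ g = f P}
  have hs : IsMulCommutative (Subgroup.closure s) := Subgroup.isMulCommutative_closure (by
    rintro _ ⟨P, hP, rfl⟩ _ ⟨Q, hQ, rfl⟩
    exact hcomm P Q hP hQ)
  let _ : CommGroup (Subgroup.closure s) :=
    { (inferInstance : Group (Subgroup.closure s)) with mul_comm := hs.is_comm.comm }
  let f' : A → Additive (Subgroup.closure s) := fun P =>
    if hP : Projective P then Additive.ofMul ⟨f P, Subgroup.subset_closure ⟨P, hP, rfl⟩⟩ else 0
  have hf' : ∀ P : A, Projective P → ((f' P).toMul : G) = f P := fun P hP => by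
    simp [f', hP]
  obtain ⟨φ, hφ⟩ := hered.exists_hom (f := f')
    (fun P Q hP e => by
      apply Additive.toMul.injective
      apply Subtype.ext
      rw [hf' P hP, hf' Q (Projective.of_iso e hP), hiso P Q hP e])
    (fun P Q hP hQ => by
      apply Additive.toMul.injective
      apply Subtype.ext
      rw [toMul_add, Subgroup.coe_mul, hf' P hP, hf' Q hQ, hf' _ inferInstance, hadd P Q hP hQ])
  refine ⟨(Subgroup.closure s).subtype.comp (AddMonoidHom.toMultiplicativeLeft φ), fun P hP => ?_⟩
  rw [← hf' P hP, ← hφ P hP]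
  rfl

lemma cl_kx_congr {A : Type u} [Category.{v} A] [Abelian A] {P Q : A} [Projective P]
    [Projective Q] (e : P ≅ Q) : (kx P).cl = (kx Q).cl :=
  cl_eq (M := kx P) (N := kx Q) e e (by simp) (by simp)

/-- A translation of `LocSpace` combined with a scaling that depends on the homology. -/
def scaleShift (k : Type w) {A : Type u} [Category.{v} A] [Abelian A]
    (e : IsoClasses A × IsoClasses A → ℤ) (γ : K0 A × K0 A) : Module.End ℂ (LocSpace A) :=
  Finsupp.linearCombination ℂ fun x => tt k ^ e x.1 • Finsupp.single (x.1, x.2 + γ) 1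

lemma scaleShift_single (k : Type w) {A : Type u} [Category.{v} A] [Abelian A]
    (e : IsoClasses A × IsoClasses A → ℤ) (γ : K0 A × K0 A) (x : LocIndex A) :
    scaleShift k e γ (Finsupp.single x 1) =
      tt k ^ e x.1 • Finsupp.single (x.1, x.2 + γ) 1 := by
  rw [scaleShift, Finsupp.linearCombination_single, one_smul]

lemma isUnit_scaleShift (k : Type w) [Field k] [Finite k] {A : Type u} [Category.{v} A] [Abelian A]
    (e : IsoClasses A × IsoClasses A → ℤ) (γ : K0 A × K0 A) :
    IsUnit (scaleShift k e γ) := by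
  refine ⟨⟨scaleShift k e γ, scaleShift k (-e) (-γ), ?_, ?_⟩, rfl⟩
  all_goals
    refine Finsupp.lhom_ext' fun x => LinearMap.ext_ring ?_
    simp only [LinearMap.comp_apply, Finsupp.lsingle_apply, Module.End.mul_apply,
      scaleShift_single, map_smul, smul_smul, ← tt_zpow_add, Module.End.one_apply]
    simp

section Torus

variable (k : Type w) [Field k] {A : Type u} [Category.{v} A] [Abelian A] [Linear k A]
  [Finite k] [HomFinite A] [EnoughProjectives A] [FiniteGlobalDimension A]

open scoped Classical in
/-- The unit of the localized Hall algebra defined by the contractible complex on `P`, with the junk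
value `1` if `P` is not projective. -/
def kxUnit (P : A) : (DH A k)ˣ :=
  if _ : Projective P then (isUnit_gen (k := k) (hom_kx P)).unit else 1

lemma kxUnit_coe (P : A) [h : Projective P] : (kxUnit k P : DH A k) = gen k (bas (kx P)) := by
  simp [kxUnit, h]

lemma hallMul_kx_kx (P Q : A) [Projective P] [Projective Q] :
    hallMul k (bas (kx P)) (bas (kx Q)) = bas (kx (P ⊞ Q)) := by
  rw [hallMul_bas_kx, sub_self, map_zero, AddMonoidHom.zero_apply, neg_zero, zpow_zero, one_smul,
    bas, cl_dsum_comm]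
  congr 1
  refine cl_eq (M := dsum (kx Q) (kx P)) (N := kx (P ⊞ Q)) (Iso.refl _) (Iso.refl _) ?_ ?_
  · ext <;> simp [zeroCocycle]
  · ext <;> simp [zeroCocycle]

variable {k} in
lemma exists_torus (hered : Hereditary A) : ∃ φ : Multiplicative (K0 A) →* (DH A k)ˣ,
    ∀ P : A, Projective P → φ (Multiplicative.ofAdd (cls P)) = kxUnit k P := by
  have hadd : ∀ P Q : A, Projective P → Projective Q →
      kxUnit k (P ⊞ Q) = kxUnit k P * kxUnit k Q := fun P Q _ _ => by
    ext
    rw [Units.val_mul, kxUnit_coe, kxUnit_coe, kxUnit_coe, ← gen_hallMul, hallMul_kx_kx]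
  have hiso : ∀ P Q : A, Projective P → (P ≅ Q) → kxUnit k P = kxUnit k Q := fun P Q _ e => by
    have := Projective.of_iso e ‹_›
    ext
    rw [kxUnit_coe, kxUnit_coe, bas, bas, cl_kx_congr e]
  refine hered.exists_unitHom _ (fun P Q hP hQ => ?_) hiso hadd
  rw [← hadd P Q hP hQ, ← hadd Q P hQ hP]
  exact hiso _ _ inferInstance (biprod.braiding P Q)

/-- The homomorphism from `K(A)` to the units of the localized Hall algebra that extends
`P ↦ [P = P]`. -/
def torus (hered : Hereditary A) : Multiplicative (K0 A) →* (DH A k)ˣ :=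
  (exists_torus (k := k) hered).choose

variable (hered : Hereditary A)

/-- The element `K_α` of the localized Hall algebra. -/
def kp (α : K0 A) : DH A k := (torus k hered (Multiplicative.ofAdd α) : (DH A k)ˣ)

/-- The element `K_α` of the localized Hall algebra with the degrees exchanged. -/
def km (α : K0 A) : DH A k := DH.swap k (kp k hered α)

lemma kp_cls (P : A) [Projective P] : kp k hered (cls P) = gen k (bas (kx P)) := by
  rw [kp, torus, (exists_torus hered).choose_spec P ‹_›, kxUnit_coe]

lemma km_cls (P : A) [Projective P] : km k hered (cls P) = gen k (bas (kx P).swap) := by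
  rw [km, kp_cls, DH.swap_gen_bas]

lemma kp_add (α β : K0 A) : kp k hered (α + β) = kp k hered α * kp k hered β := by
  rw [kp, ofAdd_add, map_mul, Units.val_mul, kp, kp]

lemma kp_zero : kp k hered (0 : K0 A) = 1 := by
  rw [kp, ofAdd_zero, map_one, Units.val_one]

lemma km_add (α β : K0 A) : km k hered (α + β) = km k hered α * km k hered β := by
  rw [km, kp_add, map_mul, km, km]

lemma km_zero : km k hered (0 : K0 A) = 1 := by rw [km, kp_zero, map_one]

lemma swap_kp (α : K0 A) : DH.swap k (kp k hered α) = km k hered α := rfl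

lemma swap_km (α : K0 A) : DH.swap k (km k hered α) = kp k hered α := DH.swap_swap k _

lemma kp_mul_neg (α : K0 A) : kp k hered α * kp k hered (-α) = 1 := by
  rw [← kp_add, add_neg_cancel, kp_zero]

/-- A relation `K_α x = c(α) x K_α` holds for all `α` if it holds for classes of projectives. -/
lemma kp_comm_of_projective (c : K0 A →+ ℤ) (x : DH A k)
    (h : ∀ (P : A) [Projective P], kp k hered (cls P) * x =
      tt k ^ c (cls P) • (x * kp k hered (cls P))) (α : K0 A) :
    kp k hered α * x = tt k ^ c α • (x * kp k hered α) := by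
  have hneg : ∀ (P : A) [Projective P], kp k hered (-cls P) * x =
      tt k ^ c (-cls P) • (x * kp k hered (-cls P)) := fun P _ => by
    have e := congrArg (fun y => kp k hered (-cls P) * y * kp k hered (-cls P)) (h P)
    simp only [mul_smul_comm, smul_mul_assoc] at e
    have e₁ : kp k hered (-cls P) * (kp k hered (cls P) * x) * kp k hered (-cls P) =
        x * kp k hered (-cls P) := by
      rw [← mul_assoc, ← kp_add, neg_add_cancel, kp_zero, one_mul]
    have e₂ : kp k hered (-cls P) * (x * kp k hered (cls P)) * kp k hered (-cls P) =
        kp k hered (-cls P) * x := by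
      rw [mul_assoc, mul_assoc, ← kp_add, add_neg_cancel, kp_zero, mul_one]
    rw [e₁, e₂] at e
    rw [e, smul_smul, map_neg, ← tt_zpow_add, neg_add_cancel, zpow_zero, one_smul]
  obtain ⟨P, Q, _, _, rfl⟩ := hered.exists_sub α
  rw [sub_eq_add_neg, kp_add, mul_assoc, hneg Q, mul_smul_comm, ← mul_assoc, h P, smul_mul_assoc,
    smul_smul, ← tt_zpow_add, ← map_add, add_comm (-cls Q), mul_assoc]

/-- The symmetrized Euler form as a biadditive map. -/
def symHom : K0 A →+ K0 A →+ ℤ := eulerForm k + (eulerForm k).flip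

lemma symHom_apply (α β : K0 A) : symHom k α β = symForm k α β := rfl

lemma kp_mul_gen (α : K0 A) (M : Cx A) : kp k hered α * gen k (bas M) =
    tt k ^ symForm k α M.chi • (gen k (bas M) * kp k hered α) := by
  refine kp_comm_of_projective k hered ((symHom k).flip M.chi) _ (fun P _ => ?_) α
  rw [kp_cls, ← gen_hallMul, ← gen_hallMul, hallMul_kx_bas, hallMul_bas_kx, map_smul, map_smul,
    smul_smul, ← tt_zpow_add, AddMonoidHom.flip_apply, symHom_apply, symForm, chi,
    add_neg_cancel_right]

lemma kp_mul_km (α β : K0 A) : kp k hered α * km k hered β = km k hered β * kp k hered α := by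
  have h : ∀ (Q : A) [Projective Q] (α : K0 A),
      kp k hered α * km k hered (cls Q) = km k hered (cls Q) * kp k hered α := fun Q _ α => by
    rw [km_cls, kp_mul_gen, swap_chi, chi_kx, neg_zero, symForm, map_zero, map_zero,
      AddMonoidHom.zero_apply, add_zero, zpow_zero, one_smul]
  have e := kp_comm_of_projective k hered 0 (km k hered β) (fun P _ => by
    simpa [swap_kp, swap_km, -map_neg] using (congrArg (DH.swap k) (h P β)).symm) α
  simpa using e

/-- The elements `K_α` and `K'_β` together. -/
def kpm (γ : K0 A × K0 A) : DH A k := kp k hered γ.1 * km k hered γ.2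

lemma kpm_add (γ δ : K0 A × K0 A) : kpm k hered (γ + δ) = kpm k hered γ * kpm k hered δ := by
  rw [kpm, kpm, kpm, Prod.fst_add, Prod.snd_add, kp_add, km_add, mul_assoc, mul_assoc,
    ← mul_assoc (kp k hered δ.1), kp_mul_km, ← mul_assoc (km k hered γ.2), mul_assoc]

lemma kpm_zero : kpm k hered (0 : K0 A × K0 A) = 1 := by
  rw [kpm, Prod.fst_zero, Prod.snd_zero, kp_zero, km_zero, one_mul]

lemma kpm_comm (γ δ : K0 A × K0 A) :
    kpm k hered γ * kpm k hered δ = kpm k hered δ * kpm k hered γ := by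
  rw [← kpm_add, ← kpm_add, add_comm]

lemma kpm_fst (α : K0 A) : kpm k hered (α, 0) = kp k hered α := by rw [kpm, km_zero, mul_one]

lemma kpm_snd (α : K0 A) : kpm k hered (0, α) = km k hered α := by rw [kpm, kp_zero, one_mul]

lemma kpm_mul_neg (γ : K0 A × K0 A) : kpm k hered γ * kpm k hered (-γ) = 1 := by
  rw [← kpm_add, add_neg_cancel, kpm_zero]

lemma swap_kpm (γ : K0 A × K0 A) : DH.swap k (kpm k hered γ) = kpm k hered γ.swap := by
  rw [kpm, map_mul, swap_kp, swap_km, kpm, ← kp_mul_km]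
  rfl

/-- Right multiplication by the units `K_α K'_β`. -/
def torusRight (γ : K0 A × K0 A) : DH A k →ₗ[ℂ] DH A k :=
  LinearMap.mulRight ℂ (kpm k hered γ)

/-- In the localized Hall algebra, right multiplication by acyclic complexes extends to an action of
`K(A) × K(A)`. -/
lemma isLocalizing_gen : IsLocalizing k (gen k (A := A)) (torusRight k hered) where
  add γ δ x := by
    simp only [torusRight, LinearMap.mulRight_apply]
    rw [add_comm, kpm_add, mul_assoc]
  zero x := by
    simp only [torusRight, LinearMap.mulRight_apply]
    rw [kpm_zero, mul_one]
  mul_kx M P _ := by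
    rw [gen_hallMul, torusRight, LinearMap.mulRight_apply, kpm_fst, kp_cls]
  mul_swap_kx M P _ := by
    rw [gen_hallMul, torusRight, LinearMap.mulRight_apply, kpm_snd, km_cls]

/-- The linear map from `LocSpace` to the localized Hall algebra that comes from the universal
property of `LocSpace`. -/
def ofLoc : LocSpace A →ₗ[ℂ] DH A k := ((isLocalizing_gen k hered).exists_lift hered).choose

lemma ofLoc_lam (M : Cx A) : ofLoc k hered (lam k M) = gen k (bas M) :=
  ((isLocalizing_gen k hered).exists_lift hered).choose_spec.1 M

lemma ofLoc_shiftLoc (γ : K0 A × K0 A) (x : LocSpace A) :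
    ofLoc k hered (shiftLoc γ x) = ofLoc k hered x * kpm k hered γ :=
  ((isLocalizing_gen k hered).exists_lift hered).choose_spec.2 γ x

/-! ### The action of the localized Hall algebra on `LocSpace` -/

section Universal

variable {k}
variable {W : Type*} [AddCommGroup W] [Module ℂ W]
  {φ : HallCx A →ₗ[ℂ] W} {σ : K0 A × K0 A → W →ₗ[ℂ] W}

lemma IsLocalizing.map_mul_kx (h : IsLocalizing k φ σ) (x : HallCx A) (P : A) [Projective P] :
    φ (hallMul k x (bas (kx P))) = σ (cls P, 0) (φ x) :=
  LinearMap.congr_fun (f := φ ∘ₗ (hallMul k).flip (bas (kx P))) (g := σ (cls P, 0) ∘ₗ φ)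
    (HallCx.hom_ext fun M => h.mul_kx M P) x

lemma IsLocalizing.map_mul_swap_kx (h : IsLocalizing k φ σ) (x : HallCx A) (P : A)
    [Projective P] : φ (hallMul k x (bas (kx P).swap)) = σ (0, cls P) (φ x) :=
  LinearMap.congr_fun (f := φ ∘ₗ (hallMul k).flip (bas (kx P).swap)) (g := σ (0, cls P) ∘ₗ φ)
    (HallCx.hom_ext fun M => h.mul_swap_kx M P) x

lemma IsLocalizing.comp_hallMul (h : IsLocalizing k φ σ) (x : HallCx A) :
    IsLocalizing k (φ ∘ₗ hallMul k x) σ where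
  add := h.add
  zero := h.zero
  mul_kx M P _ := by
    simp only [LinearMap.comp_apply, ← hallMul_assoc, h.map_mul_kx]
  mul_swap_kx M P _ := by
    simp only [LinearMap.comp_apply, ← hallMul_assoc, h.map_mul_swap_kx]

end Universal

/-- Left multiplication on the twisted Hall algebra commutes with right multiplication by acyclic
complexes, so that it extends to `LocSpace`. -/
lemma exists_actHall (hered : Hereditary A) (x : HallCx A) : ∃ f : LocSpace A →ₗ[ℂ] LocSpace A,
    (∀ M, f (lam k M) = lamHall k (hallMul k x (bas M))) ∧
      ∀ γ y, f (shiftLoc γ y) = shiftLoc γ (f y) :=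
  ((isLocalizing_lamHall k).comp_hallMul x).exists_lift hered

/-- Left multiplication by elements of the twisted Hall algebra, on `LocSpace`. -/
def actHall : HallCx A →ₗ[ℂ] Module.End ℂ (LocSpace A) where
  toFun x := (exists_actHall k hered x).choose
  map_add' x y := LocSpace.hom_ext k hered fun γ M => by
    rw [LinearMap.add_apply, (exists_actHall k hered _).choose_spec.2,
      (exists_actHall k hered _).choose_spec.2, (exists_actHall k hered _).choose_spec.2,
      (exists_actHall k hered _).choose_spec.1, (exists_actHall k hered _).choose_spec.1,
      (exists_actHall k hered _).choose_spec.1, map_add, LinearMap.add_apply, map_add, map_add]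
  map_smul' c x := LocSpace.hom_ext k hered fun γ M => by
    rw [LinearMap.smul_apply, (exists_actHall k hered _).choose_spec.2,
      (exists_actHall k hered _).choose_spec.2, (exists_actHall k hered _).choose_spec.1,
      (exists_actHall k hered _).choose_spec.1, map_smul, LinearMap.smul_apply, map_smul, map_smul]
    rfl

lemma actHall_lam (x : HallCx A) (M : Cx A) :
    actHall k hered x (lam k M) = lamHall k (hallMul k x (bas M)) :=
  (exists_actHall k hered x).choose_spec.1 M

lemma actHall_shiftLoc (x : HallCx A) (γ : K0 A × K0 A) (y : LocSpace A) :
    actHall k hered x (shiftLoc γ y) = shiftLoc γ (actHall k hered x y) :=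
  (exists_actHall k hered x).choose_spec.2 γ y

lemma actHall_lamHall (x y : HallCx A) :
    actHall k hered x (lamHall k y) = lamHall k (hallMul k x y) :=
  LinearMap.congr_fun (f := actHall k hered x ∘ₗ lamHall k) (g := lamHall k ∘ₗ hallMul k x)
    (HallCx.hom_ext fun M => by
      rw [LinearMap.comp_apply, lamHall_bas, actHall_lam, LinearMap.comp_apply]) y

lemma actHall_hallMul (x y : HallCx A) :
    actHall k hered (hallMul k x y) = actHall k hered x * actHall k hered y := by
  refine LocSpace.hom_ext k hered fun γ M => ?_
  rw [Module.End.mul_apply, actHall_shiftLoc, actHall_shiftLoc, actHall_shiftLoc, actHall_lam,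
    actHall_lam, actHall_lamHall, hallMul_assoc]

lemma actHall_zero : actHall k hered (bas (zero A)) = 1 := by
  refine LocSpace.hom_ext k hered fun γ M => ?_
  rw [actHall_shiftLoc, actHall_lam, hallMul_zero_bas, lamHall_bas, Module.End.one_apply]

lemma actHall_kx (P : A) [Projective P] : actHall k hered (bas (kx P)) =
    scaleShift k (fun a => symForm k (cls P) (isoCls a.1 - isoCls a.2)) (cls P, 0) := by
  refine LocSpace.hom_ext k hered fun γ M => ?_
  rw [actHall_shiftLoc, actHall_lam, hallMul_kx_bas, map_smul, lamHall_bas, lam, lam, wt_dsum_kx,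
    map_smul, map_smul, shiftLoc_single, map_smul, shiftLoc_single, map_smul, scaleShift_single,
    smul_smul, smul_smul, ← tt_zpow_add, ← tt_zpow_add, hom_dsum_kx, Cx.bd, Cx.bd, bd₁_dsum_kx,
    bd₀_dsum_kx, ← chi_eq, symForm, ← chi]
  congr 2
  · ring
  · simp only [true_and, Prod.ext_iff, Prod.fst_add, Prod.snd_add]
    constructor <;> abel

lemma actHall_swap_kx (P : A) [Projective P] : actHall k hered (bas (kx P).swap) =
    scaleShift k (fun a => -symForm k (cls P) (isoCls a.1 - isoCls a.2)) (0, cls P) := by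
  refine LocSpace.hom_ext k hered fun γ M => ?_
  rw [actHall_shiftLoc, actHall_lam, hallMul_swap_kx_bas, map_smul, lamHall_bas, lam, lam,
    wt_swap, wt_dsum_kx, wt_swap, swap_chi,
    map_smul, map_smul, shiftLoc_single, map_smul, shiftLoc_single, map_smul, scaleShift_single,
    smul_smul, smul_smul, ← tt_zpow_add, ← tt_zpow_add, swap_hom, hom_dsum_kx, swap_hom, Cx.bd,
    Cx.bd, swap_bd₁, swap_bd₀, bd₁_dsum_kx, bd₀_dsum_kx, swap_bd₁, swap_bd₀, ← chi_eq, symForm,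
    Prod.swap_swap, map_neg, AddMonoidHom.neg_apply]
  congr 2
  · ring
  · simp only [true_and, Prod.ext_iff, Prod.fst_add, Prod.snd_add]
    constructor <;> abel

lemma hallMul_kx_swap_kx (P Q : A) [Projective P] [Projective Q] :
    hallMul k (bas (kx P)) (bas (kx Q).swap) = bas (kxkx P Q) := by
  rw [hallMul_bas_swap_kx, chi_kx, map_zero, AddMonoidHom.zero_apply, zpow_zero, one_smul]

lemma exists_act : ∃ f : DH A k →ₐ[ℂ] Module.End ℂ (LocSpace A),
    ∀ x, f (gen k x) = actHall k hered x := by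
  refine DH.exists_lift (B := Module.End ℂ (LocSpace A)) (actHall k hered)
    (actHall_zero k hered) (actHall_hallMul k hered) fun M hM => ?_
  obtain ⟨P, Q, _, _, h⟩ := hered.exists_kxkx hM
  rw [bas, h, ← bas, ← hallMul_kx_swap_kx k, actHall_hallMul, actHall_kx, actHall_swap_kx]
  exact (isUnit_scaleShift k _ _).mul (isUnit_scaleShift k _ _)

/-- The action of the localized Hall algebra on `LocSpace`. It exists because the classes of acyclic
complexes act by invertible maps, see `actHall_kx` and `actHall_swap_kx`. -/
def act : DH A k →ₐ[ℂ] Module.End ℂ (LocSpace A) := (exists_act k hered).choose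

lemma act_gen (x : HallCx A) : act k hered (gen k x) = actHall k hered x :=
  (exists_act k hered).choose_spec x

/-- The action corresponds to left multiplication. -/
lemma ofLoc_act (x : DH A k) (y : LocSpace A) :
    ofLoc k hered (act k hered x y) = x * ofLoc k hered y := by
  let S : Subalgebra ℂ (DH A k) :=
    { carrier := {x | ∀ y, ofLoc k hered (act k hered x y) = x * ofLoc k hered y}
      mul_mem' := fun {a b} ha hb y => by
        rw [map_mul, Module.End.mul_apply, ha, hb, mul_assoc]
      add_mem' := fun {a b} ha hb y => by
        rw [map_add, LinearMap.add_apply, map_add, ha, hb, add_mul]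
      algebraMap_mem' := fun r y => by
        rw [AlgHom.commutes, Module.algebraMap_end_apply, map_smul, Algebra.smul_def] }
  refine DH.induction S (fun M => ?_) (fun u hu y => ?_) x y
  · have hlin : ∀ z : HallCx A, ofLoc k hered (lamHall k z) = gen k z := fun z =>
      LinearMap.congr_fun (f := ofLoc k hered ∘ₗ lamHall k) (g := gen k)
        (HallCx.hom_ext fun N => by rw [LinearMap.comp_apply, lamHall_bas, ofLoc_lam]) z
    refine fun y => LinearMap.congr_fun (f := ofLoc k hered ∘ₗ act k hered (gen k (bas M)))
      (g := LinearMap.mulLeft ℂ (gen k (bas M)) ∘ₗ ofLoc k hered)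
      (LocSpace.hom_ext k hered fun γ N => ?_) y
    rw [LinearMap.comp_apply, act_gen, actHall_shiftLoc, actHall_lam, ofLoc_shiftLoc, hlin,
      gen_hallMul, LinearMap.comp_apply, LinearMap.mulLeft_apply, ofLoc_shiftLoc, ofLoc_lam,
      mul_assoc]
  · have h := hu (act k hered ((u⁻¹ : (DH A k)ˣ) : DH A k) y)
    rw [← Module.End.mul_apply, ← map_mul, Units.mul_inv, map_one, Module.End.one_apply] at h
    rw [h, ← mul_assoc, Units.inv_mul, one_mul]

variable (A) in
/-- The vector of `LocSpace` that represents the unit. -/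
def locOne : LocSpace A := Finsupp.single ((isoClass 0, isoClass 0), 0) 1

lemma lam_eq_of_hom {M : Cx A} (h : M.hom = (isoClass 0, isoClass 0)) :
    lam k M = shiftLoc M.bd (locOne A) := by
  rw [lam, Cx.wt, chi_eq, h, sub_self, map_zero, AddMonoidHom.zero_apply, zpow_zero, one_smul,
    locOne, shiftLoc_single, zero_add]

lemma lam_zero : lam k (zero A) = locOne A := by
  rw [lam_eq_of_hom k hom_zero, bd_zero, shiftLoc_zero]

lemma ofLoc_locOne : ofLoc k hered (locOne A) = 1 := by
  rw [← lam_zero k, ofLoc_lam, gen_zero]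

lemma act_gen_locOne (x : HallCx A) : act k hered (gen k x) (locOne A) = lamHall k x := by
  refine LinearMap.congr_fun (f := (act k hered).toLinearMap.flip (locOne A) ∘ₗ gen k)
    (g := lamHall k) (HallCx.hom_ext fun M => ?_) x
  change act k hered (gen k (bas M)) (locOne A) = _
  rw [← lam_zero k, act_gen, actHall_lam, hallMul_bas_zero]

/-- The action commutes with translations. -/
lemma act_shiftLoc (x : DH A k) (γ : K0 A × K0 A) (y : LocSpace A) :
    act k hered x (shiftLoc γ y) = shiftLoc γ (act k hered x y) := by
  let S : Subalgebra ℂ (DH A k) := (Subalgebra.centralizer ℂ {shiftLoc γ}).comap (act k hered)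
  have hS : ∀ x, x ∈ S ↔ ∀ y, act k hered x (shiftLoc γ y) = shiftLoc γ (act k hered x y) :=
    fun x => by
      rw [Subalgebra.mem_comap, Subalgebra.mem_centralizer_iff]
      simp only [Set.mem_singleton_iff, forall_eq]
      rw [LinearMap.ext_iff]
      exact forall_congr' fun y => eq_comm
  refine (hS x).1 (DH.induction S (fun M => (hS _).2 fun y => ?_)
    (fun u hu => (hS _).2 fun y => ?_) x) y
  · rw [act_gen, actHall_shiftLoc]
  · have h₁ : act k hered u (act k hered ((u⁻¹ : (DH A k)ˣ) : DH A k) y) = y := by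
      rw [← Module.End.mul_apply, ← map_mul, Units.mul_inv, map_one, Module.End.one_apply]
    have h₂ : ∀ z, act k hered ((u⁻¹ : (DH A k)ˣ) : DH A k) (act k hered u z) = z := fun z => by
      rw [← Module.End.mul_apply, ← map_mul, Units.inv_mul, map_one, Module.End.one_apply]
    have h := (hS _).1 hu (act k hered ((u⁻¹ : (DH A k)ˣ) : DH A k) y)
    rw [h₁] at h
    rw [← h, h₂]

lemma act_kp_locOne (α : K0 A) :
    act k hered (kp k hered α) (locOne A) = shiftLoc (α, 0) (locOne A) := by
  have h : ∀ (P : A) [Projective P],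
      act k hered (kp k hered (cls P)) (locOne A) = shiftLoc (cls P, 0) (locOne A) := fun P _ => by
    rw [kp_cls, act_gen, actHall_kx, locOne, scaleShift_single, shiftLoc_single, sub_self, symForm,
      map_zero, map_zero, AddMonoidHom.zero_apply, add_zero, zpow_zero, one_smul]
  obtain ⟨P, Q, _, _, rfl⟩ := hered.exists_sub α
  have h' : locOne A = act k hered (kp k hered (-cls Q)) (shiftLoc (cls Q, 0) (locOne A)) := by
    rw [← h Q, ← Module.End.mul_apply, ← map_mul, ← kp_add, neg_add_cancel, kp_zero, map_one,
      Module.End.one_apply]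
  rw [act_shiftLoc] at h'
  have h'' := congrArg (shiftLoc (-(cls Q, 0))) h'
  rw [← shiftLoc_add, neg_add_cancel, shiftLoc_zero] at h''
  rw [sub_eq_add_neg, add_comm, kp_add, map_mul, Module.End.mul_apply, h P, act_shiftLoc, ← h'',
    ← shiftLoc_add]
  simp [add_comm]

lemma act_km_locOne (α : K0 A) :
    act k hered (km k hered α) (locOne A) = shiftLoc (0, α) (locOne A) := by
  have h : ∀ (P : A) [Projective P],
      act k hered (km k hered (cls P)) (locOne A) = shiftLoc (0, cls P) (locOne A) := fun P _ => by
    rw [km_cls, act_gen, actHall_swap_kx, locOne, scaleShift_single, shiftLoc_single, sub_self,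
      symForm, map_zero, map_zero, AddMonoidHom.zero_apply, add_zero, neg_zero, zpow_zero,
      one_smul]
  obtain ⟨P, Q, _, _, rfl⟩ := hered.exists_sub α
  have h' : locOne A = act k hered (km k hered (-cls Q)) (shiftLoc (0, cls Q) (locOne A)) := by
    rw [← h Q, ← Module.End.mul_apply, ← map_mul, ← km_add, neg_add_cancel, km_zero, map_one,
      Module.End.one_apply]
  rw [act_shiftLoc] at h'
  have h'' := congrArg (shiftLoc (-(0, cls Q))) h'
  rw [← shiftLoc_add, neg_add_cancel, shiftLoc_zero] at h''
  rw [sub_eq_add_neg, add_comm, km_add, map_mul, Module.End.mul_apply, h P, act_shiftLoc, ← h'',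
    ← shiftLoc_add]
  simp [add_comm]

/-- The map `ofLoc` is injective: applying its values to the vector of the unit recovers the
argument. -/
lemma act_ofLoc (x : LocSpace A) : act k hered (ofLoc k hered x) (locOne A) = x := by
  refine LinearMap.congr_fun
    (f := (act k hered).toLinearMap.flip (locOne A) ∘ₗ ofLoc k hered) (g := LinearMap.id)
    (LocSpace.hom_ext k hered fun γ M => ?_) x
  change act k hered (ofLoc k hered (shiftLoc γ (lam k M))) (locOne A) = shiftLoc γ (lam k M)
  rw [ofLoc_shiftLoc, map_mul, Module.End.mul_apply, kpm, map_mul, Module.End.mul_apply,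
    act_km_locOne, act_shiftLoc, act_kp_locOne, ← shiftLoc_add, act_shiftLoc, ofLoc_lam,
    act_gen_locOne, lamHall_bas]
  simp

/-- The basis of the localized Hall algebra indexed by the homology of complexes and by the
classes of boundaries. -/
def locEquiv : LocSpace A ≃ₗ[ℂ] DH A k :=
  LinearEquiv.ofLinearMap (ofLoc k hered) ((act k hered).toLinearMap.flip (locOne A))
    (LinearMap.ext fun x => by
      change ofLoc k hered (act k hered x (locOne A)) = x
      rw [ofLoc_act, ofLoc_locOne, mul_one])
    (LinearMap.ext fun x => act_ofLoc k hered x)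

lemma locEquiv_apply (x : LocSpace A) : locEquiv k hered x = ofLoc k hered x := rfl

end Torus

end

noncomputable section

open Cx

/-! ### Products of classes of resolutions -/

section Resolutions

variable {A : Type u} [Category.{v} A] [Abelian A]

/-- A map of projectives as a complex, with zero differential from degree `0` to degree `1`. -/
abbrev Cx.res {P Q : A} (r : P ⟶ Q) [Projective P] [Projective Q] : Cx A where
  X₀ := Q
  X₁ := P
  d₀ := 0
  d₁ := r
  d₀₁ := zero_comp
  d₁₀ := comp_zero

/-- Pushing out a short exact sequence along a map out of its first term. -/
lemma shortExact_pushout {S : ShortComplex A} (hS : S.ShortExact) {X : A} (f : S.X₁ ⟶ X) :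
    (ShortComplex.mk (pushout.inl f S.f) (pushout.desc (0 : X ⟶ S.X₃) S.g (by simp))
      (pushout.inl_desc _ _ _)).ShortExact := by
  have := hS.mono_f
  have := hS.epi_g
  have : Epi (pushout.desc (0 : X ⟶ S.X₃) S.g (by simp) : pushout f S.f ⟶ _) :=
    epi_of_epi_fac (pushout.inr_desc _ _ _)
  have hl : IsColimit (CokernelCofork.ofπ (pushout.desc (0 : X ⟶ S.X₃) S.g (by simp))
      (pushout.inl_desc (f := f) (g := S.f) _ _ _)) :=
    CokernelCofork.IsColimit.ofπ' _ _ fun x hx =>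
      ⟨hS.exact.desc (pushout.inr _ _ ≫ x) (by rw [← pushout.condition_assoc, hx, comp_zero]), by
        ext
        · rw [pushout.inl_desc_assoc, zero_comp, hx]
        · rw [pushout.inr_desc_assoc, hS.exact.g_desc]⟩
  exact ShortComplex.ShortExact.mk' (S := ShortComplex.mk _ _ (pushout.inl_desc _ _ _))
    (ShortComplex.exact_of_g_is_cokernel _ hl) (by dsimp; infer_instance) (by dsimp; infer_instance)

lemma cls_eq_sub_of_shortExact {S : ShortComplex A} (hS : S.ShortExact) :
    cls S.X₃ = cls S.X₂ - cls S.X₁ := by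
  rw [cls_shortExact hS, add_sub_cancel_left]

/-- The lifts of a map from a projective along an epimorphism are a torsor under the maps to the
kernel. -/
lemma card_lift {S : ShortComplex A} (hS : S.ShortExact) {P : A} [Projective P] (f : P ⟶ S.X₃) :
    Nat.card {s : P ⟶ S.X₂ // s ≫ S.g = f} = Nat.card (P ⟶ S.X₁) := by
  have := hS.mono_f
  have := hS.epi_g
  have hσ : Projective.factorThru f S.g ≫ S.g = f := Projective.factorThru_comp _ _
  refine (Nat.card_congr (Equiv.ofBijective (fun h => ⟨Projective.factorThru f S.g + h ≫ S.f, by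
    rw [Preadditive.add_comp, hσ, Category.assoc, S.zero, comp_zero, add_zero]⟩)
    ⟨fun h h' e => ?_, fun s => ⟨hS.exact.lift (s.1 - Projective.factorThru f S.g) (by
      rw [Preadditive.sub_comp, hσ, s.2, sub_self]), Subtype.ext ?_⟩⟩)).symm
  · rw [← cancel_mono S.f]
    exact add_left_cancel (congrArg Subtype.val e)
  · change _ + _ = s.1
    rw [hS.exact.lift_f, add_sub_cancel]

section Positive

variable {S : ShortComplex A} [Projective S.X₁] [Projective S.X₂]
  {S' : ShortComplex A} [Projective S'.X₁] [Projective S'.X₂]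

/-- The extension of one resolution by another one that is defined by a map. -/
abbrev resCocycle (s : S.X₁ ⟶ S'.X₂) : Cocycle (res S.f) (res S'.f) := ⟨0, s, by simp, by simp⟩

/-- For resolutions, a cocycle is determined by its component of degree `1`, which is arbitrary. -/
lemma resCocycle_bijective (hS' : S'.ShortExact) :
    Function.Bijective (resCocycle (S := S) (S' := S')) := by
  have := hS'.mono_f
  refine ⟨fun s s' h => congrArg Cocycle.s₁ h, fun s => ⟨s.s₁, ?_⟩⟩
  have h : s.s₀ = 0 := by
    have := s.h₀
    simp only [zero_comp, add_zero] at this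
    exact zero_of_comp_mono S'.f this
  exact Cocycle.ext h.symm rfl

lemma hom_res (hS : S.ShortExact) : (res S.f).hom = (isoClass S.X₃, isoClass 0) := by
  have := hS.mono_f
  have := hS.epi_g
  refine hom_eq (M := res S.f)
    (leftHomologyDataOf (𝟙 S.X₂) S.f (by simp) (by simp) (fun x _ => ⟨x, by simp⟩) S.g S.zero
      (fun x hx => ⟨hS.exact.desc x hx, hS.exact.g_desc _ _⟩))
    (leftHomologyDataOf (0 : (0 : A) ⟶ S.X₁) 0 (by simp) (by simp)
      (fun x hx => ⟨0, ?_⟩) (0 : (0 : A) ⟶ 0) (by simp) (fun x _ => ⟨0, ?_⟩))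
  · rw [zero_of_comp_mono S.f hx, zero_comp]
  · exact (isZero_zero A).eq_of_src _ _

lemma bd_res (hS : S.ShortExact) : (res S.f).bd = (cls S.X₁, 0) := by
  have := hS.mono_f
  have := hS.epi_g
  rw [Cx.bd, bd₁_eq (M := res S.f) (leftHomologyDataOf (0 : (0 : A) ⟶ S.X₁) 0 (by simp) (by simp)
      (fun x hx => ⟨0, ?_⟩) (0 : (0 : A) ⟶ 0) (by simp) (fun x _ => ⟨0, ?_⟩)),
    bd₀_eq (M := res S.f) (leftHomologyDataOf (𝟙 S.X₂) S.f (by simp) (by simp)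
      (fun x _ => ⟨x, by simp⟩) S.g S.zero
      (fun x hx => ⟨hS.exact.desc x hx, hS.exact.g_desc _ _⟩))]
  · change (cls S.X₁ - cls (0 : A), cls S.X₂ - cls S.X₂) = _
    rw [cls_zero, sub_zero, sub_self]
  · rw [zero_of_comp_mono S.f hx, zero_comp]
  · exact (isZero_zero A).eq_of_src _ _

/-- An extension of resolutions resolves the corresponding extension of objects. -/
lemma shortExact_cone_res (hS : S.ShortExact) (hS' : S'.ShortExact) (s : S.X₁ ⟶ S'.X₂) :
    (ShortComplex.mk (cone (resCocycle s)).d₁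
    (biprod.desc (S'.g ≫ pushout.inl (s ≫ S'.g) S.f) (-pushout.inr (s ≫ S'.g) S.f)) (by
      ext
      · simp
      · simp [← pushout.condition])).ShortExact := by
  have := hS.mono_f
  have := hS'.mono_f
  have := hS.epi_g
  have := hS'.epi_g
  have hl : IsColimit (CokernelCofork.ofπ (f := (cone (resCocycle (S := S) (S' := S') s)).d₁)
      (biprod.desc (S'.g ≫ pushout.inl (s ≫ S'.g) S.f) (-pushout.inr (s ≫ S'.g) S.f)) (by
      ext
      · simp
      · simp [← pushout.condition])) := by
    have : Epi (biprod.desc (S'.g ≫ pushout.inl (s ≫ S'.g) S.f) (-pushout.inr (s ≫ S'.g) S.f)) := by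
      refine Preadditive.epi_of_cancel_zero _ fun x hx => ?_
      have h₁ := biprod.inl ≫= hx
      have h₂ := biprod.inr ≫= hx
      simp only [biprod.inl_desc_assoc, biprod.inr_desc_assoc, comp_zero, Category.assoc,
        Preadditive.neg_comp, neg_eq_zero] at h₁ h₂
      ext
      · rw [comp_zero]
        exact zero_of_epi_comp S'.g h₁
      · rw [comp_zero, h₂]
    refine CokernelCofork.IsColimit.ofπ' _ _ fun x hx => ?_
    have h₁ : S'.f ≫ biprod.inl ≫ x = 0 := by simpa using biprod.inl ≫= hx
    have h₂ : s ≫ biprod.inl ≫ x + S.f ≫ biprod.inr ≫ x = 0 := by simpa using biprod.inr ≫= hx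
    refine ⟨pushout.desc (hS'.exact.desc _ h₁) (-biprod.inr ≫ x) ?_, ?_⟩
    · rw [Category.assoc, hS'.exact.g_desc, Preadditive.comp_neg]
      exact eq_neg_of_add_eq_zero_left h₂
    · ext
      · rw [biprod.inl_desc_assoc, Category.assoc, pushout.inl_desc, hS'.exact.g_desc]
      · rw [biprod.inr_desc_assoc, Preadditive.neg_comp, pushout.inr_desc, neg_neg]
  have hm : Mono (cone (resCocycle (S := S) (S' := S') s)).d₁ := by
    refine Preadditive.mono_of_cancel_zero _ fun x hx => ?_
    have h₂ : x ≫ biprod.snd = 0 := by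
      have e : (cone (resCocycle (S := S) (S' := S') s)).d₁ ≫ biprod.snd = biprod.snd ≫ S.f := by
        ext <;> simp
      rw [← cancel_mono S.f, Category.assoc, ← e, reassoc_of% hx, zero_comp, zero_comp]
    have hx' := hx =≫ biprod.fst
    ext
    · rw [← cancel_mono S'.f]
      simpa [reassoc_of% h₂, biprod.desc_eq] using hx'
    · simpa using h₂
  exact ShortComplex.ShortExact.mk' (ShortComplex.exact_of_g_is_cokernel _ hl) hm (by
    exact epi_of_isColimit_cofork hl)

lemma cl_cone_res (s : S.X₁ ⟶ S'.X₂) :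
    (cone (resCocycle s)).cl = (res (cone (resCocycle (S := S) (S' := S') s)).d₁).cl := by
  refine cl_eq (M := cone (resCocycle s)) (N := res (cone (resCocycle s)).d₁)
    (Iso.refl _) (Iso.refl _) ?_ ?_
  · ext <;> simp
  · simp

end Positive

end Resolutions

lemma smul_finsum' {ι W : Type*} [Finite ι] [AddCommGroup W] [Module ℂ W] (c : ℂ) (f : ι → W) :
    c • ∑ᶠ i, f i = ∑ᶠ i, c • f i :=
  map_finsum' (LinearMap.lsmul ℂ W c) f

lemma finsum_mul' {ι B : Type*} [Finite ι] [Ring B] (f : ι → B) (b : B) :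
    (∑ᶠ i, f i) * b = ∑ᶠ i, f i * b :=
  map_finsum' (AddMonoidHom.mulRight b) f

/-- The difference of the classes of the two homology objects. -/
def chiOf {A : Type u} [Category.{v} A] [Abelian A] (a : IsoClasses A × IsoClasses A) :
    K0 A := isoCls a.1 - isoCls a.2

lemma chiOf_left {A : Type u} [Category.{v} A] [Abelian A] (X : A) :
    chiOf (isoClass X, isoClass (0 : A)) = cls X := by
  rw [chiOf, isoCls_isoClass, isoCls_isoClass, cls_zero, sub_zero]

lemma chiOf_right {A : Type u} [Category.{v} A] [Abelian A] (X : A) :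
    chiOf (isoClass (0 : A), isoClass X) = -cls X := by
  rw [chiOf, isoCls_isoClass, isoCls_isoClass, cls_zero, zero_sub]

lemma eq_of_tt_smul_eq (k : Type w) [Field k] [Finite k] {W : Type*} [AddCommGroup W] [Module ℂ W]
    {a b c : ℤ} {x y : W} (h : tt k ^ a • x = tt k ^ b • y) (hc : c = a - b) :
    y = tt k ^ c • x := by
  rw [hc, sub_eq_neg_add, tt_zpow_add, mul_smul, h, smul_smul, ← tt_zpow_add, neg_add_cancel,
    zpow_zero, one_smul]

section Positive

variable (k : Type w) [Field k] {A : Type u} [Category.{v} A] [Abelian A] [Linear k A]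
  [Finite k] [HomFinite A] [EnoughProjectives A] [FiniteGlobalDimension A]
  (hered : Hereditary A)

/-! ### The basis of the localized Hall algebra -/

/-- The element `X_a` of the localized Hall algebra that represents a pair `a` of homology
objects. -/
def xx (a : IsoClasses A × IsoClasses A) : DH A k := ofLoc k hered (Finsupp.single (a, 0) 1)

lemma ofLoc_single (x : LocIndex A) :
    ofLoc k hered (Finsupp.single x 1) = xx k hered x.1 * kpm k hered x.2 := by
  rw [xx, ← ofLoc_shiftLoc, shiftLoc_single, zero_add]

/-- The class of a complex in terms of the basis. -/
lemma gen_bas (M : Cx A) :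
    gen k (bas M) = tt k ^ M.wt k • (xx k hered M.hom * kpm k hered M.bd) := by
  rw [← ofLoc_lam k hered, lam, map_smul, ofLoc_single]

lemma xx_eq (M : Cx A) :
    xx k hered M.hom = tt k ^ (-M.wt k) • (gen k (bas M) * kpm k hered (-M.bd)) := by
  rw [gen_bas k hered, smul_mul_assoc, smul_smul, ← tt_zpow_add, neg_add_cancel, zpow_zero,
    one_smul, mul_assoc, kpm_mul_neg, mul_one]

lemma xx_zero : xx k hered (isoClass (0 : A), isoClass 0) = 1 := ofLoc_locOne k hered

lemma swap_xx (a : IsoClasses A × IsoClasses A) :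
    DH.swap k (xx k hered a) = xx k hered a.swap := by
  obtain ⟨M, rfl⟩ := hered.exists_hom_eq a
  rw [xx_eq, map_smul, map_mul, DH.swap_gen_bas, swap_kpm, ← swap_hom, xx_eq, wt_swap]
  rfl

lemma kp_mul_xx (α : K0 A) (a : IsoClasses A × IsoClasses A) : kp k hered α * xx k hered a =
    tt k ^ symForm k α (chiOf a) • (xx k hered a * kp k hered α) := by
  obtain ⟨M, rfl⟩ := hered.exists_hom_eq a
  rw [xx_eq, mul_smul_comm, ← mul_assoc, kp_mul_gen, smul_mul_assoc, mul_assoc, smul_mul_assoc,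
    mul_assoc, ← kpm_fst k hered α, kpm_comm, smul_comm, chi_eq, chiOf]

variable {S : ShortComplex A} [Projective S.X₁] [Projective S.X₂]
  {S' : ShortComplex A} [Projective S'.X₁] [Projective S'.X₂]

lemma gen_res (hS : S.ShortExact) : gen k (bas (res S.f)) =
    tt k ^ eulerForm k (cls S.X₃) (cls S.X₁) •
      (xx k hered (isoClass S.X₃, isoClass 0) * kp k hered (cls S.X₁)) := by
  rw [gen_bas k hered, hom_res hS, bd_res hS, kpm_fst, Cx.wt]
  have h := bd_res hS
  rw [Cx.bd, Prod.mk.injEq] at h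
  rw [h.1, h.2, sub_zero, Cx.chi, cls_eq_sub_of_shortExact hS]

/-- Multiplication of the positive basis elements, expressed by resolutions of the factors. -/
lemma xx_mul_xx (hS : S.ShortExact) (hS' : S'.ShortExact) :
    xx k hered (isoClass S.X₃, isoClass 0) * xx k hered (isoClass S'.X₃, isoClass 0) =
      tt k ^ (eulerForm k (cls S.X₃) (cls S'.X₃) - 2 * eulerForm k (cls S.X₂) (cls S'.X₃)) •
        ∑ᶠ f : S.X₁ ⟶ S'.X₃, xx k hered (isoClass (pushout f S.f), isoClass 0) := by
  have := HomFinite.finite_hom (A := A)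
  have := hS'.mono_f
  have := hS'.epi_g
  have hK : ∀ x y : DH A k, x * kp k hered (cls S.X₁ + cls S'.X₁) =
      y * kp k hered (cls S.X₁ + cls S'.X₁) → x = y := fun x y h => by
    have := congrArg (· * kp k hered (-(cls S.X₁ + cls S'.X₁))) h
    simpa only [mul_assoc, kp_mul_neg, mul_one] using this
  have hgen := gen_hallMul k (bas (res S.f)) (bas (res S'.f))
  rw [hallMul_bas, map_smul, map_finsum', finsum_equiv' (Equiv.ofBijective _
    (resCocycle_bijective (S := S) hS')).symm _ (fun s => gen k (bas (cone (resCocycle s))))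
    (fun s => by
      rw [← Equiv.ofBijective_apply _ (resCocycle_bijective (S := S) hS'),
        Equiv.apply_symm_apply])] at hgen
  -- the middle terms depend only on the composition of `s` with the projection to `S'.X₃`
  have hterm : ∀ s : S.X₁ ⟶ S'.X₂, gen k (bas (cone (resCocycle s))) =
      tt k ^ eulerForm k (cls S.X₃ + cls S'.X₃) (cls S.X₁ + cls S'.X₁) •
        (xx k hered (isoClass (pushout (s ≫ S'.g) S.f), isoClass 0) *
          kp k hered (cls S.X₁ + cls S'.X₁)) := fun s => by
    have h := gen_res k hered (shortExact_cone_res hS hS' s)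
    have hc : cls (S'.X₁ ⊞ S.X₁) = cls S.X₁ + cls S'.X₁ := by rw [cls_biprod, add_comm]
    have hp : cls (pushout (s ≫ S'.g) S.f) = cls S.X₃ + cls S'.X₃ := by
      rw [cls_shortExact (shortExact_pushout hS (s ≫ S'.g)), add_comm]
    rw [bas, cl_cone_res s]
    refine h.trans ?_
    rw [hc, hp]
  have hsum : ∑ᶠ s : S.X₁ ⟶ S'.X₂, gen k (bas (cone (resCocycle (S := S) (S' := S') s))) =
      tt k ^ (eulerForm k (cls S.X₃ + cls S'.X₃) (cls S.X₁ + cls S'.X₁) +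
        2 * eulerForm k (cls S.X₁) (cls S'.X₁)) •
          ((∑ᶠ f : S.X₁ ⟶ S'.X₃, xx k hered (isoClass (pushout f S.f), isoClass 0)) *
            kp k hered (cls S.X₁ + cls S'.X₁)) := by
    rw [finsum_congr hterm, ← smul_finsum' (W := DH A k), tt_zpow_add, mul_smul,
      ← card_hom_of_projective k S.X₁ S'.X₁,
      finsum_comp_of_card_fiber (W := DH A k) (fun s : S.X₁ ⟶ S'.X₂ => s ≫ S'.g)
        (Nat.card (S.X₁ ⟶ S'.X₁)) (fun f => by rw [card_lift hS']) (fun f : S.X₁ ⟶ S'.X₃ =>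
          xx k hered (isoClass (pushout f S.f), isoClass 0) *
            kp k hered (cls S.X₁ + cls S'.X₁))]
    rw [finsum_mul' (B := DH A k)]
  rw [hsum, gen_res k hered hS, gen_res k hered hS', smul_mul_smul_comm, mul_assoc,
    ← mul_assoc (kp k hered _), kp_mul_xx, smul_mul_assoc, mul_smul_comm, mul_assoc, ← kp_add,
    ← mul_assoc, smul_smul, smul_smul, ← tt_zpow_add, ← tt_zpow_add, ← tt_zpow_add,
    chiOf_left] at hgen
  refine hK _ _ ?_
  rw [smul_mul_assoc]
  refine eq_of_tt_smul_eq k hgen ?_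
  simp only [eu, symForm, cls_eq_sub_of_shortExact hS, cls_eq_sub_of_shortExact hS', map_add,
    map_sub, AddMonoidHom.add_apply, AddMonoidHom.sub_apply]
  ring

end Positive

end

noncomputable section

open Cx

/-! ### The homology of an extension of a resolution by a shifted resolution -/

lemma Hereditary.exists_resolution {A : Type u} [Category.{v} A] [Abelian A]
    (hered : Hereditary A) [EnoughProjectives A] (a : IsoClasses A) :
    ∃ S : ShortComplex A, S.ShortExact ∧ Projective S.X₁ ∧ Projective S.X₂ ∧
      isoClass S.X₃ = a :=
  ⟨_, shortExact_kernel (Projective.π (rep a)), hered.projective_kernel _,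
    inferInstanceAs (Projective (Projective.over _)), isoClass_rep a⟩

section Mixed

variable {A : Type u} [Category.{v} A] [Abelian A]
variable {S : ShortComplex A} [Projective S.X₁] [Projective S.X₂]
  {S' : ShortComplex A} [Projective S'.X₁] [Projective S'.X₂]

/-- The map of objects that is induced by a cocycle from a resolution to a shifted resolution. -/
def inducedMap (hS : S.ShortExact) (s : Cocycle (res S.f) (res S'.f).swap) : S.X₃ ⟶ S'.X₃ :=
  haveI := hS.epi_g
  hS.exact.desc (s.s₀ ≫ S'.g) (by
    have h := s.h₁ =≫ S'.g
    simp only [Preadditive.add_comp, Category.assoc, S'.zero, comp_zero, zero_add,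
      zero_comp] at h
    exact h)

lemma g_inducedMap (hS : S.ShortExact) (s : Cocycle (res S.f) (res S'.f).swap) :
    S.g ≫ inducedMap hS s = s.s₀ ≫ S'.g :=
  haveI := hS.epi_g
  hS.exact.g_desc _ _

/-- The fibres of `inducedMap`: the cocycles that induce `f` correspond to the lifts of `f` to the
resolutions. -/
def inducedMapFiber (hS : S.ShortExact) (hS' : S'.ShortExact) (f : S.X₃ ⟶ S'.X₃) :
    {s : Cocycle (res S.f) (res S'.f).swap // inducedMap hS s = f} ≃
      {s : S.X₂ ⟶ S'.X₂ // s ≫ S'.g = S.g ≫ f} where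
  toFun s := ⟨s.1.s₀, by
    obtain ⟨s, rfl⟩ := s
    exact (g_inducedMap hS s).symm⟩
  invFun s :=
    haveI := hS'.mono_f
    ⟨⟨s.1, hS'.exact.lift (-S.f ≫ s.1) (by
        rw [Preadditive.neg_comp, Category.assoc, s.2, S.zero_assoc, zero_comp, neg_zero]),
      by simp, by
        change hS'.exact.lift _ _ ≫ S'.f + S.f ≫ s.1 = 0
        rw [hS'.exact.lift_f, neg_add_cancel]⟩, by
      have := hS.epi_g
      rw [← cancel_epi S.g, g_inducedMap]
      exact s.2⟩
  left_inv s := by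
    have := hS'.mono_f
    refine Subtype.ext (Cocycle.ext rfl ?_)
    rw [← cancel_mono S'.f]
    change hS'.exact.lift _ _ ≫ S'.f = _
    rw [hS'.exact.lift_f]
    exact (eq_neg_of_add_eq_zero_left s.1.h₁).symm
  right_inv s := rfl

variable (hS : S.ShortExact) (hS' : S'.ShortExact) (s : Cocycle (res S.f) (res S'.f).swap)

/-- The homology in degree `1` is the cokernel of the induced map. -/
def mixedData₁ : (cone s).sc₁.LeftHomologyData :=
  haveI := hS'.epi_g
  haveI := hS.epi_g
  leftHomologyDataOf (K := S'.X₂) (H := cokernel (inducedMap hS s)) biprod.inl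
    (biprod.desc S'.f s.s₀) (by ext <;> simp) (by simp)
    (fun x hx => ⟨x ≫ biprod.fst, by
      have := hS.mono_f
      have e : (cone s).d₁ ≫ biprod.snd = biprod.snd ≫ S.f := by ext <;> simp
      have h : x ≫ biprod.snd = 0 := by
        rw [← cancel_mono S.f, Category.assoc, ← e, reassoc_of% hx, zero_comp, zero_comp]
      ext <;> simp [h]⟩)
    (S'.g ≫ cokernel.π _) (by
      ext
      · simp
      · simp [← reassoc_of% (g_inducedMap hS s)])
    (fun x hx => ⟨cokernel.desc _ (hS'.exact.desc x (by simpa using biprod.inl ≫= hx)) (by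
      rw [← cancel_epi S.g, reassoc_of% (g_inducedMap hS s), hS'.exact.g_desc, comp_zero]
      simpa using biprod.inr ≫= hx), by
        rw [Category.assoc, cokernel.π_desc, hS'.exact.g_desc]⟩)

/-- The lift to the second resolution that parametrizes the cycles of degree `0`. -/
def cycleLift : pullback (kernel.ι (inducedMap hS s)) S.g ⟶ S'.X₁ :=
  haveI := hS'.mono_f
  hS'.exact.lift (-pullback.snd (kernel.ι (inducedMap hS s)) S.g ≫ s.s₀) (by
    rw [Preadditive.neg_comp, Category.assoc, ← g_inducedMap hS s, ← pullback.condition_assoc,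
      kernel.condition, comp_zero, neg_zero])

lemma cycleLift_f : cycleLift hS hS' s ≫ S'.f =
    -pullback.snd (kernel.ι (inducedMap hS s)) S.g ≫ s.s₀ :=
  haveI := hS'.mono_f
  hS'.exact.lift_f _ _

/-- Every cycle of degree `0` factors through the pullback. -/
lemma exists_cycle {T : A} (x : T ⟶ S'.X₁ ⊞ S.X₂) (hx : x ≫ (cone s).d₀ = 0) :
    ∃ y, y ≫ biprod.lift (cycleLift hS hS' s) (pullback.snd _ _) = x := by
  have := hS'.mono_f
  have hx' : (x ≫ biprod.fst) ≫ S'.f = -(x ≫ biprod.snd) ≫ s.s₀ := by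
    have h := hx =≫ biprod.fst
    have e : (cone s).d₀ ≫ biprod.fst = biprod.fst ≫ S'.f + biprod.snd ≫ s.s₀ := by
      ext <;> simp
    rw [Category.assoc, e, zero_comp, Preadditive.comp_add] at h
    simpa using eq_neg_of_add_eq_zero_left h
  have hz : (x ≫ biprod.snd) ≫ S.g ≫ inducedMap hS s = 0 := by
    have h := hx' =≫ S'.g
    rw [Category.assoc, S'.zero, comp_zero] at h
    rw [g_inducedMap, ← Category.assoc, ← neg_eq_zero, ← Preadditive.neg_comp, ← h]
  obtain ⟨y, hy⟩ : ∃ y : T ⟶ pullback (kernel.ι (inducedMap hS s)) S.g,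
      y ≫ pullback.snd _ _ = x ≫ biprod.snd :=
    ⟨pullback.lift (kernel.lift (inducedMap hS s) ((x ≫ biprod.snd) ≫ S.g) (by
      simpa using hz)) (x ≫ biprod.snd) (kernel.lift_ι _ _ _), pullback.lift_snd _ _ _⟩
  refine ⟨y, ?_⟩
  ext
  · rw [← cancel_mono S'.f, hx', Category.assoc, Category.assoc, biprod.lift_fst_assoc,
      cycleLift_f, Preadditive.comp_neg, reassoc_of% hy, Category.assoc]
  · rw [Category.assoc, biprod.lift_snd, hy]

/-- The inclusion of the kernel of `g` into the pullback of `g`. -/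
def toPullback (S : ShortComplex A) {X : A} (f : X ⟶ S.X₃) : S.X₁ ⟶ pullback f S.g :=
  pullback.lift 0 S.f (by rw [zero_comp, S.zero])

@[simp]
lemma toPullback_fst (S : ShortComplex A) {X : A} (f : X ⟶ S.X₃) :
    toPullback S f ≫ pullback.fst f S.g = 0 := pullback.lift_fst _ _ _

@[simp]
lemma toPullback_snd (S : ShortComplex A) {X : A} (f : X ⟶ S.X₃) :
    toPullback S f ≫ pullback.snd f S.g = S.f := pullback.lift_snd _ _ _

/-- The homology in degree `0` is the kernel of the induced map, and the cycles are its preimage in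
`S.X₂`. -/
def mixedData₀ : (cone s).sc₀.LeftHomologyData :=
  haveI := hS'.mono_f
  haveI := hS.mono_f
  haveI := hS.epi_g
  haveI : Mono (biprod.lift (cycleLift hS hS' s)
      (pullback.snd (kernel.ι (inducedMap hS s)) S.g)) :=
    mono_of_mono_fac (biprod.lift_snd _ _)
  leftHomologyDataOf (K := pullback (kernel.ι (inducedMap hS s)) S.g)
    (H := kernel (inducedMap hS s))
    (biprod.lift (cycleLift hS hS' s) (pullback.snd _ _))
    (biprod.desc 0 (toPullback S _)) (by
      ext
      · simp
      · simp
      · rw [← cancel_mono S'.f]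
        have h : toPullback S _ ≫ cycleLift hS hS' s ≫ S'.f = s.s₁ ≫ S'.f := by
          rw [cycleLift_f, Preadditive.comp_neg, ← Category.assoc, toPullback_snd]
          exact (eq_neg_of_add_eq_zero_left s.h₁).symm
        simpa using h
      · simp)
    (by
      ext
      · simp [cycleLift_f]
      · simp)
    (fun x hx => exists_cycle hS hS' s x hx) (pullback.fst _ _) (by ext <;> simp)
    (fun x hx =>
      have he := (shortExact_pullback hS (kernel.ι (inducedMap hS s))).exact
      have h : toPullback S (kernel.ι (inducedMap hS s)) ≫ x = 0 := by
        simpa using biprod.inr ≫= hx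
      haveI := (shortExact_pullback hS (kernel.ι (inducedMap hS s))).epi_g
      ⟨he.desc x h, he.g_desc x h⟩)

/-- The class of the image of a map. -/
def imCls {X Y : A} (f : X ⟶ Y) : K0 A := cls X - cls (kernel f)

lemma hom_mixed (hS : S.ShortExact) (hS' : S'.ShortExact)
    (s : Cocycle (res S.f) (res S'.f).swap) : (cone s).hom =
    (isoClass (kernel (inducedMap hS s)), isoClass (cokernel (inducedMap hS s))) :=
  hom_eq (mixedData₀ hS hS' s) (mixedData₁ hS hS' s)

lemma bd_mixed (hS : S.ShortExact) (hS' : S'.ShortExact)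
    (s : Cocycle (res S.f) (res S'.f).swap) : (cone s).bd =
      (cls S.X₁, cls S'.X₁ + imCls (inducedMap hS s)) := by
  have h₁ : (cone s).bd₁ = cls (S'.X₂ ⊞ S.X₁) - cls S'.X₂ := bd₁_eq (mixedData₁ hS hS' s)
  have h₀ : (cone s).bd₀ = cls (S'.X₁ ⊞ S.X₂) -
    cls (pullback (kernel.ι (inducedMap hS s)) S.g) := bd₀_eq (mixedData₀ hS hS' s)
  have h₂ := cls_shortExact (shortExact_pullback hS (kernel.ι (inducedMap hS s)))
  dsimp only at h₂
  rw [Cx.bd, h₁, h₀, h₂, cls_biprod, cls_biprod, imCls, cls_shortExact hS, Prod.mk.injEq]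
  constructor <;> abel

end Mixed

section Products

variable (k : Type w) [Field k] {A : Type u} [Category.{v} A] [Abelian A] [Linear k A]
  [Finite k] [HomFinite A] [EnoughProjectives A] [FiniteGlobalDimension A]
  (hered : Hereditary A)

variable {S : ShortComplex A} [Projective S.X₁] [Projective S.X₂]
  {S' : ShortComplex A} [Projective S'.X₁] [Projective S'.X₂]

lemma gen_swap_res (hS : S.ShortExact) : gen k (bas (res S.f).swap) =
    tt k ^ eulerForm k (cls S.X₃) (cls S.X₁) •
      (xx k hered (isoClass 0, isoClass S.X₃) * km k hered (cls S.X₁)) := by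
  rw [← DH.swap_gen_bas, gen_res k hered hS, map_smul, map_mul, swap_xx, swap_kp]
  rfl

/-- The product of a positive and a negative basis element, computed with given resolutions. -/
lemma xx_mul_xx_mixed_of_res (hS : S.ShortExact) (hS' : S'.ShortExact) :
    xx k hered (isoClass S.X₃, isoClass 0) * xx k hered (isoClass 0, isoClass S'.X₃) =
      ∑ᶠ f : S.X₃ ⟶ S'.X₃, tt k ^ (-eulerForm k (cls S.X₃ - cls S'.X₃) (imCls f)) •
        (xx k hered (isoClass (kernel f), isoClass (cokernel f)) * km k hered (imCls f)) := by
  have := HomFinite.finite_hom (A := A)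
  let F : (S.X₃ ⟶ S'.X₃) → DH A k := fun f =>
    tt k ^ (-eulerForm k (cls S.X₃ - cls S'.X₃) (imCls f)) •
        (xx k hered (isoClass (kernel f), isoClass (cokernel f)) * km k hered (imCls f))
  -- the torus element common to all terms, to be cancelled at the end
  let κ : DH A k := kpm k hered (cls S.X₁, cls S'.X₁)
  have hK : ∀ x y : DH A k, x * κ = y * κ → x = y := fun x y h => by
    have := congrArg (· * kpm k hered (-(cls S.X₁, cls S'.X₁))) h
    simpa only [mul_assoc, κ, kpm_mul_neg, mul_one] using this
  have hgen := gen_hallMul k (bas (res S.f)) (bas (res S'.f).swap)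
  rw [hallMul_bas, map_smul, map_finsum'] at hgen
  have hterm : ∀ s : Cocycle (res S.f) (res S'.f).swap, gen k (bas (cone s)) =
      tt k ^ eulerForm k (cls S.X₃ - cls S'.X₃) (cls S.X₁ - cls S'.X₁) •
        (F (inducedMap hS s) * κ) := fun s => by
    have h := bd_mixed hS hS' s
    have hc : (cone s).chi = cls S.X₃ - cls S'.X₃ := by
      change cls (S'.X₁ ⊞ S.X₂) - cls (S'.X₂ ⊞ S.X₁) = _
      rw [cls_biprod, cls_biprod, cls_shortExact hS, cls_shortExact hS']
      abel
    have hb := h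
    rw [Cx.bd, Prod.mk.injEq] at h
    rw [gen_bas k hered, hom_mixed hS hS', Cx.wt, hc, h.1, h.2, hb]
    dsimp only [F, κ]
    rw [smul_mul_assoc, smul_smul, ← tt_zpow_add, ← kpm_snd, mul_assoc, ← kpm_add,
      Prod.mk_add_mk, zero_add, ← map_neg, ← map_add]
    congr 4
    · abel
    · rw [add_comm]
  have hcard : ∀ f : S.X₃ ⟶ S'.X₃,
      (Nat.card {s : Cocycle (res S.f) (res S'.f).swap // inducedMap hS s = f} : ℂ) =
        Nat.card (S.X₂ ⟶ S'.X₁) := fun f => by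
    rw [Nat.card_congr (inducedMapFiber hS hS' f), card_lift hS']
  rw [finsum_congr hterm, ← smul_finsum' (W := DH A k),
    finsum_comp_of_card_fiber (W := DH A k) (inducedMap hS) _ hcard (fun f => F f * κ),
    card_hom_of_projective k, gen_res k hered hS, gen_swap_res k hered hS', smul_mul_smul_comm,
    mul_assoc, ← mul_assoc (kp k hered _), kp_mul_xx, smul_mul_assoc, mul_smul_comm, mul_assoc,
    show kp k hered (cls S.X₁) * km k hered (cls S'.X₁) = κ from rfl, ← mul_assoc, smul_smul,
    smul_smul, smul_smul, ← tt_zpow_add, ← tt_zpow_add,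
    ← tt_zpow_add, ← tt_zpow_add, chiOf_right] at hgen
  refine hK _ _ ?_
  rw [finsum_mul' (B := DH A k)]
  refine (eq_of_tt_smul_eq k (c := 0) hgen ?_).trans (by rw [zpow_zero, one_smul])
  simp only [eu, symForm, cls_eq_sub_of_shortExact hS, cls_eq_sub_of_shortExact hS', map_sub,
    map_neg, AddMonoidHom.sub_apply, AddMonoidHom.neg_apply]
  ring

/-- The product of a positive and a negative basis element is a sum over maps. -/
lemma xx_mul_xx_mixed (X Y : A) :
    xx k hered (isoClass X, isoClass 0) * xx k hered (isoClass 0, isoClass Y) =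
      ∑ᶠ f : X ⟶ Y, tt k ^ (-eulerForm k (cls X - cls Y) (imCls f)) •
        (xx k hered (isoClass (kernel f), isoClass (cokernel f)) * km k hered (imCls f)) := by
  have := hered.projective_kernel (Projective.π X)
  have := hered.projective_kernel (Projective.π Y)
  exact xx_mul_xx_mixed_of_res (S := ShortComplex.mk (kernel.ι (Projective.π X)) (Projective.π X)
    (kernel.condition _)) (S' := ShortComplex.mk (kernel.ι (Projective.π Y)) (Projective.π Y)
    (kernel.condition _)) k hered (shortExact_kernel _) (shortExact_kernel _)

/-! ### The two copies of the extended Hall algebra -/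

/-- The positive copy of the basis of the extended Hall algebra. -/
def pos (x : ExtIndex A) : DH A k := xx k hered (x.1, isoClass 0) * kp k hered x.2

/-- The negative copy of the basis of the extended Hall algebra. -/
def neg (x : ExtIndex A) : DH A k := xx k hered (isoClass 0, x.1) * km k hered x.2

lemma swap_pos (x : ExtIndex A) : DH.swap k (pos k hered x) = neg k hered x := by
  rw [pos, map_mul, swap_xx, swap_kp]
  rfl

lemma pos_one : pos k hered extOne = 1 := by
  rw [pos, extOne, xx_zero, kp_zero, one_mul]

/-- The positive basis elements multiply as in the extended Hall algebra. -/
lemma pos_mul (x y : ExtIndex A) :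
    pos k hered x * pos k hered y = Finsupp.linearCombination ℂ (pos k hered) (extMul k x y) := by
  have := HomFinite.finite_hom (A := A)
  obtain ⟨a, α⟩ := x
  obtain ⟨b, β⟩ := y
  obtain ⟨S, hS, _, _, rfl⟩ := hered.exists_resolution a
  obtain ⟨S', hS', _, _, rfl⟩ := hered.exists_resolution b
  have h := extMul_eq k hS (Z := S'.X₃) (fun f => pushout f S.f) (fun f => pushout.inl f S.f)
    (fun f => pushout.desc 0 S.g (by simp)) (fun f => pushout.inl_desc _ _ _)
    (fun f => shortExact_pushout hS f) (fun f => pushout.inr f S.f)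
    (fun f => pushout.condition.symm) (fun f => pushout.inr_desc _ _ _) α β
  rw [h, map_finsum', pos, pos, mul_assoc, ← mul_assoc (kp k hered α), kp_mul_xx, smul_mul_assoc,
    mul_assoc, ← kp_add, mul_smul_comm, ← mul_assoc, xx_mul_xx k hered hS hS', smul_mul_assoc,
    smul_smul, ← tt_zpow_add, finsum_mul' (B := DH A k), smul_finsum' (W := DH A k), chiOf_left]
  refine finsum_congr fun f => ?_
  rw [map_smul, Finsupp.linearCombination_single, one_smul, add_sub_assoc]
  rfl

lemma neg_one : neg k hered extOne = 1 := by
  rw [← swap_pos, pos_one, map_one]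

/-- The negative basis elements multiply as in the extended Hall algebra. -/
lemma neg_mul (x y : ExtIndex A) :
    neg k hered x * neg k hered y = Finsupp.linearCombination ℂ (neg k hered) (extMul k x y) := by
  rw [← swap_pos, ← swap_pos, ← map_mul, pos_mul]
  refine LinearMap.congr_fun (f := (DH.swap k).toLinearMap ∘ₗ
    Finsupp.linearCombination ℂ (pos k hered)) ?_ _
  ext x
  simp [swap_pos]

end Products

end

noncomputable section

open Cx

/-! ### Counting maps by their kernel, image and cokernel -/

section Counting

variable {A : Type u} [Category.{v} A] [Abelian A]

lemma isoClass_image {B I X : A} (e : B ⟶ I) (m : I ⟶ X) [Epi e] [Mono m] :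
    isoClass (image (e ≫ m)) = isoClass I :=
  have := strongEpi_of_epi e
  isoClass_congr (image.isoStrongEpiMono e m rfl).symm

lemma imCls_eq {X Y : A} (f : X ⟶ Y) : imCls f = cls (image f) := by
  rw [imCls, cls_congr (kernelIsoOfEq (image.fac f).symm ≪≫ kernelCompMono (factorThruImage f) _),
    cls_kernel_add (factorThruImage f), add_sub_cancel_left]

/-- The subobjects of `Y` that are isomorphic to `Z` with quotient isomorphic to `X`. -/
abbrev SubobjectsOf (X Z Y : A) : Type _ :=
  {S : Subobject Y // Nonempty ((S : A) ≅ Z) ∧ Nonempty (cokernel S.arrow ≅ X)}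

/-- The map with a given image, a given kernel and a given identification of the coimage with the
image. -/
def mapOf {B X P C Q : A} (x : SubobjectsOf P C X × SubobjectsOf C Q B × (C ≅ C)) : B ⟶ X :=
  (cokernel.π x.2.1.1.arrow ≫ x.2.1.2.2.some.hom ≫ x.2.2.hom ≫ x.1.2.1.some.inv) ≫ x.1.1.arrow

lemma le_of_comp_eq {B X : A} {S S' : Subobject X} (e : B ⟶ S) (e' : B ⟶ S') [Epi e]
    (h : e ≫ S.arrow = e' ≫ S'.arrow) : S ≤ S' := by
  have := strongEpi_of_epi e
  have sq : CommSq e' e S'.arrow S.arrow := ⟨h.symm⟩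
  exact Subobject.le_of_comm sq.lift sq.fac_right

/-- The subobjects and the isomorphism are determined by the map. -/
lemma mapOf_injective {B X P C Q : A} :
    Function.Injective (mapOf : SubobjectsOf P C X × SubobjectsOf C Q B × (C ≅ C) → (B ⟶ X)) := by
  have hS : ∀ x y : SubobjectsOf P C X × SubobjectsOf C Q B × (C ≅ C), mapOf x = mapOf y →
      x.1.1 ≤ y.1.1 := fun x y h => le_of_comp_eq _ _ h
  have hT : ∀ x y : SubobjectsOf P C X × SubobjectsOf C Q B × (C ≅ C), mapOf x = mapOf y →
      x.2.1.1 ≤ y.2.1.1 := fun x y h => by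
    have h' := x.2.1.1.arrow ≫= h
    rw [mapOf, mapOf, Category.assoc, cokernel.condition_assoc, zero_comp] at h'
    have hz : x.2.1.1.arrow ≫ cokernel.π y.2.1.1.arrow = 0 := by
      rw [← cancel_mono ((y.2.1.2.2.some.hom ≫ y.2.2.hom ≫ y.1.2.1.some.inv) ≫ y.1.1.arrow),
        zero_comp, h']
      simp
    have hE := (shortExact_cokernel y.2.1.1.arrow).exact
    exact Subobject.le_of_comm (hE.lift _ hz) (hE.lift_f _ hz)
  rintro ⟨S, T, σ⟩ ⟨S', T', σ'⟩ h
  obtain rfl : S = S' := Subtype.ext (le_antisymm (hS _ _ h) (hS _ _ h.symm))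
  obtain rfl : T = T' := Subtype.ext (le_antisymm (hT _ _ h) (hT _ _ h.symm))
  have : σ = σ' := by
    apply Iso.ext
    rw [mapOf, mapOf, cancel_mono, cancel_epi, cancel_epi] at h
    exact (cancel_mono _).1 h
  rw [this]

/-- Every map arises from its image and its kernel. -/
lemma exists_mapOf {B X P C Q : A} (g : B ⟶ X) (h₁ : Nonempty (cokernel g ≅ P))
    (h₂ : Nonempty (image g ≅ C)) (h₃ : Nonempty (kernel g ≅ Q)) :
    ∃ x : SubobjectsOf P C X × SubobjectsOf C Q B × (C ≅ C), mapOf x = g := by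
  obtain ⟨p⟩ := h₁
  obtain ⟨c⟩ := h₂
  obtain ⟨q⟩ := h₃
  have hfac := imageSubobject_arrow_comp g
  have hk : (kernelSubobject g).arrow ≫ factorThruImageSubobject g = 0 := by
    rw [← cancel_mono (imageSubobject g).arrow, Category.assoc, hfac, kernelSubobject_arrow_comp,
      zero_comp]
  have hl : IsLimit (KernelFork.ofι (kernelSubobject g).arrow hk) :=
    KernelFork.IsLimit.ofι' _ _ fun x hx =>
      ⟨factorThruKernelSubobject g x (by rw [← hfac, reassoc_of% hx, zero_comp]), by simp⟩
  let u : cokernel (kernelSubobject g).arrow ≅ (imageSubobject g : A) :=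
    (cokernelIsCokernel _).coconePointUniqueUpToIso (Abelian.epiIsCokernelOfKernel _ hl)
  have hu : cokernel.π (kernelSubobject g).arrow ≫ u.hom = factorThruImageSubobject g :=
    IsColimit.comp_coconePointUniqueUpToIso_hom (cokernelIsCokernel _) _ WalkingParallelPair.one
  let S : SubobjectsOf P C X := ⟨imageSubobject g, ⟨imageSubobjectIso g ≪≫ c⟩,
    ⟨(cokernelEpiComp (factorThruImageSubobject g) _).symm ≪≫ cokernelIsoOfEq hfac ≪≫ p⟩⟩
  let T : SubobjectsOf C Q B := ⟨kernelSubobject g, ⟨kernelSubobjectIso g ≪≫ q⟩,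
    ⟨u ≪≫ imageSubobjectIso g ≪≫ c⟩⟩
  refine ⟨⟨S, T, T.2.2.some.symm ≪≫ u ≪≫ S.2.1.some⟩, ?_⟩
  simp only [mapOf, Iso.trans_hom, Iso.symm_hom, Category.assoc, Iso.hom_inv_id_assoc]
  change cokernel.π (kernelSubobject g).arrow ≫ u.hom ≫ (imageSubobject g).arrow = g
  rw [reassoc_of% hu, hfac]

lemma isoClass_mapOf {B X P C Q : A} (x : SubobjectsOf P C X × SubobjectsOf C Q B × (C ≅ C)) :
    isoClass (cokernel (mapOf x)) = isoClass P ∧ isoClass (image (mapOf x)) = isoClass C ∧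
      isoClass (kernel (mapOf x)) = isoClass Q := by
  refine ⟨?_, ?_, ?_⟩
  · rw [mapOf, isoClass_congr (cokernelEpiComp _ _)]
    exact isoClass_congr x.1.2.2.some
  · rw [mapOf, isoClass_image]
    exact isoClass_congr x.1.2.1.some
  · rw [mapOf, isoClass_congr (kernelCompMono _ _), isoClass_congr (kernelCompMono _ _)]
    have i : kernel (cokernel.π x.2.1.1.arrow) ≅ (x.2.1.1 : A) :=
      (kernelIsKernel _).conePointUniqueUpToIso (shortExact_cokernel x.2.1.1.arrow).fIsKernel
    exact isoClass_congr (i ≪≫ x.2.1.2.1.some)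

/-- The number of maps with given kernel, image and cokernel. -/
lemma card_maps (B X : A) (P C Q : IsoClasses A) :
    Nat.card {g : B ⟶ X // isoClass (cokernel g) = P ∧ isoClass (image g) = C ∧
      isoClass (kernel g) = Q} =
    subobjectCount (rep P) (rep C) X * (subobjectCount (rep C) (rep Q) B *
      Nat.card (Aut (rep C))) := by
  have e : {g : B ⟶ X // isoClass (cokernel g) = P ∧ isoClass (image g) = C ∧
      isoClass (kernel g) = Q} ≃
      SubobjectsOf (rep P) (rep C) X × SubobjectsOf (rep C) (rep Q) B × (rep C ≅ rep C) := by
    have hx : ∀ x : SubobjectsOf (rep P) (rep C) X × SubobjectsOf (rep C) (rep Q) B ×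
        (rep C ≅ rep C), isoClass (cokernel (mapOf x)) = P ∧ isoClass (image (mapOf x)) = C ∧
          isoClass (kernel (mapOf x)) = Q := fun x => by
      simpa only [isoClass_rep] using isoClass_mapOf x
    refine (Equiv.ofBijective (fun x => ⟨mapOf x, hx x⟩) ⟨fun x y h => mapOf_injective
      (congrArg Subtype.val h), fun g => ?_⟩).symm
    · obtain ⟨g, h₁, h₂, h₃⟩ := g
      rw [← isoClass_rep P, isoClass_eq_iff] at h₁
      rw [← isoClass_rep C, isoClass_eq_iff] at h₂
      rw [← isoClass_rep Q, isoClass_eq_iff] at h₃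
      obtain ⟨x, hx⟩ := exists_mapOf g h₁ h₂ h₃
      exact ⟨x, Subtype.ext hx⟩
  rw [Nat.card_congr e, Nat.card_prod, Nat.card_prod]
  rfl

end Counting

section Coproduct

variable (k : Type w) [Field k] {A : Type u} [Category.{v} A] [Abelian A] [Linear k A]
  [Finite k] [HomFinite A] [EnoughProjectives A] [FiniteGlobalDimension A]

/-- The pair of tensors `x₍₁₎ ⊗ x₍₂₎`, `y₍₁₎ ⊗ y₍₂₎` in which a map `g` from `y` to `x` contributes
to the product of the coproducts. -/
def tensorsOf {X Y : A} (α β : K0 A) (g : Y ⟶ X) :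
    (ExtIndex A × ExtIndex A) × (ExtIndex A × ExtIndex A) :=
  (((isoClass (cokernel g), cls (image g) + α), (isoClass (image g), α)),
    ((isoClass (image g), cls (kernel g) + β), (isoClass (kernel g), β)))

/-- Contracting the inner factors of two coproducts by Green's pairing amounts to a sum over all
maps: subobjects of the two objects with isomorphic inner subquotients, together with an
isomorphism, are the same as a map. -/
lemma finsum_coproduct {W : Type*} [AddCommGroup W] [Module ℂ W] (x y : ExtIndex A)
    (F : ExtIndex A → ExtIndex A → W) :
    ∑ᶠ p : (ExtIndex A × ExtIndex A) × (ExtIndex A × ExtIndex A),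
        (coproductCoeff k x p.1.1 p.1.2 * coproductCoeff k y p.2.1 p.2.2 *
          greenPairing k p.1.2 p.2.1) • F p.1.1 p.2.2 =
      ∑ᶠ g : rep y.1 ⟶ rep x.1,
        tt k ^ (eulerForm k (cls (cokernel g)) (cls (image g)) +
          eulerForm k (cls (image g)) (cls (kernel g)) +
          symForm k x.2 (cls (kernel g) + y.2)) •
        F (isoClass (cokernel g), cls (image g) + x.2) (isoClass (kernel g), y.2) := by
  have := HomFinite.finite_hom (A := A)
  let G : (ExtIndex A × ExtIndex A) × (ExtIndex A × ExtIndex A) → W := fun p =>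
    tt k ^ (eulerForm k (isoCls p.1.1.1) (isoCls p.1.2.1) +
      eulerForm k (isoCls p.2.1.1) (isoCls p.2.2.1) + symForm k p.1.2.2 p.2.1.2) • F p.1.1 p.2.2
  have hG : ∀ g : rep y.1 ⟶ rep x.1, tt k ^ (eulerForm k (cls (cokernel g)) (cls (image g)) +
      eulerForm k (cls (image g)) (cls (kernel g)) + symForm k x.2 (cls (kernel g) + y.2)) •
        F (isoClass (cokernel g), cls (image g) + x.2) (isoClass (kernel g), y.2) =
      G (tensorsOf x.2 y.2 g) := fun g => by
    simp only [G, tensorsOf, isoCls_isoClass]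
  rw [finsum_congr hG, ← finsum_card_fiber_smul]
  refine finsum_congr fun p => ?_
  obtain ⟨⟨⟨P, π⟩, ⟨C, γ⟩⟩, ⟨⟨C', γ'⟩, ⟨Q, κ⟩⟩⟩ := p
  by_cases h : (π = isoCls C + x.2 ∧ γ = x.2) ∧ (γ' = isoCls Q + y.2 ∧ κ = y.2) ∧ C = C'
  · obtain ⟨⟨rfl, rfl⟩, ⟨rfl, rfl⟩, rfl⟩ := h
    have hc : Nat.card {g : rep y.1 ⟶ rep x.1 // tensorsOf x.2 y.2 g =
        (((P, isoCls C + x.2), (C, x.2)), ((C, isoCls Q + y.2), (Q, y.2)))} =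
        subobjectCount (rep P) (rep C) (rep x.1) * (subobjectCount (rep C) (rep Q) (rep y.1) *
          Nat.card (Aut (rep C))) := by
      rw [← card_maps]
      refine Nat.card_congr (Equiv.subtypeEquivRight fun g => ?_)
      simp only [tensorsOf, Prod.mk.injEq, and_true]
      constructor
      · rintro ⟨⟨⟨h₁, -⟩, h₂⟩, -, h₃⟩
        exact ⟨h₁, h₂, h₃⟩
      · rintro ⟨h₁, h₂, h₃⟩
        rw [← h₂, ← h₃, isoCls_isoClass, isoCls_isoClass]
        exact ⟨⟨⟨h₁, rfl⟩, rfl⟩, ⟨rfl, rfl⟩, rfl⟩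
    rw [hc]
    simp only [coproductCoeff, greenPairing, and_self, if_true, G, smul_smul]
    congr 1
    push_cast
    rw [tt_zpow_add, tt_zpow_add]
    ring
  · have h₁ : coproductCoeff k x (P, π) (C, γ) * coproductCoeff k y (C', γ') (Q, κ) *
        greenPairing k (C, γ) (C', γ') = 0 := by
      simp only [coproductCoeff, greenPairing]
      split_ifs with h₁ h₂ h₃
      · exact absurd ⟨h₁, h₂, h₃⟩ h
      all_goals simp
    have h₂ : IsEmpty {g : rep y.1 ⟶ rep x.1 // tensorsOf x.2 y.2 g =
        (((P, π), (C, γ)), ((C', γ'), (Q, κ)))} := by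
      refine ⟨fun g => h ?_⟩
      obtain ⟨g, hg⟩ := g
      simp only [tensorsOf, Prod.mk.injEq] at hg
      obtain ⟨⟨⟨-, rfl⟩, rfl, rfl⟩, ⟨rfl, rfl⟩, rfl, rfl⟩ := hg
      simp only [isoCls_isoClass, and_self]
    rw [h₁, zero_smul, Nat.card_of_isEmpty, Nat.cast_zero, zero_smul]

lemma greenPairing_comm (x y : ExtIndex A) : greenPairing k x y = greenPairing k y x := by
  by_cases h : x.1 = y.1
  · rw [greenPairing, greenPairing, if_pos h, if_pos h.symm, h, symForm_comm]
  · rw [greenPairing, greenPairing, if_neg h, if_neg (Ne.symm h)]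

/-- The companion of `finsum_coproduct` that contracts the outer factors. -/
lemma finsum_coproduct' {W : Type*} [AddCommGroup W] [Module ℂ W] (x y : ExtIndex A)
    (F : ExtIndex A → ExtIndex A → W) :
    ∑ᶠ p : (ExtIndex A × ExtIndex A) × (ExtIndex A × ExtIndex A),
        (coproductCoeff k x p.1.1 p.1.2 * coproductCoeff k y p.2.1 p.2.2 *
          greenPairing k p.1.1 p.2.2) • F p.2.1 p.1.2 =
      ∑ᶠ g : rep x.1 ⟶ rep y.1,
        tt k ^ (eulerForm k (cls (cokernel g)) (cls (image g)) +
          eulerForm k (cls (image g)) (cls (kernel g)) +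
          symForm k y.2 (cls (kernel g) + x.2)) •
        F (isoClass (cokernel g), cls (image g) + y.2) (isoClass (kernel g), x.2) := by
  rw [← finsum_coproduct k y x F]
  exact finsum_eq_of_bijective Prod.swap Prod.swap_bijective fun p => by
    rw [Prod.fst_swap, Prod.snd_swap, greenPairing_comm, mul_comm (coproductCoeff k x _ _)]

end Coproduct

end

noncomputable section

open Cx

/-! ### Pairs of maps with zero compositions -/

section Pairs

variable {A : Type u} [Category.{v} A] [Abelian A]

/-- Maps in opposite directions whose two compositions are zero. -/
structure OrthPair (X Y : A) where
  /-- the map from `Y` to `X` -/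
  g : Y ⟶ X
  /-- the map from `X` to `Y` -/
  h : X ⟶ Y
  gh : g ≫ h = 0
  hg : h ≫ g = 0

variable {X Y : A}

/-- Exchange of the two maps. -/
def OrthPair.symm : OrthPair X Y ≃ OrthPair Y X where
  toFun p := ⟨p.h, p.g, p.hg, p.gh⟩
  invFun p := ⟨p.h, p.g, p.hg, p.gh⟩

instance [HomFinite A] : Finite (OrthPair X Y) := by
  have := HomFinite.finite_hom X Y
  have := HomFinite.finite_hom Y X
  exact Finite.of_injective (fun p : OrthPair X Y => (p.g, p.h))
    fun ⟨_, _, _, _⟩ ⟨_, _, _, _⟩ h => by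
      cases h
      rfl

/-- The homology at `X`; the homology at `Y` is that of `p.symm`. -/
def OrthPair.homology (p : OrthPair X Y) : A := (ShortComplex.mk p.g p.h p.gh).homology

/-- A pair amounts to its first map `g` and a map from the cokernel to the kernel of `g`, through
which the second map factors. -/
def orthPairEquiv : (Σ g : Y ⟶ X, cokernel g ⟶ kernel g) ≃ OrthPair X Y where
  toFun x := ⟨x.1, cokernel.π x.1 ≫ x.2 ≫ kernel.ι x.1, by simp, by simp⟩
  invFun p := ⟨p.g, cokernel.desc p.g (kernel.lift p.g p.h p.hg) (by
    rw [← cancel_mono (kernel.ι p.g), Category.assoc, kernel.lift_ι, p.gh, zero_comp])⟩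
  left_inv x := by
    obtain ⟨g, h⟩ := x
    refine Sigma.ext rfl (heq_of_eq ?_)
    rw [← cancel_epi (cokernel.π g), ← cancel_mono (kernel.ι g)]
    simp
  right_inv p := by
    obtain ⟨g, h, gh, hg⟩ := p
    simp

lemma isoClass_kernel_orthPairEquiv (x : Σ g : Y ⟶ X, cokernel g ⟶ kernel g) :
    isoClass (kernel x.2) = isoClass (orthPairEquiv x).homology := by
  obtain ⟨g, h⟩ := x
  have e : cokernel.desc g (cokernel.π g ≫ h ≫ kernel.ι g) (by simp) = h ≫ kernel.ι g := by
    rw [← cancel_epi (cokernel.π g), cokernel.π_desc]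
  exact isoClass_congr ((kernelCompMono h (kernel.ι g)).symm ≪≫ kernelIsoOfEq e.symm ≪≫
    (ShortComplex.RightHomologyData.ofHasCokernelOfHasKernel
      (ShortComplex.mk g (cokernel.π g ≫ h ≫ kernel.ι g) (by simp))).homologyIso.symm)

lemma isoClass_cokernel_orthPairEquiv (x : Σ g : Y ⟶ X, cokernel g ⟶ kernel g) :
    isoClass (cokernel x.2) = isoClass (OrthPair.symm (orthPairEquiv x)).homology := by
  obtain ⟨g, h⟩ := x
  have e : kernel.lift g (cokernel.π g ≫ h ≫ kernel.ι g) (by simp) = cokernel.π g ≫ h := by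
    rw [← cancel_mono (kernel.ι g), kernel.lift_ι, Category.assoc]
  exact isoClass_congr ((cokernelEpiComp (cokernel.π g) h).symm ≪≫ cokernelIsoOfEq e.symm ≪≫
    (ShortComplex.LeftHomologyData.ofHasKernelOfHasCokernel
      (ShortComplex.mk (cokernel.π g ≫ h ≫ kernel.ι g) g (by simp))).homologyIso.symm)

lemma imCls_orthPairEquiv (x : Σ g : Y ⟶ X, cokernel g ⟶ kernel g) :
    imCls (orthPairEquiv x).h = imCls x.2 := by
  rw [imCls_eq, imCls_eq]
  have h : (orthPairEquiv x).h =
      (cokernel.π x.1 ≫ factorThruImage x.2) ≫ image.ι x.2 ≫ kernel.ι x.1 := by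
    simp [orthPairEquiv]
  have := isoClass_image (cokernel.π x.1 ≫ factorThruImage x.2) (image.ι x.2 ≫ kernel.ι x.1)
  rw [h, ← isoCls_isoClass, this, isoCls_isoClass]

lemma cls_sub_cls (g : Y ⟶ X) : cls (cokernel g) - cls (kernel g) = cls X - cls Y := by
  have := cls_sub_kernel g
  rw [sub_eq_sub_iff_add_eq_add] at this ⊢
  rw [add_comm, add_comm (cls X)]
  rw [this]
  abel

end Pairs

/-! ### The cross relation -/

section Cross

variable (k : Type w) [Field k] {A : Type u} [Category.{v} A] [Abelian A] [Linear k A]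
  [Finite k] [HomFinite A] [EnoughProjectives A] [FiniteGlobalDimension A]
  (hered : Hereditary A)

/-- One side of the cross relation, as a sum over pairs of maps with zero compositions. -/
lemma finsum_pos_mul_neg (X Y : A) (α β : K0 A) :
    ∑ᶠ g : Y ⟶ X, tt k ^ (eulerForm k (cls (cokernel g)) (cls (image g)) +
          eulerForm k (cls (image g)) (cls (kernel g)) + symForm k α (cls (kernel g) + β)) •
        (pos k hered (isoClass (cokernel g), cls (image g) + α) *
          neg k hered (isoClass (kernel g), β)) =
      ∑ᶠ p : OrthPair X Y, tt k ^ (symForm k α β +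
          eulerForm k (cls X - cls Y) (imCls p.g - imCls p.h)) •
        (xx k hered (isoClass p.homology, isoClass p.symm.homology) *
          kpm k hered (imCls p.g + α, imCls p.h + β)) := by
  have := HomFinite.finite_hom (A := A)
  rw [← finsum_equiv' (W := DH A k) orthPairEquiv (fun x => tt k ^ (symForm k α β +
          eulerForm k (cls X - cls Y) (imCls x.1 - imCls x.2)) •
        (xx k hered (isoClass (kernel x.2), isoClass (cokernel x.2)) *
          kpm k hered (imCls x.1 + α, imCls x.2 + β))) _ (fun x => by
      rw [isoClass_kernel_orthPairEquiv, isoClass_cokernel_orthPairEquiv, imCls_orthPairEquiv]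
      rfl),
    finsum_sigma' (W := DH A k)]
  refine finsum_congr fun g => ?_
  have e : pos k hered (isoClass (cokernel g), cls (image g) + α) *
      neg k hered (isoClass (kernel g), β) =
        tt k ^ (-symForm k (cls (image g) + α) (cls (kernel g))) •
          ((xx k hered (isoClass (cokernel g), isoClass 0) *
            xx k hered (isoClass 0, isoClass (kernel g))) * kpm k hered (cls (image g) + α, β)) := by
    rw [pos, neg, mul_assoc, ← mul_assoc (kp k hered _), kp_mul_xx, chiOf_right, smul_mul_assoc,
      mul_smul_comm, mul_assoc, ← mul_assoc (xx k hered _), kpm]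
    congr 2
    simp only [symForm, map_neg, AddMonoidHom.neg_apply]
    ring
  rw [e, xx_mul_xx_mixed, finsum_mul' (B := DH A k), smul_smul, ← tt_zpow_add,
    smul_finsum' (W := DH A k)]
  refine finsum_congr fun h => ?_
  rw [smul_mul_assoc, smul_smul, ← tt_zpow_add, mul_assoc, ← kpm_snd, ← kpm_add, Prod.mk_add_mk,
    zero_add, imCls_eq g, cls_sub_cls]
  congr 2
  rw [← cls_sub_cls g]
  simp only [symForm, map_add, map_sub, AddMonoidHom.add_apply, AddMonoidHom.sub_apply]
  ring

/-- The cross relation of the Drinfeld double holds in the localized Hall algebra. -/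
lemma pos_neg_cross (x y : ExtIndex A) :
    ∑ᶠ p : (ExtIndex A × ExtIndex A) × (ExtIndex A × ExtIndex A),
        (coproductCoeff k x p.1.1 p.1.2 * coproductCoeff k y p.2.1 p.2.2 *
          greenPairing k p.1.2 p.2.1) • (pos k hered p.1.1 * neg k hered p.2.2) =
      ∑ᶠ p : (ExtIndex A × ExtIndex A) × (ExtIndex A × ExtIndex A),
        (coproductCoeff k x p.1.1 p.1.2 * coproductCoeff k y p.2.1 p.2.2 *
          greenPairing k p.1.1 p.2.2) • (neg k hered p.2.1 * pos k hered p.1.2) := by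
  have := HomFinite.finite_hom (A := A)
  rw [finsum_coproduct (W := DH A k) k x y fun p q => pos k hered p * neg k hered q,
    finsum_coproduct' (W := DH A k) k x y fun p q => neg k hered p * pos k hered q,
    finsum_pos_mul_neg]
  -- the exchange of the degrees maps one side of the relation to the other one
  have hs : ∀ p q, neg k hered p * pos k hered q =
      DH.swap k (pos k hered p * neg k hered q) := fun p q => by
    rw [map_mul, swap_pos, ← swap_pos k hered q, DH.swap_swap]
  have h := congrArg (DH.swap k) (finsum_pos_mul_neg k hered (rep y.1) (rep x.1) y.2 x.2)
  rw [map_finsum', map_finsum'] at h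
  simp only [map_smul, ← hs] at h
  rw [h]
  refine finsum_equiv' (W := DH A k) OrthPair.symm _ _ fun p => ?_
  rw [map_mul, swap_xx, swap_kpm, symForm_comm, ← neg_sub (cls (rep y.1)), ← neg_sub (imCls p.h)]
  simp only [map_neg, AddMonoidHom.neg_apply, neg_neg]
  rfl

end Cross

end

noncomputable section

open Cx

/-! ### Triangular linear maps -/

section Triangular

variable {ι : Type*}

/-- An endomorphism that is triangular with respect to a well-founded relation is bijective. -/
lemma bijective_of_triangular {r : ι → ι → Prop} (hr : WellFounded r)
    (T : (ι →₀ ℂ) →ₗ[ℂ] (ι →₀ ℂ)) (c : ι → ℂ) (hc : ∀ i, c i ≠ 0)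
    (hT : ∀ i, T (Finsupp.single i 1) - c i • Finsupp.single i 1 ∈
      Finsupp.supported ℂ ℂ {j | r j i}) : Function.Bijective T := by
  constructor
  · rw [← LinearMap.ker_eq_bot, LinearMap.ker_eq_bot']
    intro x hx
    by_contra hne
    have hne : x.support.Nonempty := Finsupp.support_nonempty_iff.2 hne
    let r' : x.support → x.support → Prop := fun i j => Relation.TransGen r j i
    have : IsTrans x.support r' := ⟨fun _ _ _ h₁ h₂ => h₂.trans h₁⟩
    have : Std.Irrefl r' := ⟨fun i h => hr.transGen.irrefl.irrefl _ h⟩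
    have hwf : WellFounded r' := Finite.wellFounded_of_trans_of_irrefl r'
    -- an index of the finite support that is maximal: no other term contributes at `i`
    obtain ⟨i, -, hi⟩ := hwf.has_min Set.univ ⟨⟨_, hne.choose_spec⟩, trivial⟩
    have hxi : x i.1 ≠ 0 := Finsupp.mem_support_iff.1 i.2
    have hval : ∀ j ∈ x.support, j ≠ i.1 → T (Finsupp.single j 1) i.1 = 0 := fun j hj hji => by
      have h := (Finsupp.mem_supported' ℂ _).1 (hT j) i.1
        (fun h => hi ⟨j, hj⟩ trivial (Relation.TransGen.single h))
      rwa [Finsupp.sub_apply, Finsupp.smul_apply, Finsupp.single_eq_of_ne hji.symm, smul_zero,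
        sub_zero] at h
    have hval' : T (Finsupp.single i.1 1) i.1 = c i.1 := by
      have h := (Finsupp.mem_supported' ℂ _).1 (hT i.1) i.1 (hr.irrefl.irrefl _)
      rwa [Finsupp.sub_apply, Finsupp.smul_apply, Finsupp.single_eq_same, smul_eq_mul, mul_one,
        sub_eq_zero] at h
    have hTx : ∀ l, T x l = ∑ j ∈ x.support, x j * T (Finsupp.single j 1) l := fun l => by
      conv_lhs => rw [← Finsupp.sum_single x]
      rw [Finsupp.sum, map_sum, Finsupp.finsetSum_apply]
      refine Finset.sum_congr rfl fun j _ => ?_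
      rw [← mul_one (x j), ← smul_eq_mul, ← Finsupp.smul_single, map_smul, Finsupp.smul_apply]
      simp
    have hTx := hTx i.1
    rw [hx, Finsupp.zero_apply, Finset.sum_eq_single_of_mem i.1 i.2
      (fun j hj hji => by rw [hval j hj hji, mul_zero]), hval'] at hTx
    exact mul_ne_zero hxi (hc _) hTx.symm
  · rw [← LinearMap.range_eq_top, eq_top_iff]
    have key : ∀ i, Finsupp.single i (1 : ℂ) ∈ LinearMap.range T := fun i => by
      induction i using hr.induction with
      | h i ih =>
        have h : T (Finsupp.single i 1) - c i • Finsupp.single i 1 ∈ LinearMap.range T := by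
          have h := hT i
          rw [Finsupp.supported_eq_span_single] at h
          refine Submodule.span_le.2 ?_ h
          rintro _ ⟨j, hj, rfl⟩
          exact ih j hj
        have h' := (LinearMap.range T).sub_mem (LinearMap.mem_range_self T (Finsupp.single i 1)) h
        rw [sub_sub_cancel] at h'
        simpa [smul_smul, hc i] using (LinearMap.range T).smul_mem (c i)⁻¹ h'
    intro x _
    rw [← Finsupp.sum_single x]
    refine Submodule.sum_mem _ fun i _ => ?_
    have := (LinearMap.range T).smul_mem (x i) (key i)
    rwa [Finsupp.smul_single, smul_eq_mul, mul_one] at this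

lemma mem_of_finsum_mem {κ W : Type*} [Finite κ] [AddCommGroup W] [Module ℂ W]
    (S : Submodule ℂ W) (f : κ → W) (i : κ) (h : ∑ᶠ j, f j ∈ S) (h' : ∀ j, j ≠ i → f j ∈ S) :
    f i ∈ S := by
  classical
  have := Fintype.ofFinite κ
  rw [finsum_eq_sum_of_fintype, ← Finset.add_sum_erase _ _ (Finset.mem_univ i)] at h
  exact (S.add_mem_iff_left (S.sum_mem fun j hj => h' j (Finset.ne_of_mem_erase hj))).1 h

lemma finsum_mem_submodule {κ W : Type*} [Finite κ] [AddCommGroup W] [Module ℂ W]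
    (S : Submodule ℂ W) (f : κ → W) (h : ∀ j, f j ∈ S) : ∑ᶠ j, f j ∈ S := by
  have := Fintype.ofFinite κ
  rw [finsum_eq_sum_of_fintype]
  exact S.sum_mem fun j _ => h j

lemma finsum_sub_mem_submodule {κ W : Type*} [Finite κ] [AddCommGroup W] [Module ℂ W]
    (S : Submodule ℂ W) (f : κ → W) (i : κ) (h : ∀ j, j ≠ i → f j ∈ S) :
    ∑ᶠ j, f j - f i ∈ S := by
  classical
  have := Fintype.ofFinite κ
  rw [finsum_eq_sum_of_fintype, ← Finset.add_sum_erase _ _ (Finset.mem_univ i),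
    add_sub_cancel_left]
  exact S.sum_mem fun j hj => h j (Finset.ne_of_mem_erase hj)

end Triangular

/-! ### Kernels and cokernels of nonzero maps -/

section WellFounded

variable {A : Type u} [Category.{v} A] [Abelian A]

/-- The relation that holds between a pair of objects and the kernel and the cokernel of a nonzero
map from the first to the second object of the pair. -/
def KerCokerRel (a b : IsoClasses A × IsoClasses A) : Prop :=
  ∃ f : rep b.1 ⟶ rep b.2, f ≠ 0 ∧ a = (isoClass (kernel f), isoClass (cokernel f))

/-- In the artinian case the kernel is a smaller subobject: induction on the subobjects of a
fixed `X`. -/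
lemma acc_of_artinian {X : A} [IsArtinianObject X] (S : Subobject X) (b : IsoClasses A) :
    Acc KerCokerRel (isoClass (S : A), b) := by
  induction S using WellFoundedLT.induction generalizing b with
  | ind S ih =>
    refine ⟨_, fun a ha => ?_⟩
    obtain ⟨f, hf, rfl⟩ := ha
    let f' : (S : A) ⟶ rep b := (repIso (S : A)).inv ≫ f
    have hf' : f' ≠ 0 := fun h => hf (by
      rw [← cancel_epi (repIso (S : A)).inv, comp_zero]
      exact h)
    have hle : Subobject.mk (kernel.ι f' ≫ S.arrow) ≤ S :=
      Subobject.mk_le_of_comm (kernel.ι f') rfl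
    have hlt : Subobject.mk (kernel.ι f' ≫ S.arrow) < S := lt_of_le_of_ne hle fun h => hf' (by
      have h₁ : Subobject.ofLEMk S (kernel.ι f' ≫ S.arrow) h.ge ≫ kernel.ι f' = 𝟙 _ := by
        rw [← cancel_mono S.arrow, Category.assoc, Subobject.ofLEMk_comp, Category.id_comp]
      rw [← Category.id_comp f', ← h₁, Category.assoc, kernel.condition, comp_zero])
    have h := ih _ hlt (isoClass (cokernel f))
    have e : isoClass (kernel f) = isoClass (Subobject.mk (kernel.ι f' ≫ S.arrow) : A) :=
      isoClass_congr ((kernelIsIsoComp (repIso (S : A)).inv f).symm ≪≫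
        (Subobject.underlyingIso _).symm)
    rwa [e]

/-- In the noetherian case the cokernel is a smaller quotient, by induction on the subobjects of a
fixed `X` that are the kernels of the projections. -/
lemma acc_of_noetherian {X : A} [IsNoetherianObject X] (S : Subobject X) (a : IsoClasses A) :
    Acc KerCokerRel (a, isoClass (cokernel S.arrow)) := by
  induction S using WellFoundedGT.induction generalizing a with
  | ind S ih =>
    refine ⟨_, fun b hb => ?_⟩
    obtain ⟨f, hf, rfl⟩ := hb
    let f' : rep a ⟶ cokernel S.arrow := f ≫ (repIso (cokernel S.arrow)).hom
    have hf' : f' ≠ 0 := fun h => hf (by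
      rw [← cancel_mono (repIso (cokernel S.arrow)).hom, zero_comp]
      exact h)
    let e : X ⟶ cokernel f' := cokernel.π S.arrow ≫ cokernel.π f'
    have hl : IsLimit (KernelFork.ofι (kernelSubobject e).arrow (kernelSubobject_arrow_comp e)) :=
      KernelFork.IsLimit.ofι' _ _ fun x hx => ⟨factorThruKernelSubobject e x hx, by simp⟩
    have hc := Abelian.epiIsCokernelOfKernel _ hl
    have hlt : S < kernelSubobject e := lt_of_le_of_ne
      (le_kernelSubobject _ _ (by simp [e])) fun h => hf' (by
        have h₁ : (kernelSubobject e).arrow ≫ cokernel.π S.arrow = 0 := by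
          rw [← Subobject.ofLE_arrow h.ge, Category.assoc, cokernel.condition, comp_zero]
        obtain ⟨d, hd⟩ := CokernelCofork.IsColimit.desc' hc _ h₁
        have hd' : cokernel.π f' ≫ d = 𝟙 _ := by
          rw [← cancel_epi (cokernel.π S.arrow), ← Category.assoc, Category.comp_id]
          exact hd
        rw [← Category.comp_id f', ← hd', cokernel.condition_assoc, zero_comp])
    have h := ih _ hlt (isoClass (kernel f))
    have e' : isoClass (cokernel f) = isoClass (cokernel (kernelSubobject e).arrow) :=
      isoClass_congr ((cokernelCompIsIso f (repIso (cokernel S.arrow)).hom).symm ≪≫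
        hc.coconePointUniqueUpToIso (colimit.isColimit _))
    rwa [e']

lemma wellFounded_kerCokerRel
    (h : (∀ X : A, IsArtinianObject X) ∨ (∀ X : A, IsNoetherianObject X)) :
    WellFounded (KerCokerRel (A := A)) := by
  refine ⟨fun ⟨a, b⟩ => ?_⟩
  rcases h with h | h
  · have := acc_of_artinian (⊤ : Subobject (rep a)) b
    rwa [isoClass_congr (asIso (⊤ : Subobject (rep a)).arrow), isoClass_rep] at this
  · have := acc_of_noetherian (⊥ : Subobject (rep b)) a
    rwa [isoClass_congr (cokernelIsoOfEq Subobject.bot_arrow ≪≫ cokernelZeroIsoTarget),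
      isoClass_rep] at this

end WellFounded

end

noncomputable section

open Cx

/-! ### The Drinfeld double -/

section Double

variable (k : Type w) [Field k] {A : Type u} [Category.{v} A] [Abelian A] [Linear k A]
  [Finite k] [HomFinite A] [EnoughProjectives A] [FiniteGlobalDimension A]

/-- The basis elements of the positive half of the double. -/
def dpos (x : ExtIndex A) : DrinfeldDouble k A := RingQuot.mkAlgHom ℂ (DoubleRel k A) (freePos x)

/-- The basis elements of the negative half of the double. -/
def dneg (x : ExtIndex A) : DrinfeldDouble k A := RingQuot.mkAlgHom ℂ (DoubleRel k A) (freeNeg x)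

lemma toDoublePos_single (x : ExtIndex A) : toDoublePos k A (Finsupp.single x 1) = dpos k x := by
  simp [toDoublePos, dpos]

lemma toDoubleNeg_single (x : ExtIndex A) : toDoubleNeg k A (Finsupp.single x 1) = dneg k x := by
  simp [toDoubleNeg, dneg]

lemma dpos_one : dpos k (extOne : ExtIndex A) = 1 := by
  rw [dpos, RingQuot.mkAlgHom_rel ℂ DoubleRel.one_pos, map_one]

lemma dneg_one : dneg k (extOne : ExtIndex A) = 1 := by
  rw [dneg, RingQuot.mkAlgHom_rel ℂ DoubleRel.one_neg, map_one]

lemma dpos_mul (x y : ExtIndex A) : dpos k x * dpos k y = toDoublePos k A (extMul k x y) := by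
  rw [dpos, dpos, ← map_mul, RingQuot.mkAlgHom_rel ℂ (DoubleRel.mul_pos x y)]
  rfl

lemma dneg_mul (x y : ExtIndex A) : dneg k x * dneg k y = toDoubleNeg k A (extMul k x y) := by
  rw [dneg, dneg, ← map_mul, RingQuot.mkAlgHom_rel ℂ (DoubleRel.mul_neg x y)]
  rfl

/-- The sum over maps to which one side of the cross relation reduces. The other side is the same
sum with the roles of `x` and `y` exchanged. -/
def crossSum {W : Type*} [AddCommGroup W] [Module ℂ W] (x y : ExtIndex A)
    (F : ExtIndex A → ExtIndex A → W) : W :=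
  ∑ᶠ g : rep y.1 ⟶ rep x.1, tt k ^ (eulerForm k (cls (cokernel g)) (cls (image g)) +
      eulerForm k (cls (image g)) (cls (kernel g)) + symForm k x.2 (cls (kernel g) + y.2)) •
    F (isoClass (cokernel g), cls (image g) + x.2) (isoClass (kernel g), y.2)

lemma map_crossSum {W W' : Type*} [AddCommGroup W] [Module ℂ W] [AddCommGroup W'] [Module ℂ W']
    (L : W →ₗ[ℂ] W') (x y : ExtIndex A) (F : ExtIndex A → ExtIndex A → W) :
    L (crossSum k x y F) = crossSum k x y fun p q => L (F p q) := by
  have := HomFinite.finite_hom (A := A)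
  simp only [crossSum, map_finsum', map_smul]

/-- The cross relation in terms of sums over maps. -/
lemma dpos_dneg_cross (x y : ExtIndex A) :
    crossSum k x y (fun p q => dpos k p * dneg k q) =
      crossSum k y x (fun p q => dneg k p * dpos k q) := by
  have h := RingQuot.mkAlgHom_rel ℂ (DoubleRel.cross (k := k) x y)
  rw [finsum_coproduct (W := DoubleFree A) k x y fun p q => freePos p * freeNeg q,
    finsum_coproduct' (W := DoubleFree A) k x y fun p q => freeNeg p * freePos q] at h
  have h₁ := map_crossSum (W := DoubleFree A) (W' := DrinfeldDouble k A) k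
    (RingQuot.mkAlgHom ℂ (DoubleRel k A)).toLinearMap x y fun p q => freePos p * freeNeg q
  have h₂ := map_crossSum (W := DoubleFree A) (W' := DrinfeldDouble k A) k
    (RingQuot.mkAlgHom ℂ (DoubleRel k A)).toLinearMap y x fun p q => freeNeg p * freePos q
  simp only [AlgHom.toLinearMap_apply, map_mul] at h₁ h₂
  exact h₁.symm.trans (h.trans h₂)

variable (hered : Hereditary A)

/-- The relations of the Drinfeld double hold in the localized Hall algebra. -/
lemma exists_toDH : ∃ Φ : DrinfeldDouble k A →ₐ[ℂ] DH A k,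
    (∀ x, Φ (dpos k x) = pos k hered x) ∧ ∀ x, Φ (dneg k x) = neg k hered x := by
  let F : DoubleFree A →ₐ[ℂ] DH A k :=
    FreeAlgebra.lift ℂ (Sum.elim (pos k hered) (neg k hered))
  have hp : ∀ x, F (freePos x) = pos k hered x := fun x => by simp [F, freePos]
  have hn : ∀ x, F (freeNeg x) = neg k hered x := fun x => by simp [F, freeNeg]
  have hp' : ∀ x, F (Finsupp.linearCombination ℂ freePos x) =
      Finsupp.linearCombination ℂ (pos k hered) x := fun x => by
    refine LinearMap.congr_fun (f := F.toLinearMap ∘ₗ Finsupp.linearCombination ℂ freePos) ?_ x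
    ext x
    simp [hp]
  have hn' : ∀ x, F (Finsupp.linearCombination ℂ freeNeg x) =
      Finsupp.linearCombination ℂ (neg k hered) x := fun x => by
    refine LinearMap.congr_fun (f := F.toLinearMap ∘ₗ Finsupp.linearCombination ℂ freeNeg) ?_ x
    ext x
    simp [hn]
  refine ⟨RingQuot.liftAlgHom ℂ ⟨F, fun x y h => ?_⟩, fun x => ?_, fun x => ?_⟩
  · cases h with
    | one_pos => rw [hp, pos_one, map_one]
    | one_neg => rw [hn, neg_one, map_one]
    | mul_pos x y => rw [map_mul, hp, hp, hp', pos_mul]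
    | mul_neg x y => rw [map_mul, hn, hn, hn', neg_mul]
    | cross x y =>
      have h := pos_neg_cross k hered x y
      rw [finsum_coproduct (W := DH A k) k x y fun p q => pos k hered p * neg k hered q,
        finsum_coproduct' (W := DH A k) k x y fun p q => neg k hered p * pos k hered q] at h
      rw [finsum_coproduct (W := DoubleFree A) k x y fun p q => freePos p * freeNeg q,
        finsum_coproduct' (W := DoubleFree A) k x y fun p q => freeNeg p * freePos q]
      have h₁ := map_crossSum (W := DoubleFree A) (W' := DH A k) k
        F.toLinearMap x y fun p q => freePos p * freeNeg q
      have h₂ := map_crossSum (W := DoubleFree A) (W' := DH A k) k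
        F.toLinearMap y x fun p q => freeNeg p * freePos q
      simp only [AlgHom.toLinearMap_apply, map_mul, hp, hn] at h₁ h₂
      exact h₁.trans (h.trans h₂.symm)
  · exact (RingQuot.liftAlgHom_mkAlgHom_apply ℂ F _ _).trans (hp x)
  · exact (RingQuot.liftAlgHom_mkAlgHom_apply ℂ F _ _).trans (hn x)

/-- The homomorphism from the Drinfeld double to the localized Hall algebra. -/
def toDH : DrinfeldDouble k A →ₐ[ℂ] DH A k := (exists_toDH k hered).choose

lemma toDH_dpos (x : ExtIndex A) : toDH k hered (dpos k x) = pos k hered x :=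
  (exists_toDH k hered).choose_spec.1 x

lemma toDH_dneg (x : ExtIndex A) : toDH k hered (dneg k x) = neg k hered x :=
  (exists_toDH k hered).choose_spec.2 x

/-! ### Spanning of the double by ordered products -/

lemma doubleMulMap_tmul (x y : ExtHall A) :
    doubleMulMap k A (x ⊗ₜ y) = toDoublePos k A x * toDoubleNeg k A y := rfl

lemma dpos_mul_mem (x : ExtIndex A) {z : DrinfeldDouble k A}
    (hz : z ∈ LinearMap.range (doubleMulMap k A)) :
    dpos k x * z ∈ LinearMap.range (doubleMulMap k A) := by
  obtain ⟨z, rfl⟩ := hz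
  have h : ∀ a : ExtHall A, dpos k x * toDoublePos k A a ∈ LinearMap.range (toDoublePos k A) :=
    fun a => by
      induction a using Finsupp.induction_linear with
      | zero => simp
      | add a b ha hb => rw [map_add, mul_add]; exact Submodule.add_mem _ ha hb
      | single y c =>
        rw [← Finsupp.smul_single_one, map_smul, mul_smul_comm,
          toDoublePos_single, dpos_mul]
        exact Submodule.smul_mem _ _ ⟨_, rfl⟩
  induction z with
  | zero => simp
  | add z z' hz hz' => rw [map_add, mul_add]; exact Submodule.add_mem _ hz hz'
  | tmul a b =>
    obtain ⟨c, hc⟩ := h a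
    exact ⟨c ⊗ₜ b, by rw [doubleMulMap_tmul, doubleMulMap_tmul, hc, mul_assoc]⟩

lemma mul_dneg_mem (x : ExtIndex A) {z : DrinfeldDouble k A}
    (hz : z ∈ LinearMap.range (doubleMulMap k A)) :
    z * dneg k x ∈ LinearMap.range (doubleMulMap k A) := by
  obtain ⟨z, rfl⟩ := hz
  have h : ∀ a : ExtHall A, toDoubleNeg k A a * dneg k x ∈ LinearMap.range (toDoubleNeg k A) :=
    fun a => by
      induction a using Finsupp.induction_linear with
      | zero => simp
      | add a b ha hb => rw [map_add, add_mul]; exact Submodule.add_mem _ ha hb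
      | single y c =>
        rw [← Finsupp.smul_single_one, map_smul, smul_mul_assoc,
          toDoubleNeg_single, dneg_mul]
        exact Submodule.smul_mem _ _ ⟨_, rfl⟩
  induction z with
  | zero => simp
  | add z z' hz hz' => rw [map_add, add_mul]; exact Submodule.add_mem _ hz hz'
  | tmul a b =>
    obtain ⟨c, hc⟩ := h b
    exact ⟨a ⊗ₜ c, by rw [doubleMulMap_tmul, doubleMulMap_tmul, hc, mul_assoc]⟩

lemma dpos_mul_dneg_mem (x y : ExtIndex A) :
    dpos k x * dneg k y ∈ LinearMap.range (doubleMulMap k A) :=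
  ⟨Finsupp.single x 1 ⊗ₜ Finsupp.single y 1, by
    rw [doubleMulMap_tmul, toDoublePos_single, toDoubleNeg_single]⟩

/-- The cross relation expresses products in the wrong order by products in the right order, up to
products for smaller pairs of objects. -/
lemma dneg_mul_dpos_mem (hwf : WellFounded (KerCokerRel (A := A)))
    (a : IsoClasses A × IsoClasses A) (α β : K0 A) :
    dneg k (a.2, β) * dpos k (a.1, α) ∈ LinearMap.range (doubleMulMap k A) := by
  have := HomFinite.finite_hom (A := A)
  induction a using hwf.induction generalizing α β with
  | h a ih =>
    have hL : crossSum k (a.1, α) (a.2, β) (fun p q => dpos k p * dneg k q) ∈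
        LinearMap.range (doubleMulMap k A) :=
      finsum_mem_submodule (W := DrinfeldDouble k A) _ _ fun g =>
        Submodule.smul_mem _ _ (dpos_mul_dneg_mem k _ _)
    rw [dpos_dneg_cross, crossSum] at hL
    -- the term of the zero map is a multiple of the given product
    have h := mem_of_finsum_mem (W := DrinfeldDouble k A) _ _ 0 hL fun g hg =>
      Submodule.smul_mem _ _ (ih _ ⟨g, hg, rfl⟩ _ _)
    have h' := Submodule.smul_mem _ (tt k ^ (-(eulerForm k (cls (cokernel (0 : rep a.1 ⟶ rep a.2)))
      (cls (image (0 : rep a.1 ⟶ rep a.2))) + eulerForm k (cls (image (0 : rep a.1 ⟶ rep a.2)))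
      (cls (kernel (0 : rep a.1 ⟶ rep a.2))) +
      symForm k β (cls (kernel (0 : rep a.1 ⟶ rep a.2)) + α)))) h
    rw [smul_smul, ← tt_zpow_add, neg_add_cancel, zpow_zero, one_smul] at h'
    have e₁ : isoClass (cokernel (0 : rep a.1 ⟶ rep a.2)) = a.2 := by
      rw [isoClass_congr cokernelZeroIsoTarget, isoClass_rep]
    have e₂ : isoClass (kernel (0 : rep a.1 ⟶ rep a.2)) = a.1 := by
      rw [isoClass_congr kernelZeroIsoSource, isoClass_rep]
    have e₃ : cls (image (0 : rep a.1 ⟶ rep a.2)) = 0 := by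
      rw [cls_congr imageZero, cls_zero]
    rwa [e₁, e₂, e₃, zero_add] at h'

lemma doubleMulMap_surjective (hwf : WellFounded (KerCokerRel (A := A))) :
    Function.Surjective (doubleMulMap k A) := by
  have hneg : ∀ (y : ExtIndex A) {z : DrinfeldDouble k A},
      z ∈ LinearMap.range (doubleMulMap k A) →
        dneg k y * z ∈ LinearMap.range (doubleMulMap k A) := fun y z hz => by
    obtain ⟨z, rfl⟩ := hz
    induction z with
    | zero => simp
    | add z z' hz hz' => rw [map_add, mul_add]; exact Submodule.add_mem _ hz hz'
    | tmul a b =>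
      rw [doubleMulMap_tmul, ← mul_assoc]
      induction b using Finsupp.induction_linear with
      | zero => simp
      | add a b ha hb => rw [map_add, mul_add]; exact Submodule.add_mem _ ha hb
      | single x c =>
        rw [← Finsupp.smul_single_one, map_smul, mul_smul_comm,
          toDoubleNeg_single]
        refine Submodule.smul_mem _ _ (mul_dneg_mem k x ?_)
        induction a using Finsupp.induction_linear with
        | zero => simp
        | add a b ha hb => rw [map_add, mul_add]; exact Submodule.add_mem _ ha hb
        | single x c =>
          rw [← Finsupp.smul_single_one, map_smul, mul_smul_comm,
            toDoublePos_single]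
          exact Submodule.smul_mem _ _ (dneg_mul_dpos_mem k hwf (x.1, y.1) x.2 y.2)
  have hone : (1 : DrinfeldDouble k A) ∈ LinearMap.range (doubleMulMap k A) := by
    have := dpos_mul_dneg_mem k (extOne : ExtIndex A) extOne
    rwa [dpos_one, dneg_one, one_mul] at this
  have hmul : ∀ (y : DoubleFree A) {z : DrinfeldDouble k A},
      z ∈ LinearMap.range (doubleMulMap k A) →
      RingQuot.mkAlgHom ℂ (DoubleRel k A) y * z ∈ LinearMap.range (doubleMulMap k A) := fun y => by
    induction y using FreeAlgebra.induction with
    | grade0 r =>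
      intro z hz
      rw [AlgHom.commutes, ← Algebra.smul_def]
      exact Submodule.smul_mem _ _ hz
    | grade1 x =>
      rcases x with x | x
      · exact dpos_mul_mem k x
      · exact hneg x
    | mul a b ha hb =>
      intro z hz
      rw [map_mul, mul_assoc]
      exact ha (hb hz)
    | add a b ha hb =>
      intro z hz
      rw [map_add, add_mul]
      exact Submodule.add_mem _ (ha hz) (hb hz)
  intro x
  obtain ⟨y, rfl⟩ := RingQuot.mkAlgHom_surjective ℂ (DoubleRel k A) x
  have := hmul y hone
  rwa [mul_one] at this

end Double

end

noncomputable section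

open Cx

/-! ### Complexes isomorphic to their shift -/

section Shift

variable {A : Type u} [Category.{v} A] [Abelian A]

/-- A complex is isomorphic to its shift if and only if exchanging the degrees does not change its
isomorphism class: the signs in the shift can be removed by an isomorphism. -/
lemma nonempty_iso_dagger_iff (R : ProjIndex A) :
    Nonempty (repComplex R ≅ dagger (repComplex R)) ↔ (ofClass R).swap.cl = R := by
  constructor
  · rintro ⟨e⟩
    conv_rhs => rw [← cl_ofClass R]
    let e₀ : (ofClass R).X₀ ≅ (ofClass R).X₁ :=
      (HomologicalComplex.eval A (ComplexShape.up (ZMod 2)) 0).mapIso e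
    let e₁ : (ofClass R).X₁ ≅ (ofClass R).X₀ :=
      (HomologicalComplex.eval A (ComplexShape.up (ZMod 2)) 1).mapIso e
    have h₀ : e₀.hom ≫ (-(ofClass R).d₁) = (ofClass R).d₀ ≫ e₁.hom := e.hom.comm 0 1
    have h₁ : e₁.hom ≫ (-(ofClass R).d₀) = (ofClass R).d₁ ≫ e₀.hom := e.hom.comm 1 0
    let e₁' : (ofClass R).X₁ ≅ (ofClass R).X₀ := ⟨-e₁.hom, -e₁.inv, by simp, by simp⟩
    refine (cl_eq (M := ofClass R) (N := (ofClass R).swap) e₀ e₁' ?_ ?_).symm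
    · change e₀.hom ≫ (ofClass R).d₁ = (ofClass R).d₀ ≫ (-e₁.hom)
      rw [Preadditive.comp_neg, ← h₀, Preadditive.comp_neg, neg_neg]
    · change (-e₁.hom) ≫ (ofClass R).d₀ = (ofClass R).d₁ ≫ e₀.hom
      rw [← h₁, Preadditive.comp_neg, Preadditive.neg_comp]
  · intro h
    obtain ⟨e₀, e₁, h₀, h₁⟩ := exists_iso_of_cl_eq ((cl_ofClass R).trans h.symm)
    let e₁' : (ofClass R).X₁ ≅ (ofClass R).X₀ :=
      ⟨-e₁.hom, -e₁.inv,
        by rw [Preadditive.neg_comp, Preadditive.comp_neg, neg_neg]; exact e₁.hom_inv_id,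
        by rw [Preadditive.neg_comp, Preadditive.comp_neg, neg_neg]; exact e₁.inv_hom_id⟩
    exact ⟨isoZ2 (K := repComplex R) (L := dagger (repComplex R)) e₀ e₁'
      (by
        change e₀.hom ≫ (-(ofClass R).d₁) = (ofClass R).d₀ ≫ (-e₁.hom)
        rw [Preadditive.comp_neg, Preadditive.comp_neg, ← h₀])
      (by
        change (-e₁.hom) ≫ (-(ofClass R).d₀) = (ofClass R).d₁ ≫ e₀.hom
        rw [Preadditive.comp_neg, Preadditive.neg_comp, neg_neg, ← h₁])⟩

lemma cl_swap_kxkx (P : A) [Projective P] : (kxkx P P).swap.cl = (kxkx P P).cl :=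
  cl_dsum_comm (kx P).swap (kx P)

end Shift

/-! ### Comparison of the Drinfeld double with the localized Hall algebra -/

/-- The identification of the tensor square of the extended Hall algebra with `LocSpace`. -/
def tensorEquiv (A : Type u) [Category.{v} A] [Abelian A] :
    LocSpace A ≃ₗ[ℂ] ExtHall A ⊗[ℂ] ExtHall A :=
  (Finsupp.domLCongr (Equiv.prodProdProdComm _ _ _ _)).trans
    (finsuppTensorFinsupp' ℂ (ExtIndex A) (ExtIndex A)).symm

lemma tensorEquiv_single {A : Type u} [Category.{v} A] [Abelian A] (x : LocIndex A) :
    tensorEquiv A (Finsupp.single x 1) =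
    Finsupp.single (x.1.1, x.2.1) 1 ⊗ₜ Finsupp.single (x.1.2, x.2.2) 1 := by
  rw [tensorEquiv, LinearEquiv.trans_apply, Finsupp.domLCongr_single]
  exact finsuppTensorFinsupp'_symm_single_eq_single_one_tmul ℂ (ExtIndex A) (ExtIndex A) _ _

section Comparison

variable (k : Type w) [Field k] {A : Type u} [Category.{v} A] [Abelian A] [Linear k A]
  [Finite k] [HomFinite A] [EnoughProjectives A] [FiniteGlobalDimension A]
  (hered : Hereditary A)

/-- The coordinates in `LocSpace` of a product of a positive and a negative basis element. -/
def posNegCoord (x : LocIndex A) : LocSpace A :=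
  tt k ^ symForm k x.2.1 (chiOf (isoClass 0, x.1.2)) •
    ∑ᶠ f : rep x.1.1 ⟶ rep x.1.2,
      tt k ^ (-eulerForm k (cls (rep x.1.1) - cls (rep x.1.2)) (imCls f)) •
        Finsupp.single ((isoClass (kernel f), isoClass (cokernel f)),
          (x.2.1, imCls f + x.2.2)) 1

lemma ofLoc_posNegCoord (x : LocIndex A) : ofLoc k hered (posNegCoord k x) =
    pos k hered (x.1.1, x.2.1) * neg k hered (x.1.2, x.2.2) := by
  have := HomFinite.finite_hom (A := A)
  obtain ⟨⟨a, b⟩, α, β⟩ := x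
  have h := xx_mul_xx_mixed k hered (rep a) (rep b)
  rw [isoClass_rep, isoClass_rep] at h
  rw [pos, neg, mul_assoc, ← mul_assoc (kp k hered _), kp_mul_xx, smul_mul_assoc, mul_smul_comm,
    mul_assoc, ← mul_assoc (xx k hered _), h, finsum_mul' (B := DH A k), posNegCoord, map_smul,
    map_finsum']
  congr 1
  refine finsum_congr fun f => ?_
  rw [map_smul, ofLoc_single, smul_mul_assoc, mul_assoc]
  congr 2
  rw [← kpm_snd, show kp k hered α * km k hered β = kpm k hered (α, β) from rfl, ← kpm_add,
    Prod.mk_add_mk, zero_add]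

/-- Triangularity: the zero map contributes a multiple of the basis vector, the other maps
contribute smaller basis vectors. -/
lemma posNegCoord_sub_mem (x : LocIndex A) :
    posNegCoord k x - tt k ^ symForm k x.2.1 (chiOf (isoClass 0, x.1.2)) • Finsupp.single x 1 ∈
      Finsupp.supported ℂ ℂ {y : LocIndex A | KerCokerRel y.1 x.1} := by
  have := HomFinite.finite_hom (A := A)
  rw [posNegCoord, ← smul_sub]
  refine Submodule.smul_mem _ _ ?_
  have h := finsum_sub_mem_submodule (Finsupp.supported ℂ ℂ {y : LocIndex A | KerCokerRel y.1 x.1})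
    (fun f : rep x.1.1 ⟶ rep x.1.2 =>
      tt k ^ (-eulerForm k (cls (rep x.1.1) - cls (rep x.1.2)) (imCls f)) •
        Finsupp.single ((isoClass (kernel f), isoClass (cokernel f)),
          (x.2.1, imCls f + x.2.2)) 1) 0
    fun f hf => Submodule.smul_mem _ _ (Finsupp.single_mem_supported ℂ 1 ⟨f, hf, rfl⟩)
  have e₁ : isoClass (cokernel (0 : rep x.1.1 ⟶ rep x.1.2)) = x.1.2 := by
    rw [isoClass_congr cokernelZeroIsoTarget, isoClass_rep]
  have e₂ : isoClass (kernel (0 : rep x.1.1 ⟶ rep x.1.2)) = x.1.1 := by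
    rw [isoClass_congr kernelZeroIsoSource, isoClass_rep]
  have e₃ : imCls (0 : rep x.1.1 ⟶ rep x.1.2) = 0 := by
    rw [imCls_eq, cls_congr imageZero, cls_zero]
  rwa [e₁, e₂, e₃, map_zero, neg_zero, zpow_zero, one_smul, zero_add] at h

lemma toDH_doubleMulMap_bijective (hwf : WellFounded (KerCokerRel (A := A))) :
    Function.Bijective fun z => toDH k hered (doubleMulMap k A z) := by
  let T : LocSpace A →ₗ[ℂ] LocSpace A := (locEquiv k hered).symm.toLinearMap ∘ₗ
    (toDH k hered).toLinearMap ∘ₗ doubleMulMap k A ∘ₗ (tensorEquiv A).toLinearMap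
  have hT : ∀ x, T (Finsupp.single x 1) = posNegCoord k x := fun x => by
    apply (locEquiv k hered).injective
    change locEquiv k hered ((locEquiv k hered).symm
      (toDH k hered (doubleMulMap k A (tensorEquiv A (Finsupp.single x 1))))) = _
    rw [LinearEquiv.apply_symm_apply, tensorEquiv_single, doubleMulMap_tmul, toDoublePos_single,
      toDoubleNeg_single, map_mul, toDH_dpos, toDH_dneg, locEquiv_apply, ofLoc_posNegCoord]
  have hb : Function.Bijective T := bijective_of_triangular
    (r := InvImage KerCokerRel Prod.fst) (InvImage.wf _ hwf) T
    (fun x => tt k ^ symForm k x.2.1 (chiOf (isoClass 0, x.1.2)))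
    (fun x => tt_zpow_ne_zero k _) fun x => by
      rw [hT]
      exact posNegCoord_sub_mem k x
  have h : (fun z => toDH k hered (doubleMulMap k A z)) =
      locEquiv k hered ∘ T ∘ (tensorEquiv A).symm := by
    funext z
    simp [T]
  rw [h]
  exact (locEquiv k hered).bijective.comp (hb.comp (tensorEquiv A).symm.bijective)

lemma doubleMulMap_bijective (hered : Hereditary A) (hwf : WellFounded (KerCokerRel (A := A))) :
    Function.Bijective (doubleMulMap k A) :=
  ⟨Function.Injective.of_comp (f := toDH k hered) (toDH_doubleMulMap_bijective k hered hwf).1,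
    doubleMulMap_surjective k hwf⟩

lemma toDH_bijective (hwf : WellFounded (KerCokerRel (A := A))) :
    Function.Bijective (toDH k hered) :=
  (Function.Bijective.of_comp_iff _ (doubleMulMap_bijective k hered hwf)).1
    (toDH_doubleMulMap_bijective k hered hwf)

/-- The Drinfeld double is isomorphic to the localized Hall algebra. -/
def toDHEquiv (hwf : WellFounded (KerCokerRel (A := A))) : DrinfeldDouble k A ≃ₐ[ℂ] DH A k :=
  AlgEquiv.ofBijective (toDH k hered) (toDH_bijective k hered hwf)

/-! ### The reduced algebras -/

lemma toDH_torus (α : K0 A) :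
    toDH k hered (toDoublePos k A (Finsupp.single (isoClass 0, α) 1) *
      toDoubleNeg k A (Finsupp.single (isoClass 0, α) 1)) =
      kp k hered α * km k hered α := by
  rw [map_mul, toDoublePos_single, toDoubleNeg_single, toDH_dpos, toDH_dneg, pos, neg, xx_zero,
    one_mul, one_mul]

/-- The class of an acyclic complex that is isomorphic to its shift is some `K_α K'_α`. -/
lemma gen_of_acyclic {R : AcyclicIndex A} (h : (ofClass R.1).swap.cl = R.1) :
    ∃ α : K0 A, gen k (Finsupp.single R.1 1) = kp k hered α * km k hered α := by
  have hR : (ofClass R.1).hom = (isoClass 0, isoClass 0) :=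
    (acyclic_iff _).1 (by rw [cl_ofClass]; exact R.2)
  have hb : (ofClass R.1).bd₁ = (ofClass R.1).bd₀ := by
    have hc : (ofClass R.1).cl = (ofClass R.1).swap.cl := (cl_ofClass R.1).trans h.symm
    have := bd₁_congr hc
    rwa [swap_bd₁] at this
  refine ⟨(ofClass R.1).bd₀, ?_⟩
  have hg := gen_bas k hered (ofClass R.1)
  rw [bas, cl_ofClass, hR, xx_zero, one_mul, Cx.wt, hb, sub_self, map_zero, zpow_zero,
    one_smul, Cx.bd, hb] at hg
  exact hg

/-- The quotient map to the reduced localized Hall algebra. -/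
def redDH : DH A k →ₐ[ℂ] ReducedDH A k := RingQuot.mkAlgHom ℂ (ReducedDHRel A k)

/-- It suffices to treat the contractible complexes on projectives, whose classes generate. -/
lemma redDH_torus (α : K0 A) : redDH k (kp k hered α * km k hered α) = 1 := by
  have h : ∀ (P : A) [Projective P], redDH k (kpm k hered (cls P, cls P)) = 1 := fun P _ => by
    have hs : (ofClass (kxkx P P).cl).swap.cl = (kxkx P P).cl :=
      (swapIndex_cl (kxkx P P)).trans (cl_swap_kxkx P)
    have hr := RingQuot.mkAlgHom_rel ℂ (ReducedDHRel.shift (k := k)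
      (⟨(kxkx P P).cl, (acyclic_iff _).2 (hom_kxkx P P)⟩ : AcyclicIndex A)
      ((nonempty_iso_dagger_iff _).2 hs))
    rw [← gen_single, map_one] at hr
    rw [kpm, kp_cls, km_cls, ← gen_hallMul, hallMul_kx_swap_kx]
    exact hr
  have hneg : ∀ (P : A) [Projective P], redDH k (kpm k hered (-(cls P, cls P))) = 1 :=
    fun P _ => by
      have := congrArg (redDH k) (kpm_mul_neg k hered (cls P, cls P))
      rwa [map_mul, h P, one_mul, map_one] at this
  obtain ⟨P, Q, _, _, rfl⟩ := hered.exists_sub α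
  have e : kp k hered (cls P - cls Q) * km k hered (cls P - cls Q) =
      kpm k hered (cls P, cls P) * kpm k hered (-(cls Q, cls Q)) := by
    rw [← kpm_add]
    simp [kpm, sub_eq_add_neg]
  rw [e, map_mul, h, hneg, one_mul]

/-- The quotient map to the reduced Drinfeld double. -/
def redDouble : DrinfeldDouble k A →ₐ[ℂ] ReducedDrinfeldDouble k A :=
  RingQuot.mkAlgHom ℂ (ReducedDoubleRel k A)

/-- The homomorphism `toDH` descends to the reduced algebras. -/
lemma exists_reducedToDH : ∃ f : ReducedDrinfeldDouble k A →ₐ[ℂ] ReducedDH A k,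
    ∀ x, f (redDouble k x) = redDH k (toDH k hered x) := by
  refine ⟨RingQuot.liftAlgHom ℂ ⟨(redDH k).comp (toDH k hered), fun x y h => ?_⟩,
    fun x => RingQuot.liftAlgHom_mkAlgHom_apply ℂ _ _ _⟩
  cases h with
  | torus α => rw [AlgHom.comp_apply, toDH_torus, redDH_torus, map_one]

/-- The inverse of `toDH` descends to the reduced algebras. -/
lemma exists_reducedOfDH (hwf : WellFounded (KerCokerRel (A := A))) :
    ∃ f : ReducedDH A k →ₐ[ℂ] ReducedDrinfeldDouble k A,
      ∀ x, f (redDH k x) = redDouble k ((toDHEquiv k hered hwf).symm x) := by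
  refine ⟨RingQuot.liftAlgHom ℂ ⟨(redDouble k).comp
    (toDHEquiv k hered hwf).symm.toAlgHom, fun x y h => ?_⟩,
    fun x => RingQuot.liftAlgHom_mkAlgHom_apply ℂ _ _ _⟩
  cases h with
  | shift R h =>
    obtain ⟨α, hα⟩ := gen_of_acyclic k hered ((nonempty_iso_dagger_iff _).1 h)
    rw [← gen_single, hα, map_one]
    have e : (toDHEquiv k hered hwf).symm (kp k hered α * km k hered α) =
        toDoublePos k A (Finsupp.single (isoClass 0, α) 1) *
          toDoubleNeg k A (Finsupp.single (isoClass 0, α) 1) := by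
      rw [AlgEquiv.symm_apply_eq, ← toDH_torus k hered]
      rfl
    refine (congrArg (redDouble k) e).trans ?_
    rw [redDouble, RingQuot.mkAlgHom_rel ℂ (ReducedDoubleRel.torus α), map_one]

lemma nonempty_reducedEquiv (hered : Hereditary A) (hwf : WellFounded (KerCokerRel (A := A))) :
    Nonempty (ReducedDH A k ≃ₐ[ℂ] ReducedDrinfeldDouble k A) := by
  obtain ⟨f, hf⟩ := exists_reducedToDH k hered
  obtain ⟨g, hg⟩ := exists_reducedOfDH k hered hwf
  have h₁ : ∀ x, toDH k hered ((toDHEquiv k hered hwf).symm x) = x :=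
    (toDHEquiv k hered hwf).apply_symm_apply
  have h₂ : ∀ x, (toDHEquiv k hered hwf).symm (toDH k hered x) = x :=
    (toDHEquiv k hered hwf).symm_apply_apply
  refine ⟨AlgEquiv.ofAlgHom g f ?_ ?_⟩
  · refine RingQuot.ringQuot_ext' ℂ _ _ (AlgHom.ext fun x => ?_)
    change g (f (redDouble k x)) = redDouble k x
    rw [hf, hg, h₂]
  · refine RingQuot.ringQuot_ext' ℂ _ _ (AlgHom.ext fun x => ?_)
    change f (g (redDH k x)) = redDH k x
    rw [hg, hf, h₁]

end Comparison

end

end HallDouble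

theorem theorem2 {k : Type w} [Field k] [Finite k]
    {A : Type u} [Category.{v} A] [Abelian A] [Linear k A]
    [HallDouble.HomFinite A] [EnoughProjectives A] [HallDouble.FiniteGlobalDimension A]
    (hereditary : HallDouble.Hereditary A)
    (nonzero : ∀ X : A, ¬ IsZero X → HallDouble.cls X ≠ 0)
    (finiteness : (∀ X : A, IsArtinianObject X) ∨ (∀ X : A, IsNoetherianObject X)) :
    Function.Bijective (HallDouble.doubleMulMap k A) ∧
    Nonempty (HallDouble.DH A k ≃ₐ[ℂ] HallDouble.DrinfeldDouble k A) ∧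
    Nonempty (HallDouble.ReducedDH A k ≃ₐ[ℂ] HallDouble.ReducedDrinfeldDouble k A) := by
  have hwf := HallDouble.wellFounded_kerCokerRel finiteness
  exact ⟨HallDouble.doubleMulMap_bijective k hereditary hwf,
    ⟨(HallDouble.toDHEquiv k hereditary hwf).symm⟩,
    HallDouble.nonempty_reducedEquiv k hereditary hwf⟩
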